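/- **Setting.** A partition of $[0,1]$ is a finite set $\{0=t_0<t_1<\dots<t_N=1\}$; $|P|$ and $\underline{P}$ denote the lengths of the largest and of the smallest interval of a partition $P$. Let $\pi=(\pi^n)_{n\ge 0}$ be a sequence of partitions of $[0,1]$ with $\pi^0=\{0,1\}$ which is * *balanced*: there is $c>1$ with $|\pi^n|/\underline{\pi^n}\le c$ for all $n\ge1$; * *complete refining*: $\pi^m\subseteq\pi^n$ for $m\le n$, and there are $a,b>0$ with $1+a\le |\pi^n|/|\pi^{n+1}|\le b$ for all $n\ge1$. For $m\ge0$ let $I_m$ index the points of $\pi^{m+1}\setminus\pi^m$. For $k\in I_m$ let $t_2=t_2^{m,k}$ be the corresponding point, let $t_1=t_1^{m,k}$ be the largest point of $\pi^m$ below $t_2$, and let $t_3=t_3^{m,k}$ be the smallest point of $\pi^{m+1}$ above $t_2$. The Schauder function $e^\pi_{m,k}$ is $$e^\pi_{m,k}(t)=\begin{cases}\Big(\frac{t_3-t_2}{t_2-t_1}\cdot\frac1{t_3-t_1}\Big)^{1/2}(t-t_1),& t\in[t_1,t_2),\\ \Big(\frac{t_2-t_1}{t_3-t_2}\cdot\frac1{t_3-t_1}\Big)^{1/2}(t_3-t),&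 t\in[t_2,t_3),\\ 0,&\text{otherwise,}\end{cases}$$ and the Schauder coefficients of a continuous function $x$ on $[0,1]$ are $$\theta^{x}_{m,k}=\frac{(x(t_2)-x(t_1))(t_3-t_2)-(x(t_3)-x(t_2))(t_2-t_1)}{\sqrt{(t_2-t_1)(t_3-t_2)(t_3-t_1)}}.$$ For a sequence $\nu=(\nu^n)$ of partitions and a continuous function $x$ on $[0,1]$ we write $[x]^{(2)}_\nu=q$ if $q$ is continuous on $[0,1]$ and $\sum_{t_j,t_{j+1}\in\nu^n,\ t_j\le t}|x(t_{j+1})-x(t_j)|^2\to q(t)$ uniformly in $t\in[0,1]$ as $n\to\infty$ (the sum is over pairs of consecutive points of $\nu^n$). A sequence $\nu$ of partitions is a *coarsening* of $\pi$ if $\nu^n\subseteq\pi^n$ for all $n$, $|\nu^n|\to0$, and $\nu$ is itself refining ($\nu^m\subseteq\nu^n$ for $m\le n$) or, if it is not, $\sum_n|\nu^n|<\infty$. (The latter covers, for instance, all subpartitions with $|\nu^n|\le C|\pi^n|^\beta$ for some $C,\beta>0$.) **Theorem (construction of fake Brownian motion).** Let $\{\theta_{m,k}\}_{m\ge0,\,k\in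 I_m}$ be independent random variables such that * (a) $\mathbb E[\theta_{m,k}]=0$ and $\operatorname{Var}[\theta_{m,k}]=1$; * (b) there are $C_1,C_2>0$ with $\mathbb P[|\theta_{m,k}|\ge\delta]\le C_1\exp(-\delta^2/(2C_2))$ for all $\delta>0$, $m\ge 0$, $k\in I_m$. Let $Z$ be a random variable with mean $0$ and variance $1$ (for instance a standard normal one), independent of the family $\{\theta_{m,k}\}$, and let $$Y(t)=Zt+\sum_{m=0}^\infty\sum_{k\in I_m}\theta_{m,k}\,e^\pi_{m,k}(t),\qquad t\in[0,1].$$ Then: 1. Almost surely the series converges uniformly on $[0,1]$ and $Y$ has a continuous path. 2. $Y(t)$ is square integrable, $\mathbb E[Y(t)]=0$ and $\mathbb E[Y(t)Y(s)]=t\wedge s$ for all $s,t\in[0,1]$. 3. $\mathbb E[(Y(t)-Y(s))(Y(v)-Y(u))]=0$ for all $0\le s\le t\le u\le v\le1$. 4. Almost every path of $Y$ belongs to $C^{\frac12-}([0,1],\mathbb R)$, that is, it is $\alpha$-Hölder continuous on $[0,1]$ for every $0\le\alpha<\frac12$. 5. Almost surely the Schauder coefficients of the path $Y$ along $\pi$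 are $\theta^Y_{m,k}=\theta_{m,k}$ for all $m,k$; they have mean $0$ and variance $1$ and are uncorrelated, i.e. $\mathbb E[\theta^Y_{m,k}\theta^Y_{m',k'}]=\mathbb 1_{m=m'}\mathbb 1_{k=k'}$. If moreover (c) $\mathbb E[\theta_{m,k}^4]<\infty$ for all $m,k$, then: 6. Almost surely $[Y]^{(2)}_\pi(t)=t$ for every $t\in[0,1]$. 7. For every coarsening $\nu$ of $\pi$, almost surely $[Y]^{(2)}_\nu(t)=t$ for every $t\in[0,1]$. -/

import Mathlib

open Set Filter Topology MeasureTheory ProbabilityTheory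
open scoped NNReal

noncomputable section

/-- A finite partition `0 = t_0 < t_1 < ⋯ < t_N = 1` of `[0,1]`, given by its set of points. -/
def IsPartition (P : Finset ℝ) : Prop :=
  (0 : ℝ) ∈ P ∧ (1 : ℝ) ∈ P ∧ ∀ x ∈ P, x ∈ Icc (0 : ℝ) 1

/-- `s < t` are two consecutive points of `P`. -/
def Consecutive (P : Finset ℝ) (s t : ℝ) : Prop :=
  s ∈ P ∧ t ∈ P ∧ s < t ∧ ∀ r ∈ P, ¬ (s < r ∧ r < t)

/-- The size of the largest interval of `P`. -/
def mesh (P : Finset ℝ) : ℝ :=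
  sSup {d : ℝ | ∃ s t, Consecutive P s t ∧ d = t - s}

/-- The size of the smallest interval of `P`. -/
def minMesh (P : Finset ℝ) : ℝ :=
  sInf {d : ℝ | ∃ s t, Consecutive P s t ∧ d = t - s}

/-- The largest point of `P` to the left of `t`. -/
def prevPt (P : Finset ℝ) (t : ℝ) : ℝ := sSup {q : ℝ | q ∈ P ∧ q < t}

/-- The smallest point of `P` to the right of `t`. -/
def nextPt (P : Finset ℝ) (t : ℝ) : ℝ := sInf {q : ℝ | q ∈ P ∧ t < q}

/-- A sequence of partitions of `[0,1]`, with the convention that the zeroth one is `{0, 1}`. -/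
structure PartitionSeq where
  pts : ℕ → Finset ℝ
  isPartition : ∀ n, IsPartition (pts n)
  pts_zero : pts 0 = {0, 1}

namespace PartitionSeq

/-- Refining (nested). -/
def Refining (π : PartitionSeq) : Prop :=
  ∀ m n, m ≤ n → π.pts m ⊆ π.pts n

def VanishingMesh (π : PartitionSeq) : Prop :=
  Tendsto (fun n => mesh (π.pts n)) atTop (𝓝 0)

/-- Balanced; the condition concerns the partitions `π¹, π², …`. -/
def Balanced (π : PartitionSeq) : Prop :=
  ∃ c : ℝ, 1 < c ∧ ∀ n, 1 ≤ n → mesh (π.pts n) / minMesh (π.pts n) ≤ c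

/-- Complete refining; the condition concerns the partitions `π¹, π², …`. -/
def CompleteRefining (π : PartitionSeq) : Prop :=
  π.Refining ∧ ∃ a b : ℝ, 0 < a ∧ 0 < b ∧ ∀ n, 1 ≤ n →
    1 + a ≤ mesh (π.pts n) / mesh (π.pts (n + 1)) ∧
      mesh (π.pts n) / mesh (π.pts (n + 1)) ≤ b

/-- `ν` is a coarsening of `π`: each `νⁿ` is a subpartition of `πⁿ`, the mesh of `νⁿ` tends to `0`,
and `ν` is either itself refining, or else (for sequences that are not nested) its meshes are
summable.  The second alternative covers for instance the balanced subpartitions with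
`|νⁿ| ≍ |πⁿ|^β`, `0 < β ≤ 1`, when `|πⁿ|` decays exponentially. -/
def IsCoarsening (ν π : PartitionSeq) : Prop :=
  (∀ n, ν.pts n ⊆ π.pts n) ∧ ν.VanishingMesh ∧
    (ν.Refining ∨ Summable (fun n => mesh (ν.pts n)))

/-- The level-`m` index set of the Schauder functions.  The generalized Haar and Schauder functions
of level `m` correspond one to one to the points of `π^{m+1}` that are not in `π^m`: such a point is
the point where the Schauder function attains its maximum. -/
abbrev LevelIndex (π : PartitionSeq) (m : ℕ) : Type :=
  {q : ℝ // q ∈ π.pts (m + 1) \ π.pts m}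

/-- All Schauder indices `(m, k)`. -/
abbrev SchauderIndex (π : PartitionSeq) : Type := Σ m : ℕ, π.LevelIndex m

/-- Left end point of the support of a Schauder function: the left end of the interval of `π^m`
that contains the peak. -/
def suppLeft (π : PartitionSeq) (i : π.SchauderIndex) : ℝ := prevPt (π.pts i.1) i.2.1

/-- Peak of a Schauder function. -/
def peak (π : PartitionSeq) (i : π.SchauderIndex) : ℝ := i.2.1

/-- Right end point of the support of a Schauder function: the point of `π^{m+1}` that follows the
peak. -/
def suppRight (π : PartitionSeq) (i : π.SchauderIndex) : ℝ := nextPt (π.pts (i.1 + 1)) i.2.1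

/-- The Schauder function, the primitive of the generalized Haar function. -/
def schauderFun (π : PartitionSeq) (i : π.SchauderIndex) (t : ℝ) : ℝ :=
  let t₁ := π.suppLeft i
  let t₂ := π.peak i
  let t₃ := π.suppRight i
  if t₁ ≤ t ∧ t < t₂ then
    Real.sqrt ((t₃ - t₂) / (t₂ - t₁) * (1 / (t₃ - t₁))) * (t - t₁)
  else if t₂ ≤ t ∧ t < t₃ then
    Real.sqrt ((t₂ - t₁) / (t₃ - t₂) * (1 / (t₃ - t₁))) * (t₃ - t)
  else 0

/-- The Schauder coefficient of a function `x` along `π`, in closed form. -/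
def schauderCoeff (π : PartitionSeq) (x : ℝ → ℝ) (i : π.SchauderIndex) : ℝ :=
  let t₁ := π.suppLeft i
  let t₂ := π.peak i
  let t₃ := π.suppRight i
  ((x t₂ - x t₁) * (t₃ - t₂) - (x t₃ - x t₂) * (t₂ - t₁)) /
    Real.sqrt ((t₂ - t₁) * (t₃ - t₂) * (t₃ - t₁))

/-- The contribution of level `m` to a Schauder series. -/
def schauderLevel (π : PartitionSeq) (θ : π.SchauderIndex → ℝ) (m : ℕ) (t : ℝ) : ℝ :=
  ∑ k : π.LevelIndex m, θ ⟨m, k⟩ * π.schauderFun ⟨m, k⟩ t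

/-- The Schauder representation with linear part `z t`, truncated after the first `n` levels. -/
def schauderTrunc (π : PartitionSeq) (z : ℝ) (θ : π.SchauderIndex → ℝ) (n : ℕ) (t : ℝ) : ℝ :=
  z * t + ∑ m ∈ Finset.range n, π.schauderLevel θ m t

/-- The full Schauder series `z t + ∑ₘ ∑ₖ θ_{m,k} e_{m,k}(t)`. -/
def schauderSeries (π : PartitionSeq) (z : ℝ) (θ : π.SchauderIndex → ℝ) (t : ℝ) : ℝ :=
  z * t + ∑' m : ℕ, π.schauderLevel θ m t

end PartitionSeq

/-- The process `Y(t) = Z t + ∑ₘ ∑ₖ θ_{m,k} e_{m,k}(t)`. -/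
def schauderProcess {Ω : Type*} (π : PartitionSeq) (Z : Ω → ℝ) (θ : π.SchauderIndex → Ω → ℝ)
    (t : ℝ) (ω : Ω) : ℝ :=
  π.schauderSeries (Z ω) (fun i => θ i ω) t

/-- The sum of `|x(t_{j+1}) - x(t_j)|²` over the intervals of `P` with `t_j ≤ t`. -/
def quadVarSum (P : Finset ℝ) (x : ℝ → ℝ) (t : ℝ) : ℝ :=
  ∑ s ∈ P with s < 1 ∧ s ≤ t, |x (nextPt P s) - x s| ^ 2

/-- The continuous function `x` on `[0,1]` has quadratic variation `q` along `ν`: the function `q`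
is continuous and is the uniform limit of the sums of squared increments. -/
def HasQuadVar (ν : PartitionSeq) (x q : ℝ → ℝ) : Prop :=
  ContinuousOn x (Icc 0 1) ∧ ContinuousOn q (Icc 0 1) ∧
    TendstoUniformlyOn (fun n t => quadVarSum (ν.pts n) x t) q atTop (Icc 0 1)

end

/-!
The Schauder functions `e_i` are primitives of an orthonormal (generalized Haar) system of
`L²[0, 1]`. The two facts used about them are biorthogonality to the coefficient functionals
(`schauderCoeff_schauderFun`) and Parseval's identity `s t + ∑ e_i(s) e_i(t) = min s t` on the grids
(`sum_schauderFun_mul`). Both follow from ordering the Schauder functions by level, and within a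
level from right to left: the functions then add one partition point at a time, each in the middle
of a gap left by its predecessors.

Balance and complete refinement make the mesh of `π^m` geometric in `m`, with boundedly many active
Schauder functions of each level at each time and exponentially many in total
(`exists_geometricBounds`). By the sub-Gaussian tails and the Borel-Cantelli lemma the coefficients
of level `m` are almost surely `O(m)`, which gives uniform convergence, continuity and Hölder
continuity below exponent `1/2`. A majorant in `L²` allows passing to the limit in means and
covariances. At grid points the series is a finite sum, so the Schauder coefficients can be read off
for every path.

For the quadratic variation along a coarsening `ν`, drop the linear part, whose contribution
vanishes in the limit. The sum of squared increments along `ν^n` is then a quadratic form in the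
independent coefficients, with matrix `A_n = ∑_J v_J v_Jᵀ` over the gaps `J` of `ν^n`. Centred by its
trace, its fourth moment is at most `C ‖A_n‖⁴` in Frobenius norm
(`fourth_moment_quadraticForm_le`), and by Parseval's identity `‖A_n‖²` is at most the area `a_n` of
the union of the squares `J × J`, which is at most the mesh. If the meshes are summable, this alone
gives almost sure convergence. If `ν` is refining, these unions decrease and
`‖A_n - A_m‖² ≤ a_m - a_n` for `m ≤ n` (`frobenius_qvMatrix_sub_le`), so that the centred sums satisfy
Kolmogorov's moment criterion with respect to the clock `a_n`, however slowly it decreases; a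
maximal inequality (`exists_maximal_bound`) then gives almost sure convergence
(`ae_tendsto_zero_of_clock`). Monotonicity in time upgrades pointwise to uniform convergence.
-/

noncomputable section

/-! ### Partitions and their gaps -/

namespace IsPartition

theorem nextPt_spec {P : Finset ℝ} (hP : IsPartition P) {t : ℝ} (ht : t < 1) :
    nextPt P t ∈ P ∧ t < nextPt P t ∧ ∀ r ∈ P, t < r → nextPt P t ≤ r := by
  have hfin : {q : ℝ | q ∈ P ∧ t < q}.Finite := P.finite_toSet.subset fun q hq => hq.1
  have hne : {q : ℝ | q ∈ P ∧ t < q}.Nonempty := ⟨1, hP.2.1, ht⟩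
  have hmem : nextPt P t ∈ {q : ℝ | q ∈ P ∧ t < q} := hne.csInf_mem hfin
  exact ⟨hmem.1, hmem.2, fun r hr htr => csInf_le hfin.bddBelow ⟨hr, htr⟩⟩

theorem prevPt_spec {P : Finset ℝ} (hP : IsPartition P) {t : ℝ} (ht : 0 < t) :
    prevPt P t ∈ P ∧ prevPt P t < t ∧ ∀ r ∈ P, r < t → r ≤ prevPt P t := by
  have hfin : {q : ℝ | q ∈ P ∧ q < t}.Finite := P.finite_toSet.subset fun q hq => hq.1
  have hne : {q : ℝ | q ∈ P ∧ q < t}.Nonempty := ⟨0, hP.1, ht⟩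
  have hmem : prevPt P t ∈ {q : ℝ | q ∈ P ∧ q < t} := hne.csSup_mem hfin
  exact ⟨hmem.1, hmem.2, fun r hr htr => le_csSup hfin.bddAbove ⟨hr, htr⟩⟩

theorem consecutive_nextPt {P : Finset ℝ} (hP : IsPartition P) {s : ℝ} (hs : s ∈ P)
    (hs1 : s < 1) : Consecutive P s (nextPt P s) := by
  obtain ⟨h1, h2, h3⟩ := hP.nextPt_spec hs1
  exact ⟨hs, h1, h2, fun r hr h => (h3 r hr h.1).not_gt h.2⟩

theorem finite_gaps (P : Finset ℝ) :
    {d : ℝ | ∃ s t, Consecutive P s t ∧ d = t - s}.Finite := by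
  refine ((P ×ˢ P).finite_toSet.image fun p => p.2 - p.1).subset ?_
  rintro d ⟨s, t, h, rfl⟩
  exact ⟨(s, t), by simpa using ⟨h.1, h.2.1⟩, rfl⟩

theorem gap_le_mesh {P : Finset ℝ} {s t : ℝ} (h : Consecutive P s t) : t - s ≤ mesh P :=
  le_csSup (finite_gaps P).bddAbove ⟨s, t, h, rfl⟩

theorem minMesh_le_gap {P : Finset ℝ} {s t : ℝ} (h : Consecutive P s t) : minMesh P ≤ t - s :=
  csInf_le (finite_gaps P).bddBelow ⟨s, t, h, rfl⟩

theorem nonempty_gaps {P : Finset ℝ} (hP : IsPartition P) :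
    {d : ℝ | ∃ s t, Consecutive P s t ∧ d = t - s}.Nonempty :=
  ⟨_, 0, _, hP.consecutive_nextPt hP.1 one_pos, rfl⟩

theorem minMesh_pos {P : Finset ℝ} (hP : IsPartition P) : 0 < minMesh P := by
  obtain ⟨s, t, h, hd⟩ := hP.nonempty_gaps.csInf_mem (finite_gaps P)
  have : minMesh P = t - s := hd
  linarith [h.2.2.1]

theorem minMesh_le_mesh {P : Finset ℝ} (hP : IsPartition P) : minMesh P ≤ mesh P :=
  have h := hP.consecutive_nextPt hP.1 one_pos
  (minMesh_le_gap h).trans (gap_le_mesh h)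

theorem mesh_pos {P : Finset ℝ} (hP : IsPartition P) : 0 < mesh P :=
  hP.minMesh_pos.trans_le hP.minMesh_le_mesh

theorem mesh_le_one {P : Finset ℝ} (hP : IsPartition P) : mesh P ≤ 1 := by
  refine csSup_le hP.nonempty_gaps ?_
  rintro d ⟨s, t, h, rfl⟩
  linarith [(hP.2.2 s h.1).1, (hP.2.2 t h.2.1).2]

theorem nextPt_sub_le {P : Finset ℝ} (hP : IsPartition P) {t : ℝ} (h0 : 0 ≤ t) (h1 : t < 1) :
    nextPt P t - t ≤ mesh P := by
  by_cases ht : t ∈ P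
  · exact gap_le_mesh (hP.consecutive_nextPt ht h1)
  have ht0 : 0 < t := lt_of_le_of_ne h0 fun h => ht (h ▸ hP.1)
  obtain ⟨a1, a2, a3⟩ := hP.prevPt_spec ht0
  obtain ⟨b1, b2, b3⟩ := hP.nextPt_spec h1
  have : Consecutive P (prevPt P t) (nextPt P t) := by
    refine ⟨a1, b1, a2.trans b2, fun r hr h => ?_⟩
    rcases lt_trichotomy r t with hrt | rfl | hrt
    · exact (a3 r hr hrt).not_gt h.1
    · exact ht hr
    · exact (b3 r hr hrt).not_gt h.2
  linarith [gap_le_mesh this]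

/-- Increments over the gaps to the left of a partition point telescope. -/
theorem sum_increments {P : Finset ℝ} (hP : IsPartition P) (f : ℝ → ℝ) {u : ℝ} (hu : u ∈ P) :
    ∑ s ∈ P with s < u, (f (nextPt P s) - f s) = f u - f 0 := by
  induction h : (P.filter (· < u)).card using Nat.strong_induction_on generalizing u with
  | _ n ih =>
    rcases eq_or_lt_of_le (hP.2.2 u hu).1 with h0 | h0
    · subst h0
      rw [Finset.filter_false_of_mem fun s hs => not_lt.2 (hP.2.2 s hs).1]
      simp
    obtain ⟨a1, a2, a3⟩ := hP.prevPt_spec h0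
    set p := prevPt P u
    have hp1 : p < 1 := a2.trans_le (hP.2.2 u hu).2
    obtain ⟨b1, b2, b3⟩ := hP.nextPt_spec hp1
    have hnext : nextPt P p = u := by
      refine le_antisymm (b3 u hu a2) (not_lt.1 fun hlt => ?_)
      exact (a3 _ b1 hlt).not_gt b2
    have hset : P.filter (· < u) = insert p (P.filter (· < p)) := by
      ext s
      simp only [Finset.mem_filter, Finset.mem_insert]
      constructor
      · rintro ⟨hs, hsu⟩
        rcases eq_or_lt_of_le (a3 s hs hsu) with h | h
        · exact Or.inl h
        · exact Or.inr ⟨hs, h⟩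
      · rintro (rfl | ⟨hs, hsp⟩)
        · exact ⟨a1, a2⟩
        · exact ⟨hs, hsp.trans a2⟩
    have hnot : p ∉ P.filter (· < p) := by simp
    have hcard : (P.filter (· < p)).card < n := by
      rw [← h, hset, Finset.card_insert_of_notMem hnot]; exact Nat.lt_succ_self _
    rw [hset, Finset.sum_insert hnot, ih _ hcard a1 rfl, hnext]
    ring

theorem card_mul_minMesh_le {P : Finset ℝ} (hP : IsPartition P) {l r : ℝ} (hl : l ∈ P)
    (hr : r ∈ P) (hlr : l ≤ r) :
    ((P.filter fun s => l ≤ s ∧ s < r).card : ℝ) * minMesh P ≤ r - l := by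
  have h1 := hP.sum_increments (fun x => x) hr
  have h2 := hP.sum_increments (fun x => x) hl
  have hsplit : P.filter (· < r) =
      (P.filter (· < l)) ∪ (P.filter fun s => l ≤ s ∧ s < r) := by
    ext s
    simp only [Finset.mem_filter, Finset.mem_union]
    constructor
    · rintro ⟨hs, hsr⟩
      rcases lt_or_ge s l with h | h
      · exact Or.inl ⟨hs, h⟩
      · exact Or.inr ⟨hs, h, hsr⟩
    · rintro (⟨hs, h⟩ | ⟨hs, _, h⟩)
      · exact ⟨hs, h.trans_le hlr⟩
      · exact ⟨hs, h⟩
  have hdisj : Disjoint (P.filter (· < l)) (P.filter fun s => l ≤ s ∧ s < r) := by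
    rw [Finset.disjoint_filter]
    rintro s _ h ⟨h', _⟩
    exact h.not_ge h'
  rw [hsplit, Finset.sum_union hdisj, h2] at h1
  have hge : ((P.filter fun s => l ≤ s ∧ s < r).card : ℝ) * minMesh P ≤
      ∑ s ∈ P with l ≤ s ∧ s < r, (nextPt P s - s) := by
    rw [← nsmul_eq_mul]
    refine Finset.card_nsmul_le_sum _ _ _ fun s hs => ?_
    obtain ⟨hs, _, hsr⟩ := Finset.mem_filter.1 hs
    exact minMesh_le_gap (hP.consecutive_nextPt hs (hsr.trans_le (hP.2.2 r hr).2))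
  linarith

end IsPartition

/-! ### Tent functions and their coefficient functionals -/

/-- The Schauder function with left end, peak and right end `a < b < c`, written as a minimum of two
affine functions cut off at zero. -/
def tent (a b c t : ℝ) : ℝ :=
  max 0 (min ((c - b) * (t - a)) ((b - a) * (c - t))) / √((b - a) * (c - b) * (c - a))

/-- The Schauder coefficient attached to the three points `a < b < c`: a normalised second
difference. -/
def tentCoeff (a b c : ℝ) (x : ℝ → ℝ) : ℝ :=
  ((x b - x a) * (c - b) - (x c - x b) * (b - a)) / √((b - a) * (c - b) * (c - a))

theorem tent_norm_pos {a b c : ℝ} (hab : a < b) (hbc : b < c) :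
    0 < √((b - a) * (c - b) * (c - a)) :=
  Real.sqrt_pos.2 (mul_pos (mul_pos (by linarith) (by linarith)) (by linarith))

theorem tent_eq_zero_of_le {a b c t : ℝ} (hbc : b < c) (h : t ≤ a) :
    tent a b c t = 0 := by
  have : min ((c - b) * (t - a)) ((b - a) * (c - t)) ≤ 0 :=
    (min_le_left _ _).trans (mul_nonpos_of_nonneg_of_nonpos (by linarith) (by linarith))
  rw [tent, max_eq_left this, zero_div]

theorem tent_eq_zero_of_ge {a b c t : ℝ} (hab : a < b) (h : c ≤ t) :
    tent a b c t = 0 := by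
  have : min ((c - b) * (t - a)) ((b - a) * (c - t)) ≤ 0 :=
    (min_le_right _ _).trans (mul_nonpos_of_nonneg_of_nonpos (by linarith) (by linarith))
  rw [tent, max_eq_left this, zero_div]

theorem tent_eq_zero_of_notMem {a b c t : ℝ} (hab : a < b) (hbc : b < c) (h : t ∉ Ioo a c) :
    tent a b c t = 0 := by
  rcases le_or_gt t a with h1 | h1
  · exact tent_eq_zero_of_le hbc h1
  · exact tent_eq_zero_of_ge hab (not_lt.1 fun h2 => h ⟨h1, h2⟩)

theorem tent_eq_left {a b c t : ℝ} (hab : a < b) (hbc : b < c) (h1 : a ≤ t) (h2 : t ≤ b) :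
    tent a b c t = (c - b) * (t - a) / √((b - a) * (c - b) * (c - a)) := by
  rw [tent, min_eq_left (by nlinarith), max_eq_right (mul_nonneg (by linarith) (by linarith))]

theorem tent_eq_right {a b c t : ℝ} (hab : a < b) (hbc : b < c) (h1 : b ≤ t) (h2 : t ≤ c) :
    tent a b c t = (b - a) * (c - t) / √((b - a) * (c - b) * (c - a)) := by
  rw [tent, min_eq_right (by nlinarith), max_eq_right (mul_nonneg (by linarith) (by linarith))]

theorem tent_nonneg (a b c t : ℝ) : 0 ≤ tent a b c t :=
  div_nonneg (le_max_left _ _) (Real.sqrt_nonneg _)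

theorem continuous_tent (a b c : ℝ) : Continuous (tent a b c) := by
  unfold tent; fun_prop

theorem tent_le {a b c : ℝ} (hab : a < b) (hbc : b < c) (t : ℝ) :
    tent a b c t ≤ √(c - b) := by
  have hba : 0 < b - a := by linarith
  have hcb : 0 < c - b := by linarith
  have hca : 0 < c - a := by linarith
  rw [tent, div_le_iff₀ (tent_norm_pos hab hbc), ← Real.sqrt_mul hcb.le]
  refine max_le (Real.sqrt_nonneg _) ?_
  have hle : min ((c - b) * (t - a)) ((b - a) * (c - t)) ≤ (b - a) * (c - b) := by
    rcases le_total t b with h | h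
    · exact (min_le_left _ _).trans (by nlinarith)
    · exact (min_le_right _ _).trans (by nlinarith)
  refine hle.trans (Real.le_sqrt_of_sq_le ?_)
  have : 0 ≤ (c - b) ^ 2 * (b - a) * ((c - a) - (b - a)) := by
    have : (0 : ℝ) ≤ (c - a) - (b - a) := by linarith
    positivity
  nlinarith

theorem abs_tent_sub_le {a b c m : ℝ} (hm : 0 < m) (hab : m ≤ b - a) (hbc : m ≤ c - b)
    (s t : ℝ) : |tent a b c s - tent a b c t| ≤ |s - t| / √m := by
  have hba : 0 < b - a := by linarith
  have hcb : 0 < c - b := by linarith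
  have hca : 0 < c - a := by linarith
  set M := max (c - b) (b - a)
  have hM0 : 0 ≤ M := hcb.le.trans (le_max_left _ _)
  have hnum : |max 0 (min ((c - b) * (s - a)) ((b - a) * (c - s))) -
      max 0 (min ((c - b) * (t - a)) ((b - a) * (c - t)))| ≤ M * |s - t| := by
    refine (abs_max_sub_max_le_max _ _ _ _).trans (max_le (by simp; positivity) ?_)
    refine (abs_min_sub_min_le_max _ _ _ _).trans (max_le ?_ ?_)
    · rw [← mul_sub, abs_mul, abs_of_pos hcb, sub_sub_sub_cancel_right]
      exact mul_le_mul_of_nonneg_right (le_max_left _ _) (abs_nonneg _)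
    · rw [← mul_sub, abs_mul, abs_of_pos hba, sub_sub_sub_cancel_left, abs_sub_comm]
      exact mul_le_mul_of_nonneg_right (le_max_right _ _) (abs_nonneg _)
  rw [tent, tent, ← sub_div, abs_div, abs_of_pos (tent_norm_pos (by linarith) (by linarith)),
    div_le_div_iff₀ (tent_norm_pos (by linarith) (by linarith)) (Real.sqrt_pos.2 hm)]
  have key : M * √m ≤ √((b - a) * (c - b) * (c - a)) := by
    refine Real.le_sqrt_of_sq_le ?_
    rw [mul_pow, Real.sq_sqrt hm.le]
    rcases le_total (c - b) (b - a) with h | h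
    · have hM : M = b - a := max_eq_right h
      rw [hM]
      calc (b - a) ^ 2 * m ≤ (b - a) ^ 2 * (c - b) := by gcongr
        _ = (b - a) * (c - b) * (b - a) := by ring
        _ ≤ _ := by gcongr; linarith
    · have hM : M = c - b := max_eq_left h
      rw [hM]
      calc (c - b) ^ 2 * m ≤ (c - b) ^ 2 * (b - a) := by gcongr
        _ = (b - a) * (c - b) * (c - b) := by ring
        _ ≤ _ := by gcongr; linarith
  calc _ ≤ M * |s - t| * √m := by gcongr
    _ = |s - t| * (M * √m) := by ring
    _ ≤ _ := by gcongr

/-- A tent function is affine on every interval whose interior contains none of its three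
breakpoints. -/
theorem tent_affine_of_gap {a b c u v : ℝ} (hab : a < b) (hbc : b < c)
    (ha : a ∉ Ioo u v) (hb : b ∉ Ioo u v) (hc : c ∉ Ioo u v) :
    ∃ p q : ℝ, ∀ t ∈ Icc u v, tent a b c t = p * t + q := by
  simp only [mem_Ioo, not_and, not_lt] at ha hb hc
  set w := √((b - a) * (c - b) * (c - a))
  rcases le_or_gt c u with hcu | hcu
  · exact ⟨0, 0, fun t ht => by rw [tent_eq_zero_of_ge hab (hcu.trans ht.1)]; ring⟩
  rcases le_or_gt b u with hbu | hbu
  · have hcv : v ≤ c := hc hcu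
    refine ⟨-(b - a) / w, (b - a) * c / w, fun t ht => ?_⟩
    rw [tent_eq_right hab hbc (hbu.trans ht.1) (ht.2.trans hcv)]
    ring
  have hbv : v ≤ b := hb hbu
  rcases le_or_gt a u with hau | hau
  · refine ⟨(c - b) / w, -((c - b) * a) / w, fun t ht => ?_⟩
    rw [tent_eq_left hab hbc (hau.trans ht.1) (ht.2.trans hbv)]
    ring
  · exact ⟨0, 0, fun t ht => by rw [tent_eq_zero_of_le hbc (ht.2.trans (ha hau))]; ring⟩

theorem tentCoeff_eq_zero_of_affine {a b c p q : ℝ} {x : ℝ → ℝ} (hab : a < b) (hbc : b < c)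
    (h : ∀ t ∈ Icc a c, x t = p * t + q) : tentCoeff a b c x = 0 := by
  rw [tentCoeff, h a ⟨le_rfl, by linarith⟩, h b ⟨hab.le, hbc.le⟩, h c ⟨by linarith, le_rfl⟩]
  rw [div_eq_zero_iff]
  left; ring

theorem tentCoeff_tent_self {a b c : ℝ} (hab : a < b) (hbc : b < c) :
    tentCoeff a b c (tent a b c) = 1 := by
  have hw := tent_norm_pos hab hbc
  have hsq : √((b - a) * (c - b) * (c - a)) ^ 2 = (b - a) * (c - b) * (c - a) :=
    Real.sq_sqrt (mul_nonneg (mul_nonneg (by linarith) (by linarith)) (by linarith))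
  rw [tentCoeff, tent_eq_zero_of_le hbc le_rfl, tent_eq_zero_of_ge hab le_rfl,
    tent_eq_left hab hbc hab.le le_rfl]
  generalize √((b - a) * (c - b) * (c - a)) = w at *
  field_simp
  rw [hsq]
  ring

/-- The Schauder coefficient of `t ↦ min s t`, the primitive of the indicator of `[0, s]`, is the
value of the Schauder function at `s`. -/
theorem tentCoeff_min {a b c : ℝ} (hab : a < b) (hbc : b < c) (s : ℝ) :
    tentCoeff a b c (fun t => min s t) = tent a b c s := by
  rcases le_or_gt s a with h1 | h1
  · rw [tent_eq_zero_of_le hbc h1, tentCoeff]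
    rw [min_eq_left h1, min_eq_left (h1.trans hab.le), min_eq_left (by linarith)]
    simp
  rcases le_or_gt s b with h2 | h2
  · rw [tent_eq_left hab hbc h1.le h2, tentCoeff]
    rw [min_eq_right h1.le, min_eq_left h2, min_eq_left (by linarith)]
    congr 1; ring
  rcases le_or_gt s c with h3 | h3
  · rw [tent_eq_right hab hbc h2.le h3, tentCoeff]
    rw [min_eq_right h1.le, min_eq_right h2.le, min_eq_left h3]
    congr 1; ring
  · rw [tent_eq_zero_of_ge hab h3.le, tentCoeff]
    rw [min_eq_right h1.le, min_eq_right h2.le, min_eq_right h3.le, div_eq_zero_iff]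
    left; ring

/-! ### Schauder functions along a refining sequence of partitions -/

namespace PartitionSeq

variable {π : PartitionSeq}

theorem peak_mem (i : π.SchauderIndex) : π.peak i ∈ π.pts (i.1 + 1) :=
  (Finset.mem_sdiff.1 i.2.2).1

theorem peak_notMem (i : π.SchauderIndex) : π.peak i ∉ π.pts i.1 :=
  (Finset.mem_sdiff.1 i.2.2).2

theorem peak_pos (i : π.SchauderIndex) : 0 < π.peak i :=
  lt_of_le_of_ne ((π.isPartition _).2.2 _ (peak_mem i)).1 fun h =>
    peak_notMem i (h ▸ (π.isPartition i.1).1)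

theorem peak_lt_one (i : π.SchauderIndex) : π.peak i < 1 :=
  lt_of_le_of_ne ((π.isPartition _).2.2 _ (peak_mem i)).2 fun h =>
    peak_notMem i (h ▸ (π.isPartition i.1).2.1)

theorem suppLeft_spec (i : π.SchauderIndex) : π.suppLeft i ∈ π.pts i.1 ∧
    π.suppLeft i < π.peak i ∧ ∀ r ∈ π.pts i.1, r < π.peak i → r ≤ π.suppLeft i :=
  (π.isPartition i.1).prevPt_spec (peak_pos i)

theorem suppRight_spec (i : π.SchauderIndex) : π.suppRight i ∈ π.pts (i.1 + 1) ∧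
    π.peak i < π.suppRight i ∧ ∀ r ∈ π.pts (i.1 + 1), π.peak i < r → π.suppRight i ≤ r :=
  (π.isPartition (i.1 + 1)).nextPt_spec (peak_lt_one i)

theorem suppLeft_lt (i : π.SchauderIndex) : π.suppLeft i < π.peak i := (suppLeft_spec i).2.1

theorem lt_suppRight (i : π.SchauderIndex) : π.peak i < π.suppRight i := (suppRight_spec i).2.1

theorem schauderCoeff_eq (x : ℝ → ℝ) (i : π.SchauderIndex) :
    π.schauderCoeff x i = tentCoeff (π.suppLeft i) (π.peak i) (π.suppRight i) x := rfl

theorem schauderFun_eq (i : π.SchauderIndex) (t : ℝ) :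
    π.schauderFun i t = tent (π.suppLeft i) (π.peak i) (π.suppRight i) t := by
  have hab := suppLeft_lt i
  have hbc := lt_suppRight i
  unfold schauderFun
  generalize π.suppLeft i = a at *
  generalize π.peak i = b at *
  generalize π.suppRight i = c at *
  have hba : 0 < b - a := by linarith
  have hcb : 0 < c - b := by linarith
  have hca : 0 < c - a := by linarith
  simp only
  split_ifs with h1 h2
  · rw [tent_eq_left hab hbc h1.1 h1.2.le]
    have : (c - b) / (b - a) * (1 / (c - a)) = (c - b) ^ 2 / ((b - a) * (c - b) * (c - a)) := by
      field_simp
    rw [this, Real.sqrt_div (sq_nonneg _), Real.sqrt_sq hcb.le]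
    ring
  · rw [tent_eq_right hab hbc h2.1 h2.2.le]
    have : (b - a) / (c - b) * (1 / (c - a)) = (b - a) ^ 2 / ((b - a) * (c - b) * (c - a)) := by
      field_simp
    rw [this, Real.sqrt_div (sq_nonneg _), Real.sqrt_sq hba.le]
    ring
  · refine (tent_eq_zero_of_notMem hab hbc fun h => ?_).symm
    rcases lt_or_ge t b with h' | h'
    · exact h1 ⟨h.1.le, h'⟩
    · exact h2 ⟨h', h.2⟩

theorem notMem_supp_of_mem (hπ : π.Refining) (i : π.SchauderIndex) {n : ℕ} (hn : n ≤ i.1) {r : ℝ}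
    (hr : r ∈ π.pts n) : r ∉ Ioo (π.suppLeft i) (π.suppRight i) := by
  rintro ⟨h1, h2⟩
  have hr' := hπ n i.1 hn hr
  rcases lt_trichotomy r (π.peak i) with h | h | h
  · exact ((suppLeft_spec i).2.2 r hr' h).not_gt h1
  · exact peak_notMem i (h ▸ hr')
  · exact ((suppRight_spec i).2.2 r (hπ _ _ (Nat.le_succ _) hr') h).not_gt h2

theorem schauderFun_eq_zero_of_mem (hπ : π.Refining) (i : π.SchauderIndex) {n : ℕ} (hn : n ≤ i.1)
    {r : ℝ} (hr : r ∈ π.pts n) : π.schauderFun i r = 0 := by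
  rw [schauderFun_eq]
  exact tent_eq_zero_of_notMem (suppLeft_lt i) (lt_suppRight i) (notMem_supp_of_mem hπ i hn hr)

theorem suppLeft_mem_succ (hπ : π.Refining) (i : π.SchauderIndex) :
    π.suppLeft i ∈ π.pts (i.1 + 1) :=
  hπ _ _ (Nat.le_succ _) (suppLeft_spec i).1

/-- Order the Schauder indices by level, and within a level from right to left. The breakpoints of
an earlier Schauder function avoid the open support of a later one. -/
theorem breakpoints_notMem_supp (hπ : π.Refining) (i j : π.SchauderIndex)
    (h : j.1 < i.1 ∨ j.1 = i.1 ∧ π.peak i < π.peak j) :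
    π.suppLeft j ∉ Ioo (π.suppLeft i) (π.suppRight i) ∧
      π.peak j ∉ Ioo (π.suppLeft i) (π.suppRight i) ∧
      π.suppRight j ∉ Ioo (π.suppLeft i) (π.suppRight i) := by
  rcases h with h | ⟨h, hlt⟩
  · exact ⟨notMem_supp_of_mem hπ i h (suppLeft_mem_succ hπ j),
      notMem_supp_of_mem hπ i h (peak_mem j), notMem_supp_of_mem hπ i h (suppRight_spec j).1⟩
  · have hpk : π.suppRight i ≤ π.peak j :=
      (suppRight_spec i).2.2 _ (h ▸ peak_mem j) hlt
    exact ⟨notMem_supp_of_mem hπ i h.le (suppLeft_spec j).1, fun h' => hpk.not_gt h'.2,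
      fun h' => (hpk.trans (lt_suppRight j).le).not_gt h'.2⟩

theorem index_order {i j : π.SchauderIndex} (hij : i ≠ j) :
    (j.1 < i.1 ∨ j.1 = i.1 ∧ π.peak i < π.peak j) ∨
      (i.1 < j.1 ∨ i.1 = j.1 ∧ π.peak j < π.peak i) := by
  rcases lt_trichotomy i.1 j.1 with h | h | h
  · exact Or.inr (Or.inl h)
  · rcases lt_trichotomy (π.peak i) (π.peak j) with h' | h' | h'
    · exact Or.inl (Or.inr ⟨h.symm, h'⟩)
    · refine absurd ?_ hij
      obtain ⟨m, k⟩ := i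
      obtain ⟨m', k'⟩ := j
      obtain rfl : m = m' := h
      rw [show k = k' from Subtype.ext h']
    · exact Or.inr (Or.inr ⟨h, h'⟩)
  · exact Or.inl (Or.inl h)

/-- The Schauder functions and the coefficient functionals are biorthogonal. -/
theorem schauderCoeff_schauderFun (hπ : π.Refining) [DecidableEq π.SchauderIndex]
    (i j : π.SchauderIndex) :
    π.schauderCoeff (π.schauderFun j) i = if i = j then 1 else 0 := by
  have hfun : π.schauderFun j = tent (π.suppLeft j) (π.peak j) (π.suppRight j) :=
    funext (schauderFun_eq j)
  split_ifs with hij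
  · subst hij
    rw [schauderCoeff_eq, hfun, tentCoeff_tent_self (suppLeft_lt i) (lt_suppRight i)]
  rcases index_order hij with h | h
  · obtain ⟨h1, h2, h3⟩ := breakpoints_notMem_supp hπ i j h
    obtain ⟨p, q, hpq⟩ := tent_affine_of_gap (suppLeft_lt j) (lt_suppRight j) h1 h2 h3
    rw [schauderCoeff_eq, hfun]
    exact tentCoeff_eq_zero_of_affine (suppLeft_lt i) (lt_suppRight i) hpq
  · obtain ⟨h1, h2, h3⟩ := breakpoints_notMem_supp hπ j i h
    rw [schauderCoeff_eq, hfun, tentCoeff,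
      tent_eq_zero_of_notMem (suppLeft_lt j) (lt_suppRight j) h1,
      tent_eq_zero_of_notMem (suppLeft_lt j) (lt_suppRight j) h2,
      tent_eq_zero_of_notMem (suppLeft_lt j) (lt_suppRight j) h3]
    simp

theorem schauderCoeff_linear (z : ℝ) (i : π.SchauderIndex) :
    π.schauderCoeff (fun t => z * t) i = 0 := by
  rw [schauderCoeff_eq]
  exact tentCoeff_eq_zero_of_affine (p := z) (q := 0) (suppLeft_lt i) (lt_suppRight i)
    fun t _ => by ring

theorem schauderCoeff_add (x y : ℝ → ℝ) (i : π.SchauderIndex) :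
    π.schauderCoeff (fun t => x t + y t) i = π.schauderCoeff x i + π.schauderCoeff y i := by
  simp only [schauderCoeff]; ring

theorem schauderCoeff_const_mul (r : ℝ) (x : ℝ → ℝ) (i : π.SchauderIndex) :
    π.schauderCoeff (fun t => r * x t) i = r * π.schauderCoeff x i := by
  simp only [schauderCoeff]; ring

theorem schauderCoeff_finsetSum {ι : Type*} (F : Finset ι) (x : ι → ℝ → ℝ) (i : π.SchauderIndex) :
    π.schauderCoeff (fun t => ∑ j ∈ F, x j t) i = ∑ j ∈ F, π.schauderCoeff (x j) i := by
  classical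
  induction F using Finset.induction_on with
  | empty => simp [schauderCoeff]
  | insert j F hj ih =>
    simp only [Finset.sum_insert hj]
    rw [schauderCoeff_add, ih]

/-- The Schauder indices of level less than `N`. -/
def indexBelow (π : PartitionSeq) (N : ℕ) : Finset π.SchauderIndex :=
  (Finset.range N).sigma fun _ => Finset.univ

theorem mem_indexBelow {N : ℕ} {i : π.SchauderIndex} : i ∈ π.indexBelow N ↔ i.1 < N := by
  simp [indexBelow]

theorem sum_indexBelow (N : ℕ) (f : π.SchauderIndex → ℝ) :
    ∑ i ∈ π.indexBelow N, f i = ∑ m ∈ Finset.range N, ∑ k : π.LevelIndex m, f ⟨m, k⟩ :=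
  Finset.sum_sigma _ _ _

/-- A function with vanishing Schauder coefficients up to level `N` that vanishes at `0` and `1`
vanishes on `π^N`. -/
theorem eq_zero_of_schauderCoeff_eq_zero {x : ℝ → ℝ} (h0 : x 0 = 0) (h1 : x 1 = 0)
    (N : ℕ) (hx : ∀ i : π.SchauderIndex, i.1 < N → π.schauderCoeff x i = 0) :
    ∀ t ∈ π.pts N, x t = 0 := by
  induction N with
  | zero =>
    intro t ht
    rw [π.pts_zero] at ht
    simp only [Finset.mem_insert, Finset.mem_singleton] at ht
    rcases ht with rfl | rfl <;> assumption
  | succ N ih =>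
    have ih' := ih fun i hi => hx i (by omega)
    by_contra! hcon
    obtain ⟨t, ht, htx⟩ := hcon
    -- the rightmost point where `x` does not vanish is the peak of some Schauder function
    obtain ⟨q, hq, hmax⟩ := ((π.pts (N + 1)).filter fun t => x t ≠ 0).exists_max_image id
      ⟨t, Finset.mem_filter.2 ⟨ht, htx⟩⟩
    obtain ⟨hq1, hq2⟩ := Finset.mem_filter.1 hq
    have hqN : q ∉ π.pts N := fun h => hq2 (ih' q h)
    let i : π.SchauderIndex := ⟨N, q, Finset.mem_sdiff.2 ⟨hq1, hqN⟩⟩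
    have hl : x (π.suppLeft i) = 0 := ih' _ (suppLeft_spec i).1
    have hr : x (π.suppRight i) = 0 := by
      by_contra hne
      have : π.suppRight i ≤ q :=
        hmax _ (Finset.mem_filter.2 ⟨(suppRight_spec i).1, hne⟩)
      exact this.not_gt (lt_suppRight i)
    have hc := hx i (Nat.lt_succ_self N)
    have hab := suppLeft_lt i
    have hbc := lt_suppRight i
    rw [schauderCoeff_eq, tentCoeff, hl, hr, div_eq_zero_iff] at hc
    rcases hc with hc | hc
    · have h3 : x (π.peak i) * (π.suppRight i - π.suppLeft i) = 0 := by linarith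
      rcases mul_eq_zero.1 h3 with h4 | h4
      · exact hq2 h4
      · linarith
    · exact (tent_norm_pos hab hbc).ne' hc

/-- On `π^N`, a function is the sum of its linear part and of its Schauder expansion up to level
`N`. -/
theorem schauder_interpolation (hπ : π.Refining) (x : ℝ → ℝ) (h0 : x 0 = 0) (N : ℕ) {t : ℝ}
    (ht : t ∈ π.pts N) :
    x t = x 1 * t + ∑ i ∈ π.indexBelow N, π.schauderCoeff x i * π.schauderFun i t := by
  classical
  let D : ℝ → ℝ := fun t => x t + (-x 1 * t +
    ∑ i ∈ π.indexBelow N, -π.schauderCoeff x i * π.schauderFun i t)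
  have hzero : ∀ r ∈ π.pts 0, ∀ i, π.schauderFun i r = 0 := fun r hr i =>
    schauderFun_eq_zero_of_mem hπ i (Nat.zero_le _) hr
  have hD := eq_zero_of_schauderCoeff_eq_zero (π := π) (x := D)
    (by simp [D, h0, hzero 0 (π.isPartition 0).1])
    (by simp [D, hzero 1 (π.isPartition 0).2.1]) N
    (fun i hi => by
      simp only [D]
      rw [schauderCoeff_add, schauderCoeff_add, schauderCoeff_linear, schauderCoeff_finsetSum]
      simp_rw [schauderCoeff_const_mul, schauderCoeff_schauderFun hπ]
      simp [mem_indexBelow.2 hi]) t ht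
  simp only [D, neg_mul, Finset.sum_neg_distrib] at hD
  linarith

/-- Parseval's identity for the Schauder functions on the grid `π^N`. -/
theorem sum_schauderFun_mul (hπ : π.Refining) {N : ℕ} {s t : ℝ} (hs : s ∈ Icc (0 : ℝ) 1)
    (ht : t ∈ π.pts N) :
    s * t + ∑ i ∈ π.indexBelow N, π.schauderFun i s * π.schauderFun i t = min s t := by
  have h := schauder_interpolation hπ (fun t => min s t) (min_eq_right hs.1) N ht
  have hc : ∀ i, π.schauderCoeff (fun t => min s t) i = π.schauderFun i s := fun i => by
    rw [schauderCoeff_eq, tentCoeff_min (suppLeft_lt i) (lt_suppRight i), schauderFun_eq]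
  simp only [hc] at h
  rw [h]
  simp [hs.2]

theorem schauderFun_affine_of_gap (hπ : π.Refining) (i : π.SchauderIndex) {N : ℕ} (hi : i.1 < N)
    {u v : ℝ} (huv : Consecutive (π.pts N) u v) :
    ∃ p q : ℝ, ∀ t ∈ Icc u v, π.schauderFun i t = p * t + q := by
  have hmem : ∀ r ∈ π.pts (i.1 + 1), r ∉ Ioo u v := fun r hr h =>
    huv.2.2.2 r (hπ _ _ hi hr) h
  simp_rw [schauderFun_eq]
  exact tent_affine_of_gap (suppLeft_lt i) (lt_suppRight i)
    (hmem _ (suppLeft_mem_succ hπ i)) (hmem _ (peak_mem i)) (hmem _ (suppRight_spec i).1)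

/-- Off the grid, the truncated covariance differs from `min s t` by at most the mesh. -/
theorem abs_sum_schauderFun_mul_sub_le (hπ : π.Refining) {N : ℕ} {s t : ℝ}
    (hs : s ∈ Icc (0 : ℝ) 1) (ht : t ∈ Icc (0 : ℝ) 1) :
    |s * t + ∑ i ∈ π.indexBelow N, π.schauderFun i s * π.schauderFun i t - min s t| ≤
      mesh (π.pts N) := by
  by_cases htN : t ∈ π.pts N
  · rw [sum_schauderFun_mul hπ hs htN, sub_self, abs_zero]
    exact (π.isPartition N).mesh_pos.le
  have hP := π.isPartition N
  have ht0 : 0 < t := lt_of_le_of_ne ht.1 fun h => htN (h ▸ hP.1)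
  have ht1 : t < 1 := lt_of_le_of_ne ht.2 fun h => htN (h ▸ hP.2.1)
  obtain ⟨a1, a2, a3⟩ := hP.prevPt_spec ht0
  obtain ⟨b1, b2, b3⟩ := hP.nextPt_spec ht1
  set u := prevPt (π.pts N) t
  set v := nextPt (π.pts N) t
  have huv : Consecutive (π.pts N) u v := by
    refine ⟨a1, b1, a2.trans b2, fun r hr h => ?_⟩
    rcases lt_trichotomy r t with hrt | rfl | hrt
    · exact (a3 r hr hrt).not_gt h.1
    · exact htN hr
    · exact (b3 r hr hrt).not_gt h.2
  have hmesh := IsPartition.gap_le_mesh huv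
  let K : ℝ → ℝ := fun t => s * t + ∑ i ∈ π.indexBelow N, π.schauderFun i s * π.schauderFun i t
  have hKu : K u = min s u := sum_schauderFun_mul hπ hs a1
  have hKv : K v = min s v := sum_schauderFun_mul hπ hs b1
  have haff : ∀ i : π.SchauderIndex, ∃ p q : ℝ, i ∈ π.indexBelow N →
      ∀ t ∈ Icc u v, π.schauderFun i t = p * t + q := fun i => by
    by_cases hi : i ∈ π.indexBelow N
    · obtain ⟨p, q, h⟩ := schauderFun_affine_of_gap hπ i (mem_indexBelow.1 hi) huv
      exact ⟨p, q, fun _ => h⟩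
    · exact ⟨0, 0, fun h => absurd h hi⟩
  choose p q hpq using haff
  have hKaff : ∀ t ∈ Icc u v, K t = (s + ∑ i ∈ π.indexBelow N, π.schauderFun i s * p i) * t +
      ∑ i ∈ π.indexBelow N, π.schauderFun i s * q i := fun t ht => by
    simp only [K]
    rw [add_mul, add_assoc, Finset.sum_mul, ← Finset.sum_add_distrib]
    congr 1
    refine Finset.sum_congr rfl fun i hi => ?_
    rw [hpq i hi t ht]; ring
  rw [hKaff u ⟨le_rfl, by linarith⟩] at hKu
  rw [hKaff v ⟨by linarith, le_rfl⟩] at hKv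
  have hKt := hKaff t ⟨a2.le, b2.le⟩
  change |K t - min s t| ≤ _
  rw [hKt]
  generalize (s + ∑ i ∈ π.indexBelow N, π.schauderFun i s * p i) = A at *
  generalize ∑ i ∈ π.indexBelow N, π.schauderFun i s * q i = B at *
  have m1 : min s u ≤ min s t := min_le_min_left _ a2.le
  have m2 : min s t ≤ min s v := min_le_min_left _ b2.le
  have m3 : min s v - min s u ≤ v - u := by
    rcases le_total s u with h | h
    · rw [min_eq_left h, min_eq_left (by linarith)]; linarith
    · rw [min_eq_right h]; linarith [min_le_right s v]
  have hA : 0 ≤ A := by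
    by_contra hA
    have : A * (v - u) < 0 := mul_neg_of_neg_of_pos (not_le.1 hA) (by linarith)
    linarith
  have k1 : A * u ≤ A * t := mul_le_mul_of_nonneg_left a2.le hA
  have k2 : A * t ≤ A * v := mul_le_mul_of_nonneg_left b2.le hA
  rw [abs_le]
  constructor <;> linarith

end PartitionSeq

/-! ### Geometric bounds for balanced complete refining partitions -/

/-- The quantitative content of being balanced and complete refining: the mesh decays geometrically
and is comparable to the smallest gap, at most `M` Schauder functions of each level are nonzero at a
given point, and the number of Schauder functions of level `m` is at most `K * ρ ^ m`. -/
structure GeometricBounds (π : PartitionSeq) (r c M K ρ : ℝ) : Prop where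
  refining : π.Refining
  r_pos : 0 < r
  r_lt_one : r < 1
  c_pos : 0 < c
  M_pos : 0 < M
  K_pos : 0 < K
  ρ_pos : 0 < ρ
  mesh_le : ∀ m, mesh (π.pts (m + 1)) ≤ r ^ m
  mesh_le_minMesh : ∀ m, mesh (π.pts (m + 1)) ≤ c * minMesh (π.pts (m + 1))
  card_active_le : ∀ (m : ℕ) (t : ℝ),
    ((Finset.univ.filter fun k : π.LevelIndex m => π.schauderFun ⟨m, k⟩ t ≠ 0).card : ℝ) ≤ M
  card_level_le : ∀ m : ℕ, (Fintype.card (π.LevelIndex m) : ℝ) ≤ K * ρ ^ m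

namespace PartitionSeq

variable {π : PartitionSeq}

theorem card_level_mul_minMesh_le (m : ℕ) :
    (Fintype.card (π.LevelIndex m) : ℝ) * minMesh (π.pts (m + 1)) ≤ 1 := by
  have hP := π.isPartition (m + 1)
  have h := hP.card_mul_minMesh_le hP.1 hP.2.1 zero_le_one
  rw [sub_zero] at h
  refine le_trans (mul_le_mul_of_nonneg_right ?_ hP.minMesh_pos.le) h
  rw [← Finset.card_univ]
  exact_mod_cast Finset.card_le_card_of_injOn (fun k : π.LevelIndex m => k.1)
    (fun k _ => by
      have h0 := peak_pos (π := π) ⟨m, k⟩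
      have h1 := peak_lt_one (π := π) ⟨m, k⟩
      exact Finset.mem_coe.2 (Finset.mem_filter.2 ⟨(Finset.mem_sdiff.1 k.2).1, h0.le, h1⟩))
    (fun k _ k' _ h => Subtype.ext h)

/-- All Schauder functions of level `m` that do not vanish at `t` have their peaks in one gap
of `π^m`. -/
theorem card_active_mul_minMesh_le (hπ : π.Refining) (m : ℕ) (t : ℝ) :
    ((Finset.univ.filter fun k : π.LevelIndex m => π.schauderFun ⟨m, k⟩ t ≠ 0).card : ℝ) *
      minMesh (π.pts (m + 1)) ≤ mesh (π.pts m) := by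
  have hP := π.isPartition m
  have hP' := π.isPartition (m + 1)
  have hsupp : ∀ k : π.LevelIndex m, π.schauderFun ⟨m, k⟩ t ≠ 0 →
      t ∈ Ioo (π.suppLeft ⟨m, k⟩) (π.suppRight ⟨m, k⟩) := fun k hk => by
    by_contra h
    rw [schauderFun_eq] at hk
    exact hk (tent_eq_zero_of_notMem (suppLeft_lt _) (lt_suppRight _) h)
  by_cases hne : ∃ k : π.LevelIndex m, π.schauderFun ⟨m, k⟩ t ≠ 0
  swap
  · push Not at hne
    rw [Finset.filter_false_of_mem fun k _ => not_not.2 (hne k)]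
    simpa using hP.mesh_pos.le
  obtain ⟨k₀, hk₀⟩ := hne
  have htm : t ∉ π.pts m := fun h => hk₀ (schauderFun_eq_zero_of_mem hπ _ le_rfl h)
  have ht0 : 0 < t :=
    (hP'.2.2 _ (suppLeft_mem_succ hπ ⟨m, k₀⟩)).1.trans_lt (hsupp k₀ hk₀).1
  have ht1 : t < 1 :=
    (hsupp k₀ hk₀).2.trans_le (hP'.2.2 _ (suppRight_spec (π := π) ⟨m, k₀⟩).1).2
  obtain ⟨a1, a2, a3⟩ := hP.prevPt_spec ht0
  obtain ⟨b1, b2, b3⟩ := hP.nextPt_spec ht1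
  set u := prevPt (π.pts m) t
  set v := nextPt (π.pts m) t
  have huv : Consecutive (π.pts m) u v := by
    refine ⟨a1, b1, a2.trans b2, fun r hr h => ?_⟩
    rcases lt_trichotomy r t with hrt | rfl | hrt
    · exact (a3 r hr hrt).not_gt h.1
    · exact htm hr
    · exact (b3 r hr hrt).not_gt h.2
  refine le_trans ?_ (IsPartition.gap_le_mesh huv)
  refine le_trans (mul_le_mul_of_nonneg_right ?_ hP'.minMesh_pos.le)
    (hP'.card_mul_minMesh_le (hπ _ _ (Nat.le_succ m) a1) (hπ _ _ (Nat.le_succ m) b1)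
      (a2.trans b2).le)
  exact_mod_cast Finset.card_le_card_of_injOn (fun k : π.LevelIndex m => k.1)
    (fun k hk => by
      have hk' := hsupp k (Finset.mem_filter.1 hk).2
      have hu := notMem_supp_of_mem hπ ⟨m, k⟩ le_rfl a1
      have hv := notMem_supp_of_mem hπ ⟨m, k⟩ le_rfl b1
      have hl := suppLeft_lt (π := π) ⟨m, k⟩
      have hr := lt_suppRight (π := π) ⟨m, k⟩
      have h1 : u ≤ π.suppLeft ⟨m, k⟩ := not_lt.1 fun h => hu ⟨h, a2.trans hk'.2⟩
      have h2 : π.suppRight ⟨m, k⟩ ≤ v := not_lt.1 fun h => hv ⟨hk'.1.trans b2, h⟩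
      exact Finset.mem_coe.2 (Finset.mem_filter.2 ⟨(Finset.mem_sdiff.1 k.2).1,
        (h1.trans_lt hl).le, hr.trans_le h2⟩))
    (fun k _ k' _ h => Subtype.ext h)

theorem exists_geometricBounds (hbal : π.Balanced) (hcr : π.CompleteRefining) :
    ∃ r c M K ρ : ℝ, GeometricBounds π r c M K ρ := by
  obtain ⟨c, hc1, hc⟩ := hbal
  obtain ⟨hπ, a, b, ha, hb, hab⟩ := hcr
  have hpos : ∀ n, 0 < mesh (π.pts n) := fun n => (π.isPartition n).mesh_pos
  have hmin : ∀ n, 0 < minMesh (π.pts n) := fun n => (π.isPartition n).minMesh_pos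
  have hc0 : 0 < c := by linarith
  have hcm : ∀ m, mesh (π.pts (m + 1)) ≤ c * minMesh (π.pts (m + 1)) := fun m =>
    (div_le_iff₀ (hmin _)).1 (hc (m + 1) (by omega))
  have hdec : ∀ m, (1 + a) * mesh (π.pts (m + 2)) ≤ mesh (π.pts (m + 1)) := fun m =>
    (le_div_iff₀ (hpos _)).1 (hab (m + 1) (by omega)).1
  have hgrow : ∀ m, mesh (π.pts (m + 1)) ≤ b * mesh (π.pts (m + 2)) := fun m =>
    (div_le_iff₀ (hpos _)).1 (hab (m + 1) (by omega)).2
  have hlow : ∀ m, mesh (π.pts 1) ≤ b ^ m * mesh (π.pts (m + 1)) := fun m => by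
    induction m with
    | zero => simp
    | succ m ih =>
      refine ih.trans ?_
      rw [pow_succ, mul_assoc]
      exact mul_le_mul_of_nonneg_left (hgrow m) (by positivity)
  refine ⟨(1 + a)⁻¹, c, b * c + Fintype.card (π.LevelIndex 0), c / mesh (π.pts 1), b, hπ,
    by positivity, inv_lt_one_of_one_lt₀ (by linarith), hc0, by positivity,
    div_pos hc0 (hpos 1), hb, fun m => ?_, hcm, fun m t => ?_, fun m => ?_⟩
  · induction m with
    | zero => simpa using (π.isPartition 1).mesh_le_one
    | succ m ih =>
      have h1 : mesh (π.pts (m + 2)) ≤ (1 + a)⁻¹ * mesh (π.pts (m + 1)) := by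
        rw [inv_mul_eq_div, le_div_iff₀ (by linarith), mul_comm]; exact hdec m
      refine h1.trans ?_
      rw [pow_succ, mul_comm]
      exact mul_le_mul_of_nonneg_right ih (by positivity)
  · rcases m with _ | m
    · have : (0 : ℝ) < b * c := by positivity
      have h2 : ((Finset.univ.filter fun k : π.LevelIndex 0 =>
          π.schauderFun ⟨0, k⟩ t ≠ 0).card : ℝ) ≤ Fintype.card (π.LevelIndex 0) := by
        exact_mod_cast Finset.card_le_univ _
      linarith
    · have h1 := card_active_mul_minMesh_le hπ (m + 1) t
      have h2 := hgrow m
      have h3 := hcm (m + 1)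
      have h4 : mesh (π.pts (m + 1)) ≤ b * c * minMesh (π.pts (m + 2)) := by
        rw [mul_assoc]
        exact h2.trans (mul_le_mul_of_nonneg_left h3 hb.le)
      have h5 := le_of_mul_le_mul_right (h1.trans h4) (hmin _)
      have : (0 : ℝ) ≤ Fintype.card (π.LevelIndex 0) := Nat.cast_nonneg _
      linarith
  · have h1 := card_level_mul_minMesh_le (π := π) m
    rw [div_mul_eq_mul_div, le_div_iff₀ (hpos 1)]
    have hN : (0 : ℝ) ≤ Fintype.card (π.LevelIndex m) := Nat.cast_nonneg _
    calc (Fintype.card (π.LevelIndex m) : ℝ) * mesh (π.pts 1)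
        ≤ Fintype.card (π.LevelIndex m) * (b ^ m * (c * minMesh (π.pts (m + 1)))) := by
          gcongr
          exact (hlow m).trans (mul_le_mul_of_nonneg_left (hcm m) (by positivity))
      _ = c * b ^ m * (Fintype.card (π.LevelIndex m) * minMesh (π.pts (m + 1))) := by ring
      _ ≤ c * b ^ m * 1 := by gcongr
      _ = c * b ^ m := mul_one _

end PartitionSeq

/-! ### Schauder series with slowly growing coefficients -/

namespace GeometricBounds

open PartitionSeq

variable {π : PartitionSeq} {r c M K ρ : ℝ}

theorem schauderFun_nonneg (i : π.SchauderIndex) (t : ℝ) : 0 ≤ π.schauderFun i t := by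
  rw [schauderFun_eq]; exact tent_nonneg _ _ _ _

theorem schauderFun_le (i : π.SchauderIndex) (t : ℝ) :
    π.schauderFun i t ≤ √(mesh (π.pts (i.1 + 1))) := by
  rw [schauderFun_eq]
  refine (tent_le (suppLeft_lt i) (lt_suppRight i) t).trans (Real.sqrt_le_sqrt ?_)
  exact IsPartition.gap_le_mesh
    ((π.isPartition _).consecutive_nextPt (peak_mem i) (peak_lt_one i))

theorem abs_schauderFun_sub_le (h : GeometricBounds π r c M K ρ) (i : π.SchauderIndex) (s t : ℝ) :
    |π.schauderFun i s - π.schauderFun i t| ≤ √c * |s - t| / √(mesh (π.pts (i.1 + 1))) := by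
  have hP := π.isPartition (i.1 + 1)
  have h1 : minMesh (π.pts (i.1 + 1)) ≤ π.suppRight i - π.peak i :=
    IsPartition.minMesh_le_gap (hP.consecutive_nextPt (peak_mem i) (peak_lt_one i))
  have h2 : minMesh (π.pts (i.1 + 1)) ≤ π.peak i - π.suppLeft i := by
    -- the right neighbour of the left end point in the finer partition is at most the peak
    have hlt : π.suppLeft i < 1 := (suppLeft_lt i).trans (peak_lt_one i)
    have h3 := IsPartition.minMesh_le_gap
      (hP.consecutive_nextPt (suppLeft_mem_succ h.refining i) hlt)
    have h4 := (hP.nextPt_spec hlt).2.2 _ (peak_mem i) (suppLeft_lt i)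
    linarith
  simp_rw [schauderFun_eq]
  refine (abs_tent_sub_le hP.minMesh_pos h2 h1 s t).trans ?_
  rw [div_le_div_iff₀ (Real.sqrt_pos.2 hP.minMesh_pos) (Real.sqrt_pos.2 hP.mesh_pos)]
  have h5 : √(mesh (π.pts (i.1 + 1))) ≤ √c * √(minMesh (π.pts (i.1 + 1))) := by
    rw [← Real.sqrt_mul h.c_pos.le]
    exact Real.sqrt_le_sqrt (h.mesh_le_minMesh i.1)
  calc |s - t| * √(mesh (π.pts (i.1 + 1)))
      ≤ |s - t| * (√c * √(minMesh (π.pts (i.1 + 1)))) := by gcongr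
    _ = _ := by ring

theorem sqrt_mesh_le (h : GeometricBounds π r c M K ρ) (m : ℕ) :
    √(mesh (π.pts (m + 1))) ≤ √r ^ m := by
  refine Real.sqrt_le_iff.2 ⟨by positivity, ?_⟩
  rw [← pow_mul, mul_comm, pow_mul, Real.sq_sqrt h.r_pos.le]
  exact h.mesh_le m

theorem sqrt_r_lt_one (h : GeometricBounds π r c M K ρ) : √r < 1 := by
  rw [Real.sqrt_lt' one_pos, one_pow]; exact h.r_lt_one

theorem sum_schauderFun_sq_le (h : GeometricBounds π r c M K ρ) (m : ℕ) (t : ℝ) :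
    ∑ k : π.LevelIndex m, π.schauderFun ⟨m, k⟩ t ^ 2 ≤ M * r ^ m := by
  have h1 : ∑ k : π.LevelIndex m, π.schauderFun ⟨m, k⟩ t ^ 2 =
      ∑ k : π.LevelIndex m with π.schauderFun ⟨m, k⟩ t ≠ 0, π.schauderFun ⟨m, k⟩ t ^ 2 := by
    refine (Finset.sum_filter_of_ne (p := fun k : π.LevelIndex m => π.schauderFun ⟨m, k⟩ t ≠ 0)
      fun k _ hk h0 => hk ?_).symm
    rw [h0]; simp
  rw [h1]
  refine (Finset.sum_le_card_nsmul _ _ (r ^ m) fun k _ => ?_).trans ?_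
  · refine le_trans ?_ (h.mesh_le m)
    rw [← Real.sq_sqrt (π.isPartition (m + 1)).mesh_pos.le]
    exact pow_le_pow_left₀ (schauderFun_nonneg _ _) (schauderFun_le ⟨m, k⟩ t) 2
  · rw [nsmul_eq_mul]
    have := h.r_pos
    exact mul_le_mul_of_nonneg_right (h.card_active_le m t) (by positivity)

theorem abs_schauderLevel_le (h : GeometricBounds π r c M K ρ) {θ : π.SchauderIndex → ℝ} {m : ℕ}
    {B : ℝ} (hB : ∀ k, |θ ⟨m, k⟩| ≤ B) (hB0 : 0 ≤ B) (t : ℝ) :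
    |π.schauderLevel θ m t| ≤ B * M * √(mesh (π.pts (m + 1))) := by
  rw [schauderLevel, ← Finset.sum_filter_of_ne
    (p := fun k : π.LevelIndex m => π.schauderFun ⟨m, k⟩ t ≠ 0)
    (fun k _ hk h0 => hk (by rw [h0, mul_zero]))]
  refine (Finset.abs_sum_le_sum_abs _ _).trans ?_
  refine (Finset.sum_le_card_nsmul _ _ (B * √(mesh (π.pts (m + 1)))) fun k _ => ?_).trans ?_
  · rw [abs_mul, abs_of_nonneg (schauderFun_nonneg _ _)]
    exact mul_le_mul (hB k) (schauderFun_le ⟨m, k⟩ t) (schauderFun_nonneg _ _) hB0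
  · rw [nsmul_eq_mul]
    calc _ ≤ M * (B * √(mesh (π.pts (m + 1)))) :=
          mul_le_mul_of_nonneg_right (h.card_active_le m t) (by positivity)
      _ = _ := by ring

theorem abs_schauderLevel_sub_le (h : GeometricBounds π r c M K ρ) {θ : π.SchauderIndex → ℝ}
    {m : ℕ} {B : ℝ} (hB : ∀ k, |θ ⟨m, k⟩| ≤ B) (hB0 : 0 ≤ B) (s t : ℝ) :
    |π.schauderLevel θ m s - π.schauderLevel θ m t| ≤
      2 * B * M * (√c * |s - t| / √(mesh (π.pts (m + 1)))) := by
  classical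
  set A : ℝ → Finset (π.LevelIndex m) := fun t =>
    Finset.univ.filter fun k : π.LevelIndex m => π.schauderFun ⟨m, k⟩ t ≠ 0
  set D := √c * |s - t| / √(mesh (π.pts (m + 1)))
  have hD : 0 ≤ D := by positivity
  rw [schauderLevel, schauderLevel, ← Finset.sum_sub_distrib]
  have hsub : ∑ k : π.LevelIndex m, (θ ⟨m, k⟩ * π.schauderFun ⟨m, k⟩ s -
      θ ⟨m, k⟩ * π.schauderFun ⟨m, k⟩ t) = ∑ k ∈ A s ∪ A t, (θ ⟨m, k⟩ * π.schauderFun ⟨m, k⟩ s -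
      θ ⟨m, k⟩ * π.schauderFun ⟨m, k⟩ t) := by
    refine (Finset.sum_subset (Finset.subset_univ _) fun k _ hk => ?_).symm
    have h1 : π.schauderFun ⟨m, k⟩ s = 0 := by
      by_contra h0; exact hk (Finset.mem_union_left _ (Finset.mem_filter.2 ⟨Finset.mem_univ _, h0⟩))
    have h2 : π.schauderFun ⟨m, k⟩ t = 0 := by
      by_contra h0
      exact hk (Finset.mem_union_right _ (Finset.mem_filter.2 ⟨Finset.mem_univ _, h0⟩))
    rw [h1, h2]; simp
  rw [hsub]
  refine (Finset.abs_sum_le_sum_abs _ _).trans ?_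
  refine (Finset.sum_le_card_nsmul _ _ (B * D) fun k _ => ?_).trans ?_
  · rw [← mul_sub, abs_mul]
    exact mul_le_mul (hB k) (h.abs_schauderFun_sub_le ⟨m, k⟩ s t) (abs_nonneg _) hB0
  · rw [nsmul_eq_mul]
    have h1 : ((A s ∪ A t).card : ℝ) ≤ M + M := by
      calc ((A s ∪ A t).card : ℝ) ≤ (A s).card + (A t).card := by
            exact_mod_cast Finset.card_union_le _ _
        _ ≤ M + M := add_le_add (h.card_active_le m s) (h.card_active_le m t)
    calc _ ≤ (M + M) * (B * D) := mul_le_mul_of_nonneg_right h1 (by positivity)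
      _ = _ := by ring

theorem summable_level_bound (C : ℝ) {q : ℝ} (hq0 : 0 ≤ q) (hq1 : q < 1) :
    Summable fun m : ℕ => C * ((m : ℝ) + 1) * q ^ m := by
  have h1 : Summable fun m : ℕ => (m : ℝ) ^ 1 * q ^ m :=
    summable_pow_mul_geometric_of_norm_lt_one 1 (by rwa [Real.norm_of_nonneg hq0])
  have h2 : Summable fun m : ℕ => q ^ m := summable_geometric_of_lt_one hq0 hq1
  refine ((h1.add h2).mul_left C).congr fun m => ?_
  ring

theorem abs_schauderLevel_le_geometric (h : GeometricBounds π r c M K ρ)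
    {θ : π.SchauderIndex → ℝ} {C : ℝ} (hC : 0 ≤ C) (hθ : ∀ i : π.SchauderIndex, |θ i| ≤ C * (i.1 + 1))
    (m : ℕ) (t : ℝ) : |π.schauderLevel θ m t| ≤ C * M * (m + 1) * √r ^ m := by
  refine (h.abs_schauderLevel_le (B := C * ((m : ℝ) + 1)) (fun k => hθ ⟨m, k⟩) (by positivity) t).trans ?_
  have := h.M_pos
  calc C * ((m : ℝ) + 1) * M * √(mesh (π.pts (m + 1))) ≤ C * ((m : ℝ) + 1) * M * √r ^ m := by
        gcongr; exact h.sqrt_mesh_le m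
    _ = _ := by ring

theorem summable_schauderLevel (h : GeometricBounds π r c M K ρ)
    {θ : π.SchauderIndex → ℝ} {C : ℝ} (hC : 0 ≤ C) (hθ : ∀ i : π.SchauderIndex, |θ i| ≤ C * (i.1 + 1))
    (t : ℝ) : Summable fun m => π.schauderLevel θ m t :=
  Summable.of_norm_bounded (summable_level_bound (C * M) (Real.sqrt_nonneg r) h.sqrt_r_lt_one)
    fun m => h.abs_schauderLevel_le_geometric hC hθ m t

theorem tendstoUniformlyOn_schauderTrunc (h : GeometricBounds π r c M K ρ)
    {θ : π.SchauderIndex → ℝ} {C : ℝ} (hC : 0 ≤ C) (hθ : ∀ i : π.SchauderIndex, |θ i| ≤ C * (i.1 + 1))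
    (z : ℝ) : TendstoUniformlyOn (fun n t => π.schauderTrunc z θ n t)
      (fun t => π.schauderSeries z θ t) atTop (Icc 0 1) := by
  have h1 := tendstoUniformlyOn_tsum_nat (f := fun m t => π.schauderLevel θ m t) (s := Icc (0 : ℝ) 1)
    (summable_level_bound (C * M) (Real.sqrt_nonneg r) h.sqrt_r_lt_one)
    fun m t _ => h.abs_schauderLevel_le_geometric hC hθ m t
  rw [Metric.tendstoUniformlyOn_iff] at h1 ⊢
  intro ε hε
  filter_upwards [h1 ε hε] with n hn t ht
  simpa [schauderTrunc, schauderSeries, dist_add_left] using hn t ht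

theorem continuous_schauderTrunc (z : ℝ) (θ : π.SchauderIndex → ℝ) (n : ℕ) :
    Continuous (π.schauderTrunc z θ n) := by
  have : ∀ i, Continuous (π.schauderFun i) := fun i => by
    rw [show π.schauderFun i = _ from funext (schauderFun_eq i)]
    exact continuous_tent _ _ _
  unfold schauderTrunc schauderLevel
  fun_prop

theorem continuousOn_schauderSeries (h : GeometricBounds π r c M K ρ)
    {θ : π.SchauderIndex → ℝ} {C : ℝ} (hC : 0 ≤ C) (hθ : ∀ i : π.SchauderIndex, |θ i| ≤ C * (i.1 + 1))
    (z : ℝ) : ContinuousOn (π.schauderSeries z θ) (Icc 0 1) :=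
  (h.tendstoUniformlyOn_schauderTrunc hC hθ z).continuousOn
    (Frequently.of_forall fun n => (continuous_schauderTrunc z θ n).continuousOn)

/-- Interpolating between the uniform bound and the Lipschitz bound of a level gives its Hölder
constant, which decays geometrically for exponents below `1/2`. -/
theorem abs_schauderLevel_sub_le_rpow (h : GeometricBounds π r c M K ρ)
    {θ : π.SchauderIndex → ℝ} {C : ℝ} (hC : 0 ≤ C) (hθ : ∀ i : π.SchauderIndex, |θ i| ≤ C * (i.1 + 1))
    {α : ℝ} (hα0 : 0 ≤ α) (hα : α < 1 / 2) (m : ℕ) (s t : ℝ) :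
    |π.schauderLevel θ m s - π.schauderLevel θ m t| ≤
      2 * C * M * max 1 (√c) * (m + 1) * (√r ^ (1 - 2 * α)) ^ m * |s - t| ^ α := by
  set η := √(mesh (π.pts (m + 1)))
  have hη : 0 < η := Real.sqrt_pos.2 (π.isPartition _).mesh_pos
  have hM := h.M_pos
  set D := 2 * C * M * max 1 (√c) * ((m : ℝ) + 1)
  have hmax : 0 < max 1 (√c) := one_pos.trans_le (le_max_left _ _)
  have hD : 0 ≤ D := by positivity
  set u := |π.schauderLevel θ m s - π.schauderLevel θ m t|
  have hB0 : 0 ≤ C * ((m : ℝ) + 1) := by positivity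
  have hu1 : u ≤ D * η := by
    have h1 := h.abs_schauderLevel_le (B := C * ((m : ℝ) + 1)) (fun k => hθ ⟨m, k⟩) hB0 s
    have h2 := h.abs_schauderLevel_le (B := C * ((m : ℝ) + 1)) (fun k => hθ ⟨m, k⟩) hB0 t
    have h3 : u ≤ 2 * (C * ((m : ℝ) + 1) * M * η) := (abs_sub _ _).trans (by linarith)
    refine h3.trans ?_
    calc 2 * (C * ((m : ℝ) + 1) * M * η) = 2 * C * M * 1 * ((m : ℝ) + 1) * η := by ring
      _ ≤ D * η := by simp only [D]; gcongr; exact le_max_left _ _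
  have hu2 : u ≤ D * (|s - t| / η) := by
    refine (h.abs_schauderLevel_sub_le (B := C * ((m : ℝ) + 1)) (fun k => hθ ⟨m, k⟩) hB0 s t).trans ?_
    calc 2 * (C * ((m : ℝ) + 1)) * M * (√c * |s - t| / η)
        = 2 * C * M * √c * ((m : ℝ) + 1) * (|s - t| / η) := by ring
      _ ≤ D * (|s - t| / η) := by simp only [D]; gcongr; exact le_max_right _ _
  have hu0 : 0 ≤ u := abs_nonneg _
  have hηr : η ^ (1 - 2 * α) ≤ (√r ^ (1 - 2 * α)) ^ m := by
    rw [← Real.rpow_natCast (√r ^ (1 - 2 * α)) m, ← Real.rpow_mul (Real.sqrt_nonneg r),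
      mul_comm (1 - 2 * α) (m : ℝ), Real.rpow_mul (Real.sqrt_nonneg r), Real.rpow_natCast]
    exact Real.rpow_le_rpow hη.le (h.sqrt_mesh_le m) (by linarith)
  have h1α : 0 ≤ 1 - α := by linarith
  calc u = u ^ (1 - α) * u ^ α := by
        rw [← Real.rpow_add' hu0 (by norm_num), sub_add_cancel, Real.rpow_one]
    _ ≤ (D * η) ^ (1 - α) * (D * (|s - t| / η)) ^ α := by
        exact mul_le_mul (Real.rpow_le_rpow hu0 hu1 h1α) (Real.rpow_le_rpow hu0 hu2 hα0)
          (by positivity) (by positivity)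
    _ = D * η ^ (1 - 2 * α) * |s - t| ^ α := by
        rw [Real.mul_rpow hD hη.le, Real.mul_rpow hD (by positivity),
          Real.div_rpow (abs_nonneg _) hη.le]
        have e1 : D ^ (1 - α) * D ^ α = D := by
          rw [← Real.rpow_add' hD (by norm_num), sub_add_cancel, Real.rpow_one]
        have e2 : η ^ (1 - α) = η ^ (1 - 2 * α) * η ^ α := by
          rw [← Real.rpow_add hη]; congr 1; ring
        have e3 : 0 < η ^ α := Real.rpow_pos_of_pos hη _
        calc D ^ (1 - α) * η ^ (1 - α) * (D ^ α * (|s - t| ^ α / η ^ α))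
            = (D ^ (1 - α) * D ^ α) * (η ^ (1 - α) * (|s - t| ^ α / η ^ α)) := by ring
          _ = D * η ^ (1 - 2 * α) * |s - t| ^ α := by rw [e1, e2]; field_simp
    _ ≤ D * (√r ^ (1 - 2 * α)) ^ m * |s - t| ^ α := by gcongr

theorem exists_holderOnWith_schauderSeries (h : GeometricBounds π r c M K ρ)
    {θ : π.SchauderIndex → ℝ} {C : ℝ} (hC : 0 ≤ C) (hθ : ∀ i : π.SchauderIndex, |θ i| ≤ C * (i.1 + 1))
    (z : ℝ) {α : ℝ≥0} (hα : α < 1 / 2) :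
    ∃ A : ℝ≥0, HolderOnWith A α (π.schauderSeries z θ) (Icc 0 1) := by
  have hα' : (α : ℝ) < 1 / 2 := by exact_mod_cast hα
  set σ := √r ^ (1 - 2 * (α : ℝ))
  have hσ0 : 0 ≤ σ := Real.rpow_nonneg (Real.sqrt_nonneg _) _
  have hσ1 : σ < 1 := Real.rpow_lt_one (Real.sqrt_nonneg _) h.sqrt_r_lt_one (by linarith)
  have hM := h.M_pos
  set D := 2 * C * M * max 1 (√c)
  have hsum := summable_level_bound D hσ0 hσ1
  set S := ∑' m : ℕ, D * ((m : ℝ) + 1) * σ ^ m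
  have hD : 0 ≤ D := by
    have : 0 < max 1 (√c) := one_pos.trans_le (le_max_left _ _)
    positivity
  have hS : 0 ≤ S := tsum_nonneg fun m => by positivity
  refine ⟨(|z| + S).toNNReal, fun s hs t ht => ?_⟩
  have hst : |s - t| ≤ 1 := by
    rw [abs_le]; constructor <;> linarith [hs.1, hs.2, ht.1, ht.2]
  have key : |π.schauderSeries z θ s - π.schauderSeries z θ t| ≤ (|z| + S) * |s - t| ^ (α : ℝ) := by
    have e : π.schauderSeries z θ s - π.schauderSeries z θ t = z * (s - t) +
        ∑' m, (π.schauderLevel θ m s - π.schauderLevel θ m t) := by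
      rw [(h.summable_schauderLevel hC hθ s).tsum_sub (h.summable_schauderLevel hC hθ t)]
      simp only [schauderSeries]; ring
    have h1 : |∑' m, (π.schauderLevel θ m s - π.schauderLevel θ m t)| ≤ S * |s - t| ^ (α : ℝ) := by
      rw [← Real.norm_eq_abs]
      exact tsum_of_norm_bounded (hsum.hasSum.mul_right _)
        fun m => h.abs_schauderLevel_sub_le_rpow hC hθ α.coe_nonneg hα' m s t
    have h2 : |s - t| ≤ |s - t| ^ (α : ℝ) := by
      rcases eq_or_lt_of_le (abs_nonneg (s - t)) with h0 | h0
      · rw [← h0]; exact Real.rpow_nonneg le_rfl _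
      · calc |s - t| = |s - t| ^ (1 : ℝ) := (Real.rpow_one _).symm
          _ ≤ _ := Real.rpow_le_rpow_of_exponent_ge h0 hst (by linarith)
    rw [e, add_mul]
    refine (abs_add_le _ _).trans (add_le_add ?_ h1)
    rw [abs_mul]
    gcongr
  rw [edist_dist, edist_dist, Real.dist_eq, Real.dist_eq,
    ENNReal.ofReal_rpow_of_nonneg (abs_nonneg _) α.coe_nonneg]
  change _ ≤ ENNReal.ofReal _ * _
  rw [← ENNReal.ofReal_mul (by positivity)]
  exact ENNReal.ofReal_le_ofReal key

end GeometricBounds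

/-! ### Moments and growth of sub-Gaussian families -/

section Moments

variable {Ω : Type*} [MeasurableSpace Ω] {μ : Measure Ω}

theorem integrable_pow_four {X : Ω → ℝ} (hX : MemLp X 4 μ) : Integrable (fun ω => X ω ^ 4) μ := by
  have h := hX.integrable_norm_pow (p := 4) (by norm_num)
  refine h.congr (ae_of_all _ fun ω => ?_)
  simp only [Real.norm_eq_abs]
  exact (by decide : Even 4).pow_abs _

theorem integrable_pow_eight {X : Ω → ℝ} (hX : MemLp X 8 μ) : Integrable (fun ω => X ω ^ 8) μ := by
  have h := hX.integrable_norm_pow (p := 8) (by norm_num)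
  refine h.congr (ae_of_all _ fun ω => ?_)
  simp only [Real.norm_eq_abs]
  exact (by decide : Even 8).pow_abs _

theorem exists_eighth_moment_bound [IsProbabilityMeasure μ] {ι : Type*} {θ : ι → Ω → ℝ}
    (hθm : ∀ i, Measurable (θ i))
    (htail : ∃ C₁ C₂ : ℝ, 0 < C₁ ∧ 0 < C₂ ∧ ∀ δ : ℝ, 0 < δ → ∀ i,
      μ.real {ω | δ ≤ |θ i ω|} ≤ C₁ * Real.exp (-(δ ^ 2 / (2 * C₂)))) :
    ∃ M : ℝ, 0 ≤ M ∧ ∀ i, MemLp (θ i) 8 μ ∧ ∫ ω, θ i ω ^ 8 ∂μ ≤ M := by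
  obtain ⟨C₁, C₂, hC₁, hC₂, htail⟩ := htail
  set g : ℝ → ℝ := fun t => C₁ * (t ^ (7 : ℝ) * Real.exp (-(1 / (2 * C₂)) * t ^ 2))
  have hg : Integrable g (volume.restrict (Ioi 0)) :=
    ((integrable_rpow_mul_exp_neg_mul_sq (by positivity) (by norm_num)).const_mul _).integrableOn
  set J : ENNReal := ENNReal.ofReal 8 * ∫⁻ t in Ioi (0 : ℝ), ENNReal.ofReal (g t)
  have hJ : J ≠ ⊤ := ENNReal.mul_ne_top ENNReal.ofReal_ne_top hg.lintegral_lt_top.ne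
  have hbound : ∀ i, ∫⁻ ω, ENNReal.ofReal (θ i ω ^ 8) ∂μ ≤ J := fun i => by
    have h1 := lintegral_rpow_eq_lintegral_meas_le_mul μ (f := fun ω => |θ i ω|)
      (ae_of_all _ fun ω => abs_nonneg _) (hθm i).abs.aemeasurable (p := 8) (by norm_num)
    have h2 : ∀ ω, |θ i ω| ^ (8 : ℝ) = θ i ω ^ 8 := fun ω => by
      rw [show (8 : ℝ) = ((8 : ℕ) : ℝ) by norm_num, Real.rpow_natCast]
      exact (by decide : Even 8).pow_abs _
    simp only [h2] at h1
    rw [h1]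
    refine mul_le_mul_right (setLIntegral_mono' measurableSet_Ioi fun t ht => ?_) _
    have ht' : (0 : ℝ) < t := ht
    have h3 : μ {ω | t ≤ |θ i ω|} ≤ ENNReal.ofReal (C₁ * Real.exp (-(t ^ 2 / (2 * C₂)))) := by
      rw [← ofReal_measureReal]
      exact ENNReal.ofReal_le_ofReal (htail t ht' i)
    calc μ {ω | t ≤ |θ i ω|} * ENNReal.ofReal (t ^ ((8 : ℝ) - 1))
        ≤ ENNReal.ofReal (C₁ * Real.exp (-(t ^ 2 / (2 * C₂)))) *
            ENNReal.ofReal (t ^ ((8 : ℝ) - 1)) := by gcongr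
      _ = ENNReal.ofReal (g t) := by
        rw [← ENNReal.ofReal_mul (by positivity)]
        congr 1
        simp only [g]
        rw [show (8 : ℝ) - 1 = 7 by norm_num,
          show -(1 / (2 * C₂)) * t ^ 2 = -(t ^ 2 / (2 * C₂)) by ring]
        ring
  refine ⟨J.toReal, ENNReal.toReal_nonneg, fun i => ?_⟩
  have hnn : ∀ ω, 0 ≤ θ i ω ^ 8 := fun ω => (by decide : Even 8).pow_nonneg _
  have hint : Integrable (fun ω => θ i ω ^ 8) μ := by
    refine ⟨((hθm i).pow_const 8).aestronglyMeasurable, ?_⟩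
    rw [hasFiniteIntegral_iff_ofReal (ae_of_all _ hnn)]
    exact (hbound i).trans_lt hJ.lt_top
  refine ⟨?_, ?_⟩
  · rw [← integrable_norm_rpow_iff (hθm i).aestronglyMeasurable (by norm_num) (by norm_num)]
    refine hint.congr (ae_of_all _ fun ω => ?_)
    simp only [Real.norm_eq_abs]
    rw [show (8 : ENNReal).toReal = ((8 : ℕ) : ℝ) by norm_num, Real.rpow_natCast]
    exact ((by decide : Even 8).pow_abs _).symm
  · rw [integral_eq_lintegral_of_nonneg_ae (ae_of_all _ hnn) hint.1]
    exact ENNReal.toReal_mono hJ (hbound i)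

/-- Since there are only exponentially many coefficients of level `m`, almost surely they grow at
most linearly in `m`. -/
theorem ae_exists_linear_growth [IsProbabilityMeasure μ] {π : PartitionSeq} {r c M K ρ : ℝ}
    (h : GeometricBounds π r c M K ρ) {θ : π.SchauderIndex → Ω → ℝ}
    (htail : ∃ C₁ C₂ : ℝ, 0 < C₁ ∧ 0 < C₂ ∧ ∀ δ : ℝ, 0 < δ → ∀ i,
      μ.real {ω | δ ≤ |θ i ω|} ≤ C₁ * Real.exp (-(δ ^ 2 / (2 * C₂)))) :
    ∀ᵐ ω ∂μ, ∃ C : ℝ, 0 ≤ C ∧ ∀ i, |θ i ω| ≤ C * (i.1 + 1) := by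
  obtain ⟨C₁, C₂, hC₁, hC₂, htail⟩ := htail
  set s : π.SchauderIndex → Set Ω := fun i => {ω | ((i.1 : ℝ) + 1) ≤ |θ i ω|}
  have hρ := h.ρ_pos
  have hK := h.K_pos
  set u : ℕ → ℝ := fun m => K * ρ ^ m * (C₁ * Real.exp (-(((m : ℝ) + 1) ^ 2 / (2 * C₂))))
  have hu0 : ∀ m, 0 ≤ u m := fun m => by positivity
  have hu : Summable u := by
    refine summable_of_ratio_test_tendsto_lt_one (l := 0) one_pos
      (Eventually.of_forall fun m => by positivity) ?_
    have hratio : ∀ m : ℕ, ‖u (m + 1)‖ / ‖u m‖ = ρ * Real.exp (-((2 * (m : ℝ) + 3) / (2 * C₂))) := by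
      intro m
      rw [Real.norm_of_nonneg (hu0 _), Real.norm_of_nonneg (hu0 _)]
      simp only [u]
      rw [div_eq_iff (by positivity), pow_succ]
      have : Real.exp (-((((m + 1 : ℕ) : ℝ) + 1) ^ 2 / (2 * C₂))) =
          Real.exp (-((2 * (m : ℝ) + 3) / (2 * C₂))) * Real.exp (-(((m : ℝ) + 1) ^ 2 / (2 * C₂))) := by
        rw [← Real.exp_add]
        congr 1
        push_cast
        ring
      rw [this]; ring
    simp_rw [hratio]
    rw [← mul_zero ρ]
    refine Tendsto.const_mul _ (Real.tendsto_exp_neg_atTop_nhds_zero.comp ?_)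
    refine Tendsto.atTop_div_const (by positivity) (tendsto_atTop_add_const_right _ _ ?_)
    exact tendsto_natCast_atTop_atTop.const_mul_atTop two_pos
  have hsum : ∑' i, μ (s i) ≠ ⊤ := by
    rw [ENNReal.tsum_sigma' fun i => μ (s i)]
    refine ne_top_of_le_ne_top hu.tsum_ofReal_ne_top (ENNReal.tsum_le_tsum fun m => ?_)
    have h1 : ∀ k : π.LevelIndex m, μ (s ⟨m, k⟩) ≤
        ENNReal.ofReal (C₁ * Real.exp (-(((m : ℝ) + 1) ^ 2 / (2 * C₂)))) := fun k => by
      rw [← ofReal_measureReal]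
      exact ENNReal.ofReal_le_ofReal (htail _ (by positivity) ⟨m, k⟩)
    rw [tsum_fintype]
    refine (Finset.sum_le_card_nsmul _ _ _ fun k _ => h1 k).trans ?_
    rw [nsmul_eq_mul, ← ENNReal.ofReal_natCast, ← ENNReal.ofReal_mul (Nat.cast_nonneg _)]
    refine ENNReal.ofReal_le_ofReal (mul_le_mul_of_nonneg_right ?_ (by positivity))
    exact h.card_level_le m
  filter_upwards [ae_finite_setOfPred_mem hsum] with ω hω
  refine ⟨1 + ∑ i ∈ hω.toFinset, |θ i ω|, by positivity, fun i => ?_⟩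
  have hsn : 0 ≤ ∑ i ∈ hω.toFinset, |θ i ω| := Finset.sum_nonneg fun i _ => abs_nonneg _
  have hi0 : (0 : ℝ) ≤ (i.1 : ℝ) := Nat.cast_nonneg _
  by_cases hi : ω ∈ s i
  · have h1 : |θ i ω| ≤ ∑ i ∈ hω.toFinset, |θ i ω| :=
      Finset.single_le_sum (f := fun i => |θ i ω|) (fun i _ => abs_nonneg _)
        ((Set.Finite.mem_toFinset hω).2 hi)
    nlinarith
  · have h1 : |θ i ω| < (i.1 : ℝ) + 1 := not_le.1 hi
    nlinarith

/-! ### Fourth moments of quadratic forms in independent variables -/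

theorem sq_integral_mul_le {f g : Ω → ℝ} (hf : Integrable (fun ω => f ω ^ 2) μ)
    (hg : Integrable (fun ω => g ω ^ 2) μ) (hfg : Integrable (fun ω => f ω * g ω) μ) :
    (∫ ω, f ω * g ω ∂μ) ^ 2 ≤ (∫ ω, f ω ^ 2 ∂μ) * ∫ ω, g ω ^ 2 ∂μ := by
  have h := discrim_le_zero (a := ∫ ω, g ω ^ 2 ∂μ) (b := 2 * ∫ ω, f ω * g ω ∂μ)
    (c := ∫ ω, f ω ^ 2 ∂μ) fun x => by
      have h1 : 0 ≤ ∫ ω, (f ω + x * g ω) ^ 2 ∂μ := integral_nonneg fun ω => sq_nonneg _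
      have h2 : ∫ ω, (f ω + x * g ω) ^ 2 ∂μ =
          ∫ ω, (f ω ^ 2 + (2 * x * (f ω * g ω) + x * x * g ω ^ 2)) ∂μ := by
        congr 1; ext ω; ring
      have i1 : Integrable (fun ω => 2 * x * (f ω * g ω)) μ := hfg.const_mul _
      have i2 : Integrable (fun ω => x * x * g ω ^ 2) μ := hg.const_mul _
      have i3 : Integrable (fun ω => 2 * x * (f ω * g ω) + x * x * g ω ^ 2) μ := i1.add i2
      rw [h2, integral_add hf i3, integral_add i1 i2, integral_const_mul,
        integral_const_mul] at h1
      linarith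
  rw [discrim] at h
  linarith

/-- Adding an increment `d` with `E[X³ d] = 0`, fourth moments of order `V²` and `v²` combine into
one of order `(V + v)²`. The factor `16` is chosen so that the mixed term `8 E[X² d²]`, which is at
most `32 C V v` by the Cauchy–Schwarz inequality, equals the cross term of the right-hand side. -/
theorem fourth_moment_add_le {X d : Ω → ℝ} (hX : MemLp X 4 μ) (hd : MemLp d 4 μ)
    (h0 : ∫ ω, X ω ^ 3 * d ω ∂μ = 0) {V v C : ℝ} (hV : 0 ≤ V) (hv : 0 ≤ v) (hC : 0 ≤ C)
    (hXV : ∫ ω, X ω ^ 4 ∂μ ≤ 16 * C * V ^ 2) (hdv : ∫ ω, d ω ^ 4 ∂μ ≤ C * v ^ 2) :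
    ∫ ω, (X ω + d ω) ^ 4 ∂μ ≤ 16 * C * (V + v) ^ 2 := by
  have iX := integrable_pow_four hX
  have id := integrable_pow_four hd
  have isum : Integrable (fun ω => X ω ^ 4 + d ω ^ 4) μ := iX.add id
  have i31 : Integrable (fun ω => X ω ^ 3 * d ω) μ := by
    refine isum.mono' ((hX.1.pow 3).mul hd.1) (ae_of_all _ fun ω => ?_)
    rw [Real.norm_eq_abs, abs_le]
    constructor <;> nlinarith [sq_nonneg (X ω ^ 2 + X ω * d ω), sq_nonneg (X ω ^ 2 - X ω * d ω),
      sq_nonneg (X ω ^ 2 - d ω ^ 2), sq_nonneg (X ω * d ω)]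
  have i22 : Integrable (fun ω => X ω ^ 2 * d ω ^ 2) μ := by
    refine isum.mono' ((hX.1.pow 2).mul (hd.1.pow 2)) (ae_of_all _ fun ω => ?_)
    rw [Real.norm_of_nonneg (by positivity)]
    nlinarith [sq_nonneg (X ω ^ 2 - d ω ^ 2), sq_nonneg (X ω ^ 2), sq_nonneg (d ω ^ 2)]
  have hcs := sq_integral_mul_le (f := fun ω => X ω ^ 2) (g := fun ω => d ω ^ 2)
    (by simpa only [← pow_mul] using iX) (by simpa only [← pow_mul] using id) i22
  simp only [← pow_mul] at hcs
  have hI : ∫ ω, X ω ^ 2 * d ω ^ 2 ∂μ ≤ 4 * C * V * v := by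
    refine le_of_sq_le_sq ?_ (by positivity)
    calc (∫ ω, X ω ^ 2 * d ω ^ 2 ∂μ) ^ 2 ≤ (16 * C * V ^ 2) * (C * v ^ 2) :=
          hcs.trans (mul_le_mul hXV hdv (integral_nonneg fun ω => (by decide : Even (2 * 2)).pow_nonneg _)
            (by positivity))
      _ = (4 * C * V * v) ^ 2 := by ring
  have j1 : Integrable (fun ω => 8 * (X ω ^ 2 * d ω ^ 2) + 3 * d ω ^ 4) μ :=
    (i22.const_mul 8).add (id.const_mul 3)
  have j2 : Integrable (fun ω => 4 * (X ω ^ 3 * d ω) +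
      (8 * (X ω ^ 2 * d ω ^ 2) + 3 * d ω ^ 4)) μ := (i31.const_mul 4).add j1
  calc ∫ ω, (X ω + d ω) ^ 4 ∂μ
      ≤ ∫ ω, (X ω ^ 4 + (4 * (X ω ^ 3 * d ω) + (8 * (X ω ^ 2 * d ω ^ 2) + 3 * d ω ^ 4))) ∂μ := by
        refine integral_mono_of_nonneg
          (ae_of_all _ fun ω => (by decide : Even 4).pow_nonneg _) (iX.add j2) (ae_of_all _ fun ω => ?_)
        simp only
        nlinarith [sq_nonneg (X ω * d ω - d ω ^ 2)]
    _ = ∫ ω, X ω ^ 4 ∂μ + (4 * ∫ ω, X ω ^ 3 * d ω ∂μ +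
          (8 * ∫ ω, X ω ^ 2 * d ω ^ 2 ∂μ + 3 * ∫ ω, d ω ^ 4 ∂μ)) := by
        rw [integral_add iX j2, integral_add (i31.const_mul 4) j1,
          integral_add (i22.const_mul 8) (id.const_mul 3)]
        simp only [integral_const_mul]
    _ ≤ 16 * C * V ^ 2 + (4 * 0 + (8 * (4 * C * V * v) + 3 * (C * v ^ 2))) := by
        rw [h0]; gcongr
    _ ≤ 16 * C * (V + v) ^ 2 := by nlinarith [mul_nonneg hC (sq_nonneg v)]

variable {ι : Type*} {θ : ι → Ω → ℝ}

theorem integral_mul_of_indep (hindep : iIndepFun θ μ) (hθm : ∀ i, Measurable (θ i))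
    {F : Finset ι} {n : ι} (hn : n ∉ F) {G : (F → ℝ) → ℝ} (hG : Measurable G) {H : ℝ → ℝ}
    (hH : Measurable H) :
    ∫ ω, G (fun i : F => θ i ω) * H (θ n ω) ∂μ =
      (∫ ω, G (fun i : F => θ i ω) ∂μ) * ∫ ω, H (θ n ω) ∂μ := by
  have h1 := hindep.indepFun_finset F {n} (by simpa using hn) hθm
  have h2 := h1.comp (φ := G) 
    (ψ := fun f : ({n} : Finset ι) → ℝ => H (f ⟨n, Finset.mem_singleton_self n⟩)) hG
    (hH.comp (measurable_pi_apply _))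
  exact h2.integral_fun_mul_eq_mul_integral
    (hG.comp (measurable_pi_lambda _ fun i => hθm i)).aestronglyMeasurable
    (hH.comp (hθm n)).aestronglyMeasurable

theorem memLp_four_of_eight [IsProbabilityMeasure μ] {X : Ω → ℝ} (hX : MemLp X 8 μ) :
    MemLp X 4 μ := hX.mono_exponent (by norm_num)

instance holderTriple_eight_eight_four : ENNReal.HolderTriple 8 8 4 where
  inv_add_inv_eq_inv := by
    rw [← two_mul, show (8 : ENNReal) = 2 * 4 by norm_num,
      ENNReal.mul_inv (by norm_num) (by norm_num), ← mul_assoc,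
      ENNReal.mul_inv_cancel (by norm_num) (by norm_num), one_mul]

theorem memLp_linearForm [IsProbabilityMeasure μ] (hθ : ∀ i, MemLp (θ i) 8 μ) (F : Finset ι)
    (b : ι → ℝ) : MemLp (fun ω => ∑ i ∈ F, b i * θ i ω) 8 μ :=
  memLp_finsetSum F fun i _ => (hθ i).const_mul (b i)

theorem memLp_quadraticForm [IsProbabilityMeasure μ] (hθ : ∀ i, MemLp (θ i) 8 μ) (F : Finset ι)
    (A : ι → ι → ℝ) (e : ℝ) :
    MemLp (fun ω => ∑ i ∈ F, ∑ j ∈ F, A i j * (θ i ω * θ j ω) - e) 4 μ :=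
  (memLp_finsetSum F fun i _ => memLp_finsetSum F fun j _ =>
    ((hθ j).mul' (hθ i) (r := 4)).const_mul (A i j)).sub (memLp_const e)

theorem integral_pow_four_le_of_eight [IsProbabilityMeasure μ] {X : Ω → ℝ} (hX : MemLp X 8 μ)
    {M : ℝ} (hM : ∫ ω, X ω ^ 8 ∂μ ≤ M) : ∫ ω, X ω ^ 4 ∂μ ≤ 1 + M := by
  calc ∫ ω, X ω ^ 4 ∂μ ≤ ∫ ω, (1 + X ω ^ 8) ∂μ :=
        integral_mono (integrable_pow_four (memLp_four_of_eight hX))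
          ((integrable_const _).add (integrable_pow_eight hX)) fun ω => by
            simp only
            nlinarith [sq_nonneg (X ω ^ 4 - 1)]
    _ = 1 + ∫ ω, X ω ^ 8 ∂μ := by
        rw [integral_add (integrable_const _) (integrable_pow_eight hX)]; simp
    _ ≤ 1 + M := by linarith

theorem fourth_moment_linearForm_le [IsProbabilityMeasure μ] (hindep : iIndepFun θ μ)
    (hθm : ∀ i, Measurable (θ i)) (hmean : ∀ i, ∫ ω, θ i ω ∂μ = 0) {M : ℝ} (hM : 0 ≤ M)
    (hθ : ∀ i, MemLp (θ i) 8 μ ∧ ∫ ω, θ i ω ^ 8 ∂μ ≤ M) (F : Finset ι) (b : ι → ℝ) :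
    ∫ ω, (∑ i ∈ F, b i * θ i ω) ^ 4 ∂μ ≤ 16 * (1 + M) * (∑ i ∈ F, b i ^ 2) ^ 2 := by
  classical
  induction F using Finset.induction_on with
  | empty => simp
  | insert n F hn ih =>
    simp only [Finset.sum_insert hn]
    simp_rw [add_comm (b n * _), add_comm (b n ^ 2)]
    refine fourth_moment_add_le (memLp_four_of_eight (memLp_linearForm (fun i => (hθ i).1) F b))
      (memLp_four_of_eight ((hθ n).1.const_mul (b n))) ?_
      (Finset.sum_nonneg fun i _ => sq_nonneg _) (sq_nonneg _) (by linarith) ih ?_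
    · have h1 := integral_mul_of_indep hindep hθm hn
        (G := fun f => (∑ i : F, b i * f i) ^ 3) (H := fun x => b n * x)
        (by fun_prop) (by fun_prop)
      have e : ∀ ω, ∑ i : F, b i * θ i ω = ∑ i ∈ F, b i * θ i ω := fun ω =>
        Finset.sum_coe_sort F fun i => b i * θ i ω
      simp only [e] at h1
      rw [h1, integral_const_mul, hmean n]; simp
    · simp_rw [mul_pow]
      rw [integral_const_mul, ← pow_mul, mul_comm]
      exact mul_le_mul_of_nonneg_right (integral_pow_four_le_of_eight (hθ n).1 (hθ n).2)
        (by positivity)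

/-- The centred quadratic form `∑ A_ij θ_i θ_j - tr A` in independent standardised variables has
fourth moment at most a constant times the fourth power of the Frobenius norm of `A`. Adding one
variable at a time, the form is a martingale, whose increments are handled by
`fourth_moment_add_le`. -/
theorem fourth_moment_quadraticForm_le [IsProbabilityMeasure μ] (hindep : iIndepFun θ μ)
    (hθm : ∀ i, Measurable (θ i)) (hmean : ∀ i, ∫ ω, θ i ω ∂μ = 0)
    (hsq : ∀ i, ∫ ω, θ i ω ^ 2 ∂μ = 1) {M : ℝ} (hM : 0 ≤ M)
    (hθ : ∀ i, MemLp (θ i) 8 μ ∧ ∫ ω, θ i ω ^ 8 ∂μ ≤ M) (F : Finset ι) (A : ι → ι → ℝ) :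
    ∫ ω, (∑ i ∈ F, ∑ j ∈ F, A i j * (θ i ω * θ j ω) - ∑ i ∈ F, A i i) ^ 4 ∂μ ≤
      16 * (8 * (8 * (1 + M) + 64 * (1 + M) ^ 2)) * (∑ i ∈ F, ∑ j ∈ F, A i j ^ 2) ^ 2 := by
  classical
  induction F using Finset.induction_on with
  | empty => simp
  | insert n F hn ih =>
    set b : ι → ℝ := fun j => A n j + A j n
    set L : Ω → ℝ := fun ω => ∑ j ∈ F, b j * θ j ω
    set X : Ω → ℝ := fun ω => ∑ i ∈ F, ∑ j ∈ F, A i j * (θ i ω * θ j ω) - ∑ i ∈ F, A i i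
    set W := ∑ j ∈ F, (A n j ^ 2 + A j n ^ 2)
    have hW : 0 ≤ W := Finset.sum_nonneg fun i _ => by positivity
    have hL8 : MemLp L 8 μ := memLp_linearForm (fun i => (hθ i).1) F b
    have hX4 : MemLp X 4 μ := memLp_quadraticForm (fun i => (hθ i).1) F A _
    have hsum : ∀ ω, (∑ i ∈ insert n F, ∑ j ∈ insert n F, A i j * (θ i ω * θ j ω) -
        ∑ i ∈ insert n F, A i i) = X ω + (A n n * (θ n ω ^ 2 - 1) + L ω * θ n ω) := fun ω => by
      simp only [Finset.sum_insert hn, X, L, b, Finset.sum_add_distrib, add_mul, Finset.sum_mul]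
      have e1 : ∑ i ∈ F, A n i * (θ n ω * θ i ω) = ∑ i ∈ F, A n i * θ i ω * θ n ω :=
        Finset.sum_congr rfl fun i _ => by ring
      have e2 : ∑ i ∈ F, A i n * (θ i ω * θ n ω) = ∑ i ∈ F, A i n * θ i ω * θ n ω :=
        Finset.sum_congr rfl fun i _ => by ring
      rw [e1, e2]; ring
    have hfrob : ∑ i ∈ insert n F, ∑ j ∈ insert n F, A i j ^ 2 =
        ∑ i ∈ F, ∑ j ∈ F, A i j ^ 2 + (A n n ^ 2 + W) := by
      simp only [Finset.sum_insert hn, W, Finset.sum_add_distrib]; ring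
    simp_rw [hsum]
    rw [hfrob]
    have hlin : ∀ ω, ∑ j : F, b j * θ j ω = L ω := fun ω =>
      Finset.sum_coe_sort F fun j => b j * θ j ω
    have hquad : ∀ ω, ∑ i : F, ∑ j : F, A i j * (θ i ω * θ j ω) - ∑ i ∈ F, A i i = X ω :=
      fun ω => by
        simp only [X]
        rw [← Finset.sum_coe_sort F fun i => ∑ j ∈ F, A i j * (θ i ω * θ j ω)]
        simp_rw [← Finset.sum_coe_sort F]
    have hdiag4 : MemLp (fun ω => A n n * (θ n ω ^ 2 - 1)) 4 μ := by
      have h1 : MemLp (fun ω => θ n ω * θ n ω) 4 μ := (hθ n).1.mul' (hθ n).1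
      simp_rw [sq]
      exact (h1.sub (memLp_const 1)).const_mul _
    have hoff4 : MemLp (fun ω => L ω * θ n ω) 4 μ := (hθ n).1.mul' hL8
    have hd4 : MemLp (fun ω => A n n * (θ n ω ^ 2 - 1) + L ω * θ n ω) 4 μ := hdiag4.add hoff4
    refine fourth_moment_add_le hX4 hd4 ?_
      (Finset.sum_nonneg fun i _ => Finset.sum_nonneg fun j _ => sq_nonneg _)
      (add_nonneg (sq_nonneg _) hW) (by positivity) ih ?_
    · -- both parts of the increment are centred given the earlier variables
      have isum : ∀ {d : Ω → ℝ}, MemLp d 4 μ → Integrable (fun ω => X ω ^ 3 * d ω) μ := by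
        intro d hd
        refine ((integrable_pow_four hX4).add (integrable_pow_four hd)).mono'
          ((hX4.1.pow 3).mul hd.1) (ae_of_all _ fun ω => ?_)
        simp only [Pi.add_apply]
        rw [Real.norm_eq_abs, abs_le]
        constructor <;> nlinarith [sq_nonneg (X ω ^ 2 + X ω * d ω),
          sq_nonneg (X ω ^ 2 - X ω * d ω), sq_nonneg (X ω ^ 2 - d ω ^ 2), sq_nonneg (X ω * d ω)]
      have h1 : ∫ ω, X ω ^ 3 * (A n n * (θ n ω ^ 2 - 1)) ∂μ = 0 := by
        have h := integral_mul_of_indep hindep hθm hn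
          (G := fun f => (∑ i : F, ∑ j : F, A i j * (f i * f j) - ∑ i ∈ F, A i i) ^ 3)
          (H := fun x => A n n * (x ^ 2 - 1)) (by fun_prop) (by fun_prop)
        simp only [hquad] at h
        rw [h, integral_const_mul, integral_sub, hsq n]
        · simp
        · have := ((hθ n).1.mono_exponent (p := 2) (by norm_num)).integrable_sq
          exact this
        · exact integrable_const _
      have h2 : ∫ ω, X ω ^ 3 * (L ω * θ n ω) ∂μ = 0 := by
        have h := integral_mul_of_indep hindep hθm hn
          (G := fun f => (∑ i : F, ∑ j : F, A i j * (f i * f j) - ∑ i ∈ F, A i i) ^ 3 *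
            ∑ j : F, b j * f j)
          (H := fun x => x) (by fun_prop) (by fun_prop)
        simp only [hquad, hlin] at h
        simp_rw [← mul_assoc]
        rw [h, hmean n, mul_zero]
      simp_rw [mul_add]
      rw [integral_add (isum hdiag4) (isum hoff4), h1, h2, add_zero]
    · have hb : ∑ j ∈ F, b j ^ 2 ≤ 2 * W := by
        rw [Finset.mul_sum]
        exact Finset.sum_le_sum fun j _ => by
          simp only [b]; nlinarith [sq_nonneg (A n j - A j n)]
      have hL : ∫ ω, L ω ^ 4 ∂μ ≤ 16 * (1 + M) * (2 * W) ^ 2 :=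
        (fourth_moment_linearForm_le hindep hθm hmean hM hθ F b).trans (by gcongr)
      have h4 := integral_pow_four_le_of_eight (hθ n).1 (hθ n).2
      have h40 : 0 ≤ ∫ ω, θ n ω ^ 4 ∂μ := integral_nonneg fun ω => by positivity
      have hoff : ∫ ω, (L ω * θ n ω) ^ 4 ∂μ ≤ 16 * (1 + M) * (2 * W) ^ 2 * (1 + M) := by
        have h := integral_mul_of_indep hindep hθm hn
          (G := fun f => (∑ j : F, b j * f j) ^ 4) (H := fun x => x ^ 4)
          (by fun_prop) (by fun_prop)
        simp only [hlin] at h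
        simp_rw [mul_pow (L _)]
        rw [h]
        exact mul_le_mul hL h4 h40 (by positivity)
      have i8 := integrable_pow_eight (hθ n).1
      have hdiag : ∫ ω, (A n n * (θ n ω ^ 2 - 1)) ^ 4 ∂μ ≤ A n n ^ 4 * (8 * (1 + M)) := by
        simp_rw [mul_pow]
        rw [integral_const_mul]
        refine mul_le_mul_of_nonneg_left ?_ (by positivity)
        calc ∫ ω, (θ n ω ^ 2 - 1) ^ 4 ∂μ ≤ ∫ ω, 8 * (1 + θ n ω ^ 8) ∂μ := by
              refine integral_mono_of_nonneg (ae_of_all _ fun ω => (by decide : Even 4).pow_nonneg _)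
                (((integrable_const _).add i8).const_mul 8) (ae_of_all _ fun ω => ?_)
              simp only
              have e8 : θ n ω ^ 8 = (θ n ω ^ 2) ^ 4 := by ring
              rw [e8]
              generalize θ n ω ^ 2 = y
              nlinarith [sq_nonneg (y ^ 2 - 1), sq_nonneg (y + 1), sq_nonneg ((y + 1) ^ 2),
                sq_nonneg (y ^ 2 + 1), sq_nonneg (y ^ 2 + y)]
          _ ≤ 8 * (1 + M) := by
              rw [integral_const_mul, integral_add (integrable_const _) i8]
              have := (hθ n).2
              simp only [integral_const, probReal_univ, smul_eq_mul, one_mul]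
              linarith
      have id4 := integrable_pow_four hdiag4
      have io4 := integrable_pow_four hoff4
      calc ∫ ω, (A n n * (θ n ω ^ 2 - 1) + L ω * θ n ω) ^ 4 ∂μ
          ≤ ∫ ω, 8 * ((A n n * (θ n ω ^ 2 - 1)) ^ 4 + (L ω * θ n ω) ^ 4) ∂μ := by
            refine integral_mono (integrable_pow_four hd4) ((id4.add io4).const_mul 8) fun ω => ?_
            simp only
            generalize A n n * (θ n ω ^ 2 - 1) = x
            generalize L ω * θ n ω = y
            nlinarith [sq_nonneg (x - y), sq_nonneg (x ^ 2 - y ^ 2), sq_nonneg ((x - y) ^ 2),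
              sq_nonneg (x * (x - y)), sq_nonneg (y * (x - y))]
        _ = 8 * (∫ ω, (A n n * (θ n ω ^ 2 - 1)) ^ 4 ∂μ + ∫ ω, (L ω * θ n ω) ^ 4 ∂μ) := by
            rw [integral_const_mul, integral_add id4 io4]
        _ ≤ 8 * (A n n ^ 4 * (8 * (1 + M)) + 16 * (1 + M) * (2 * W) ^ 2 * (1 + M)) := by gcongr
        _ ≤ 8 * (8 * (1 + M) + 64 * (1 + M) ^ 2) * (A n n ^ 2 + W) ^ 2 := by
            have h1 : A n n ^ 4 ≤ (A n n ^ 2 + W) ^ 2 := by nlinarith [sq_nonneg (A n n)]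
            have h2 : W ^ 2 ≤ (A n n ^ 2 + W) ^ 2 := by
              gcongr; nlinarith [sq_nonneg (A n n)]
            calc _ = 8 * (8 * (1 + M) * A n n ^ 4 + 64 * (1 + M) ^ 2 * W ^ 2) := by ring
              _ ≤ 8 * (8 * (1 + M) * (A n n ^ 2 + W) ^ 2 +
                  64 * (1 + M) ^ 2 * (A n n ^ 2 + W) ^ 2) := by gcongr
              _ = _ := by ring

end Moments

/-! ### A maximal inequality and almost sure convergence -/

section Maximal

variable {Ω : Type*} [MeasurableSpace Ω] {μ : Measure Ω}

theorem tendsto_zero_of_pow_four {f : ℕ → ℝ} (h : Tendsto (fun n => f n ^ 4) atTop (𝓝 0)) :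
    Tendsto f atTop (𝓝 0) := by
  have h1 : Tendsto (fun n => √√(f n ^ 4)) atTop (𝓝 0) := by
    have := (Real.continuous_sqrt.tendsto 0).comp ((Real.continuous_sqrt.tendsto' 0 0 (by simp)).comp h)
    simpa [Function.comp_def] using this
  refine (tendsto_zero_iff_abs_tendsto_zero _).2 (h1.congr fun n => ?_)
  rw [show f n ^ 4 = (f n ^ 2) ^ 2 by ring, Real.sqrt_sq (sq_nonneg _), Real.sqrt_sq_eq_abs]
  rfl

theorem ae_tendsto_zero_of_summable_integral {f : ℕ → Ω → ℝ} (hf : ∀ n, Integrable (f n) μ)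
    (h0 : ∀ n ω, 0 ≤ f n ω) (hs : Summable fun n => ∫ ω, f n ω ∂μ) :
    ∀ᵐ ω ∂μ, Tendsto (fun n => f n ω) atTop (𝓝 0) := by
  have h1 : ∫⁻ ω, ∑' n, ENNReal.ofReal (f n ω) ∂μ ≠ ⊤ := by
    rw [lintegral_tsum fun n => (hf n).1.aemeasurable.ennreal_ofReal]
    simp_rw [← ofReal_integral_eq_lintegral_ofReal (hf _) (ae_of_all _ (h0 _))]
    exact hs.tsum_ofReal_ne_top
  have h2 := ae_lt_top' (AEMeasurable.tsum
    fun n => (hf n).1.aemeasurable.ennreal_ofReal) h1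
  filter_upwards [h2] with ω hω
  have h3 := ENNReal.tendsto_atTop_zero_of_tsum_ne_top hω.ne
  have h4 := (ENNReal.tendsto_toReal ENNReal.zero_ne_top).comp h3
  simpa [Function.comp_def, ENNReal.toReal_ofReal (h0 _ ω)] using h4

theorem pow_four_add_le (x y : ℝ) : (x + y) ^ 4 ≤ 3 / 2 * y ^ 4 + 500 * x ^ 4 := by
  -- convexity with weights `1/8` and `7/8`
  nlinarith [sq_nonneg (7 * x - y), sq_nonneg (x * (7 * x - y)), sq_nonneg (y * (7 * x - y)),
    sq_nonneg ((7 * x - y) * (7 * x - y)), sq_nonneg (x ^ 2), sq_nonneg (y ^ 2),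
    sq_nonneg (x * y)]

/-- A maximal inequality: if the increments of `S` over `[m, n]` have fourth moment at most
`C (u n - u m) ^ 2` for a clock `u`, then `(S n - S p) ^ 4`, `p ≤ n ≤ q`, is dominated by a function
whose integral is of order `(u q - u p) ^ 2`. The proof bisects the clock; each half contributes a
quarter of the bound, so the constant `K = 2000` has to satisfy `3 / 2 * (2 * K / 4) + 500 ≤ K`. -/
theorem exists_maximal_bound {S : ℕ → Ω → ℝ} {u : ℕ → ℝ} {C : ℝ} (hC : 0 ≤ C) (hu : Monotone u)
    (hS : ∀ m n, Integrable (fun ω => (S n ω - S m ω) ^ 4) μ)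
    (hinc : ∀ m n, m ≤ n → ∫ ω, (S n ω - S m ω) ^ 4 ∂μ ≤ C * (u n - u m) ^ 2) (p q : ℕ)
    (hpq : p ≤ q) :
    ∃ G : Ω → ℝ, Integrable G μ ∧ (∀ n, p ≤ n → n ≤ q → ∀ ω, (S n ω - S p ω) ^ 4 ≤ G ω) ∧
      ∫ ω, G ω ∂μ ≤ 2000 * C * (u q - u p) ^ 2 := by
  induction hd : q - p using Nat.strong_induction_on generalizing p q with
  | _ d ih =>
    rcases eq_or_lt_of_le hpq with rfl | hlt
    · refine ⟨fun _ => 0, integrable_zero _ _ _, fun n h1 h2 ω => ?_, by simp⟩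
      obtain rfl : n = p := le_antisymm h2 h1
      simp
    have hU : 0 ≤ u q - u p := sub_nonneg.2 (hu hpq)
    -- the last index in the first half of the clock
    obtain ⟨h, hh, hmax⟩ := ((Finset.Ico p q).filter
      fun n => u n - u p ≤ (u q - u p) / 2).exists_max_image id
      ⟨p, Finset.mem_filter.2 ⟨Finset.mem_Ico.2 ⟨le_rfl, hlt⟩, by rw [sub_self]; linarith⟩⟩
    obtain ⟨hhI, hhu⟩ := Finset.mem_filter.1 hh
    obtain ⟨hph, hhq⟩ := Finset.mem_Ico.1 hhI
    have hright : u q - u (h + 1) ≤ (u q - u p) / 2 := by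
      rcases eq_or_lt_of_le (Nat.succ_le_of_lt hhq) with he | hlt'
      · rw [show h + 1 = q from he, sub_self]; linarith
      · by_contra hcon
        have : h + 1 ≤ h := hmax (h + 1) (Finset.mem_filter.2
          ⟨Finset.mem_Ico.2 ⟨by omega, hlt'⟩, by linarith [not_le.1 hcon]⟩)
        omega
    obtain ⟨G₁, hG₁, hb₁, hi₁⟩ := ih (h - p) (by omega) p h hph rfl
    obtain ⟨G₂, hG₂, hb₂, hi₂⟩ := ih (q - (h + 1)) (by omega) (h + 1) q hhq rfl
    have hG₁0 : ∀ ω, 0 ≤ G₁ ω := fun ω => le_trans (by positivity) (hb₁ p le_rfl hph ω)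
    have hG₂0 : ∀ ω, 0 ≤ G₂ ω := fun ω => le_trans (by positivity) (hb₂ q hhq le_rfl ω)
    have i0 := hS p (h + 1)
    have i1 : Integrable (fun ω => 3 / 2 * (G₁ ω + G₂ ω)) μ := (hG₁.add hG₂).const_mul _
    have i2 : Integrable (fun ω => 500 * (S (h + 1) ω - S p ω) ^ 4) μ := i0.const_mul _
    refine ⟨fun ω => 3 / 2 * (G₁ ω + G₂ ω) + 500 * (S (h + 1) ω - S p ω) ^ 4, i1.add i2,
      fun n hpn hnq ω => ?_, ?_⟩
    · have hx : 0 ≤ (S (h + 1) ω - S p ω) ^ 4 := by positivity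
      rcases le_or_gt n h with hn | hn
      · have := hb₁ n hpn hn ω
        have := hG₁0 ω
        have := hG₂0 ω
        simp only
        linarith
      · have h1 := hb₂ n hn hnq ω
        have h2 := pow_four_add_le (S (h + 1) ω - S p ω) (S n ω - S (h + 1) ω)
        rw [show S (h + 1) ω - S p ω + (S n ω - S (h + 1) ω) = S n ω - S p ω by ring] at h2
        have := hG₁0 ω
        simp only
        linarith
    · have hl0 : 0 ≤ u h - u p := sub_nonneg.2 (hu hph)
      have hr0 : 0 ≤ u q - u (h + 1) := sub_nonneg.2 (hu hhq)
      have hm0 : 0 ≤ u (h + 1) - u p := sub_nonneg.2 (hu (by omega))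
      have hm1 : u (h + 1) - u p ≤ u q - u p := by linarith
      rw [integral_add i1 i2, integral_const_mul, integral_const_mul, integral_add hG₁ hG₂]
      have h3 := hinc p (h + 1) (by omega)
      have e1 : (u h - u p) ^ 2 ≤ ((u q - u p) / 2) ^ 2 := pow_le_pow_left₀ hl0 hhu 2
      have e2 : (u q - u (h + 1)) ^ 2 ≤ ((u q - u p) / 2) ^ 2 := pow_le_pow_left₀ hr0 hright 2
      have e3 : (u (h + 1) - u p) ^ 2 ≤ (u q - u p) ^ 2 := pow_le_pow_left₀ hm0 hm1 2
      have f1 : 2000 * C * (u h - u p) ^ 2 ≤ 2000 * C * ((u q - u p) / 2) ^ 2 := by gcongr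
      have f2 : 2000 * C * (u q - u (h + 1)) ^ 2 ≤ 2000 * C * ((u q - u p) / 2) ^ 2 := by gcongr
      have f3 : C * (u (h + 1) - u p) ^ 2 ≤ C * (u q - u p) ^ 2 := by gcongr
      nlinarith

/-- If a decreasing clock `a` tends to zero and controls the fourth moments of `S` and of its
increments, then `S` tends to zero almost surely; no rate for the clock is needed. -/
theorem ae_tendsto_zero_of_clock {S : ℕ → Ω → ℝ} {a : ℕ → ℝ} {C : ℝ} (hC : 0 ≤ C)
    (ha : Antitone a) (ha0 : Tendsto a atTop (𝓝 0))
    (hS : ∀ n, MemLp (S n) 4 μ) (hSa : ∀ n, ∫ ω, S n ω ^ 4 ∂μ ≤ C * a n ^ 2)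
    (hinc : ∀ m n, m ≤ n → ∫ ω, (S n ω - S m ω) ^ 4 ∂μ ≤ C * (a m - a n) ^ 2) :
    ∀ᵐ ω ∂μ, Tendsto (fun n => S n ω) atTop (𝓝 0) := by
  have hnn : ∀ n, 0 ≤ a n := fun n => ha.le_of_tendsto ha0 n
  have hex : ∀ k : ℕ, ∀ᶠ n in atTop, a n < (1 / 2 : ℝ) ^ k := fun k =>
    ha0.eventually_lt_const (by positivity)
  obtain ⟨φ, hφ, hφa⟩ := extraction_forall_of_eventually hex
  have hmax := fun k : ℕ => exists_maximal_bound (S := S) (u := fun n => -a n) hC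
    (fun m n h => neg_le_neg (ha h))
    (fun m n => integrable_pow_four ((hS n).sub (hS m)))
    (fun m n h => by
      rw [show -a n - -a m = a m - a n by ring]; exact hinc m n h)
    (φ k) (φ (k + 1)) (hφ.monotone (Nat.le_succ k))
  choose G hGi hGb hGint using hmax
  have hG0 : ∀ k ω, 0 ≤ G k ω := fun k ω =>
    le_trans (by positivity) (hGb k (φ k) le_rfl (hφ.monotone (Nat.le_succ k)) ω)
  have hgeo : Summable fun k : ℕ => 2000 * C * ((1 / 2 : ℝ) ^ k) ^ 2 := by
    simp_rw [← pow_mul, mul_comm _ 2, pow_mul]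
    exact (summable_geometric_of_lt_one (by norm_num) (by norm_num)).mul_left _
  have hGsum : Summable fun k => ∫ ω, G k ω ∂μ := by
    refine hgeo.of_nonneg_of_le (fun k => integral_nonneg (hG0 k)) fun k => (hGint k).trans ?_
    refine mul_le_mul_of_nonneg_left (pow_le_pow_left₀ ?_ ?_ 2) (by positivity)
    · linarith [ha (hφ.monotone (Nat.le_succ k))]
    · linarith [hφa k, hnn (φ (k + 1))]
  have hSsum : Summable fun k => ∫ ω, S (φ k) ω ^ 4 ∂μ := by
    refine hgeo.of_nonneg_of_le (fun k => integral_nonneg fun ω => by positivity)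
      fun k => (hSa _).trans ?_
    have : a (φ k) ^ 2 ≤ ((1 / 2 : ℝ) ^ k) ^ 2 := pow_le_pow_left₀ (hnn _) (hφa k).le 2
    nlinarith [sq_nonneg ((1 / 2 : ℝ) ^ k), mul_le_mul_of_nonneg_left this hC,
      mul_nonneg hC (sq_nonneg ((1 / 2 : ℝ) ^ k))]
  filter_upwards [ae_tendsto_zero_of_summable_integral hGi hG0 hGsum,
    ae_tendsto_zero_of_summable_integral (fun k => integrable_pow_four (hS (φ k)))
      (fun k ω => by positivity) hSsum] with ω h1 h2
  refine tendsto_zero_of_pow_four ?_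
  have h3 : Tendsto (fun k => 8 * (G k ω + S (φ k) ω ^ 4)) atTop (𝓝 0) := by
    simpa using (h1.add h2).const_mul 8
  rw [Metric.tendsto_atTop] at h3 ⊢
  intro ε hε
  obtain ⟨K, hK⟩ := h3 ε hε
  refine ⟨φ K, fun n hn => ?_⟩
  -- the block `[φ k, φ (k + 1)]` that contains `n`
  obtain ⟨k, hkK, hk1, hk2⟩ : ∃ k, K ≤ k ∧ φ k ≤ n ∧ n < φ (k + 1) := by
    have hex' : ∃ j, n < φ j := ⟨n + 1, (Nat.lt_succ_self n).trans_le (hφ.id_le _)⟩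
    have hj0 : Nat.find hex' ≠ 0 := fun h0 => by
      have := Nat.find_spec hex'
      rw [h0] at this
      exact (this.trans_le (hφ.monotone (Nat.zero_le K))).not_ge hn
    obtain ⟨k, hk⟩ := Nat.exists_eq_succ_of_ne_zero hj0
    refine ⟨k, ?_, not_lt.1 (Nat.find_min hex' (by omega)), ?_⟩
    · by_contra hcon
      have h5 : Nat.find hex' ≤ K := by omega
      exact ((Nat.find_spec hex').trans_le (hφ.monotone h5)).not_ge hn
    · have := Nat.find_spec hex'
      rwa [hk] at this
  have h4 := hGb k n hk1 hk2.le ω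
  have h5 := hK k hkK
  rw [Real.dist_eq, sub_zero] at h5 ⊢
  rw [abs_of_nonneg (by positivity)]
  refine lt_of_le_of_lt ?_ ((le_abs_self _).trans_lt h5)
  have h6 : S n ω ^ 4 ≤ 8 * ((S n ω - S (φ k) ω) ^ 4 + S (φ k) ω ^ 4) := by
    generalize S n ω = x
    generalize S (φ k) ω = y
    have : x ^ 4 = ((x - y) + y) ^ 4 := by ring
    rw [this]
    generalize x - y = z
    nlinarith [sq_nonneg (z - y), sq_nonneg (z ^ 2 - y ^ 2), sq_nonneg ((z - y) ^ 2),
      sq_nonneg (z * (z - y)), sq_nonneg (y * (z - y))]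
  linarith

end Maximal

/-! ### Uniform convergence of monotone functions -/

/-- Functions on `[0, 1]` that are monotone and converge pointwise at the rationals to the identity
converge uniformly. -/
theorem tendstoUniformlyOn_id_of_monotoneOn {f : ℕ → ℝ → ℝ}
    (hf : ∀ n, MonotoneOn (f n) (Icc 0 1))
    (h : ∀ q : ℚ, (q : ℝ) ∈ Icc (0 : ℝ) 1 → Tendsto (fun n => f n q) atTop (𝓝 q)) :
    TendstoUniformlyOn f (fun t => t) atTop (Icc 0 1) := by
  rw [Metric.tendstoUniformlyOn_iff]
  intro ε hε
  obtain ⟨K, hK⟩ := exists_nat_one_div_lt (half_pos hε)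
  have hev : ∀ᶠ n in atTop, ∀ j ∈ Finset.range (K + 2),
      |f n (((j : ℚ) / (K + 1) : ℚ) : ℝ) - (((j : ℚ) / (K + 1) : ℚ) : ℝ)| < ε / 2 := by
    rw [Filter.eventually_all_finset]
    intro j hj
    have hj' : (j : ℝ) ≤ K + 1 := by exact_mod_cast Nat.lt_succ_iff.1 (Finset.mem_range.1 hj)
    have h1 := Metric.tendsto_atTop.1 (h ((j : ℚ) / (K + 1)) (by
      push_cast
      exact ⟨by positivity, by rw [div_le_one (by positivity)]; exact hj'⟩)) (ε / 2) (half_pos hε)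
    exact eventually_atTop.2 h1
  filter_upwards [hev] with n hn t ht
  have hK0 : (0 : ℝ) < (K : ℝ) + 1 := by positivity
  push_cast at hn
  -- the grid points around `t`
  set j := ⌊t * (K + 1)⌋₊
  have hj1 : (j : ℝ) ≤ t * (K + 1) := Nat.floor_le (mul_nonneg ht.1 hK0.le)
  have hj2 : t * (K + 1) < j + 1 := Nat.lt_floor_add_one _
  have hjK : (j : ℝ) ≤ K + 1 := hj1.trans (by nlinarith [ht.2])
  have hjK' : j ≤ K + 1 := by exact_mod_cast hjK
  have hlow : (j : ℝ) / (K + 1) ≤ t := by rwa [div_le_iff₀ hK0]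
  have hup : t ≤ ((j : ℝ) + 1) / (K + 1) := by rw [le_div_iff₀ hK0]; exact hj2.le
  have hgap : ((j : ℝ) + 1) / (K + 1) = (j : ℝ) / (K + 1) + 1 / (K + 1) := add_div _ _ _
  have hjmem : (j : ℝ) / (K + 1) ∈ Icc (0 : ℝ) 1 := ⟨by positivity, hlow.trans ht.2⟩
  have b1 := abs_lt.1 (hn j (Finset.mem_range.2 (by omega)))
  have m1 := hf n hjmem ht hlow
  have hlower : t - ε < f n t := by linarith
  have hupper : f n t < t + ε := by
    rcases eq_or_lt_of_le hjK' with hj | hj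
    · have ht1 : t = 1 := by
        refine le_antisymm ht.2 (le_trans ?_ hlow)
        rw [hj]; push_cast; rw [div_self hK0.ne']
      have e1 : (j : ℝ) / (K + 1) = 1 := by rw [hj]; push_cast; exact div_self hK0.ne'
      rw [e1] at b1
      rw [ht1]
      linarith
    · have b2 := hn (j + 1) (Finset.mem_range.2 (by omega))
      push_cast at b2
      have b2 := abs_lt.1 b2
      have hmem : ((j : ℝ) + 1) / (K + 1) ∈ Icc (0 : ℝ) 1 := by
        refine ⟨by positivity, ?_⟩
        rw [div_le_one hK0]
        exact_mod_cast hj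
      have m2 := hf n ht hmem hup
      linarith
  rw [Real.dist_eq, abs_sub_lt_iff]
  constructor <;> linarith

/-! ### The process: convergence, covariance and Schauder coefficients -/

namespace PartitionSeq

variable {π : PartitionSeq}

theorem schauderTrunc_eq (z : ℝ) (θ : π.SchauderIndex → ℝ) (n : ℕ) (t : ℝ) :
    π.schauderTrunc z θ n t = z * t + ∑ i ∈ π.indexBelow n, θ i * π.schauderFun i t := by
  rw [sum_indexBelow]; rfl

/-- On the grid `π^N` the Schauder series is a finite sum. -/
theorem schauderSeries_eq_of_mem (hπ : π.Refining) (z : ℝ) (θ : π.SchauderIndex → ℝ) {N : ℕ} {t : ℝ}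
    (ht : t ∈ π.pts N) :
    π.schauderSeries z θ t = z * t + ∑ i ∈ π.indexBelow N, θ i * π.schauderFun i t := by
  rw [← schauderTrunc_eq, schauderSeries, schauderTrunc, tsum_eq_sum]
  intro m hm
  have hm' : N ≤ m := not_lt.1 fun h => hm (Finset.mem_range.2 h)
  exact Finset.sum_eq_zero fun k _ => by
    rw [schauderFun_eq_zero_of_mem hπ ⟨m, k⟩ hm' ht, mul_zero]

theorem schauderCoeff_schauderSeries (hπ : π.Refining) (z : ℝ) (θ : π.SchauderIndex → ℝ)
    (i : π.SchauderIndex) : π.schauderCoeff (π.schauderSeries z θ) i = θ i := by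
  classical
  have h := fun t ht => schauderSeries_eq_of_mem hπ z θ (N := i.1 + 1) (t := t) ht
  have h1 : π.schauderCoeff (π.schauderSeries z θ) i = π.schauderCoeff
      (fun t => z * t + ∑ j ∈ π.indexBelow (i.1 + 1), θ j * π.schauderFun j t) i := by
    simp only [schauderCoeff]
    rw [h _ (suppLeft_mem_succ hπ i), h _ (peak_mem i), h _ (suppRight_spec i).1]
  rw [h1, schauderCoeff_add, schauderCoeff_linear, schauderCoeff_finsetSum]
  simp_rw [schauderCoeff_const_mul, schauderCoeff_schauderFun hπ]
  simp [mem_indexBelow]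

end PartitionSeq

section SecondMoments

open PartitionSeq GeometricBounds

variable {Ω : Type*} [MeasurableSpace Ω] {μ : Measure Ω}

theorem integral_sum_mul_sum {ι : Type*} {ψ : ι → Ω → ℝ} (hψ : ∀ i, MemLp (ψ i) 2 μ)
    (h1 : ∀ i, ∫ ω, ψ i ω ^ 2 ∂μ = 1) (h0 : ∀ i j, i ≠ j → ∫ ω, ψ i ω * ψ j ω ∂μ = 0)
    (F : Finset ι) (a b : ι → ℝ) :
    ∫ ω, (∑ i ∈ F, a i * ψ i ω) * (∑ i ∈ F, b i * ψ i ω) ∂μ = ∑ i ∈ F, a i * b i := by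
  classical
  have hint : ∀ i j, Integrable (fun ω => a i * b j * (ψ i ω * ψ j ω)) μ := fun i j =>
    ((hψ i).integrable_mul (hψ j)).const_mul _
  have e : ∀ ω, (∑ i ∈ F, a i * ψ i ω) * (∑ i ∈ F, b i * ψ i ω) =
      ∑ i ∈ F, ∑ j ∈ F, a i * b j * (ψ i ω * ψ j ω) := fun ω => by
    rw [Finset.sum_mul_sum]
    exact Finset.sum_congr rfl fun i _ => Finset.sum_congr rfl fun j _ => by ring
  simp_rw [e]
  rw [integral_finsetSum _ fun i _ => integrable_finsetSum _ fun j _ => hint i j]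
  refine Finset.sum_congr rfl fun i hi => ?_
  rw [integral_finsetSum _ fun j _ => hint i j]
  simp_rw [integral_const_mul]
  rw [Finset.sum_eq_single i]
  · simp_rw [← sq, h1 i, mul_one]
  · intro j _ hj
    rw [h0 i j hj.symm, mul_zero]
  · exact fun h => absurd hi h

/-- Partial sums of nonnegative functions with summable integrals have an integrable majorant. -/
theorem exists_integrable_majorant {f : ℕ → Ω → ℝ} (hf : ∀ n, Integrable (f n) μ)
    (h0 : ∀ n ω, 0 ≤ f n ω) (hs : Summable fun n => ∫ ω, f n ω ∂μ) :
    ∃ g : Ω → ℝ, Integrable g μ ∧ ∀ᵐ ω ∂μ, ∀ N, ∑ n ∈ Finset.range N, f n ω ≤ g ω := by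
  have hmeas : AEMeasurable (fun ω => ∑' n, ENNReal.ofReal (f n ω)) μ :=
    AEMeasurable.tsum fun n => (hf n).1.aemeasurable.ennreal_ofReal
  have h1 : ∫⁻ ω, ∑' n, ENNReal.ofReal (f n ω) ∂μ ≠ ⊤ := by
    rw [lintegral_tsum fun n => (hf n).1.aemeasurable.ennreal_ofReal]
    simp_rw [← ofReal_integral_eq_lintegral_ofReal (hf _) (ae_of_all _ (h0 _))]
    exact hs.tsum_ofReal_ne_top
  refine ⟨fun ω => (∑' n, ENNReal.ofReal (f n ω)).toReal,
    integrable_toReal_of_lintegral_ne_top hmeas h1, ?_⟩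
  filter_upwards [ae_lt_top' hmeas h1] with ω hω N
  rw [← ENNReal.ofReal_le_iff_le_toReal hω.ne, ENNReal.ofReal_sum_of_nonneg fun n _ => h0 n ω]
  exact ENNReal.sum_le_tsum _

theorem memLp_two_of_variance [IsProbabilityMeasure μ] {X : Ω → ℝ} (hX : Measurable X)
    (h : variance X μ = 1) : MemLp X 2 μ := by
  by_contra hcon
  have := evariance_eq_top hX.aestronglyMeasurable hcon
  rw [variance, this] at h
  simp at h

variable {π : PartitionSeq} {Z : Ω → ℝ} {θ : π.SchauderIndex → Ω → ℝ}

/-- `Z` and the Schauder coefficients as one family. -/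
def optionFamily (Z : Ω → ℝ) (θ : π.SchauderIndex → Ω → ℝ) : Option π.SchauderIndex → Ω → ℝ
  | none => Z
  | some i => θ i

/-- The linear function and the Schauder functions as one family. -/
def optionBasis (π : PartitionSeq) : Option π.SchauderIndex → ℝ → ℝ
  | none => fun t => t
  | some i => π.schauderFun i

theorem schauderTrunc_eq_optionSum {Ω : Type*} {Z : Ω → ℝ} {θ : π.SchauderIndex → Ω → ℝ} (n : ℕ) (t : ℝ) (ω : Ω) :
    π.schauderTrunc (Z ω) (fun i => θ i ω) n t =
      ∑ i ∈ Finset.insertNone (π.indexBelow n), optionBasis π i t * optionFamily Z θ i ω := by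
  rw [schauderTrunc_eq, Finset.sum_insertNone]
  simp only [optionBasis, optionFamily]
  rw [mul_comm]
  congr 1
  exact Finset.sum_congr rfl fun i _ => mul_comm _ _

theorem integral_schauderTrunc_mul (hψ : ∀ i, MemLp (optionFamily Z θ i) 2 μ)
    (h1 : ∀ i, ∫ ω, optionFamily Z θ i ω ^ 2 ∂μ = 1)
    (h0 : ∀ i j, i ≠ j → ∫ ω, optionFamily Z θ i ω * optionFamily Z θ j ω ∂μ = 0)
    (n : ℕ) (s t : ℝ) :
    ∫ ω, π.schauderTrunc (Z ω) (fun i => θ i ω) n s *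
      π.schauderTrunc (Z ω) (fun i => θ i ω) n t ∂μ =
      s * t + ∑ i ∈ π.indexBelow n, π.schauderFun i s * π.schauderFun i t := by
  simp_rw [schauderTrunc_eq_optionSum]
  rw [integral_sum_mul_sum hψ h1 h0, Finset.sum_insertNone]
  rfl

theorem integral_schauderLevel_sq (hψ : ∀ i, MemLp (θ i) 2 μ)
    (h1 : ∀ i, ∫ ω, θ i ω ^ 2 ∂μ = 1) (h0 : ∀ i j, i ≠ j → ∫ ω, θ i ω * θ j ω ∂μ = 0)
    (m : ℕ) (t : ℝ) :
    ∫ ω, π.schauderLevel (fun i => θ i ω) m t ^ 2 ∂μ =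
      ∑ k : π.LevelIndex m, π.schauderFun ⟨m, k⟩ t ^ 2 := by
  have h := integral_sum_mul_sum (ψ := fun k : π.LevelIndex m => θ ⟨m, k⟩) (fun k => hψ _)
    (fun k => h1 _) (fun k k' hk => h0 _ _ fun h => hk (by simpa using h)) Finset.univ
    (fun k => π.schauderFun ⟨m, k⟩ t) (fun k => π.schauderFun ⟨m, k⟩ t)
  simp only [sq]
  rw [← h]
  simp only [schauderLevel, mul_comm (θ _ _)]

theorem memLp_schauderLevel (hψ : ∀ i, MemLp (θ i) 2 μ) (m : ℕ) (t : ℝ) :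
    MemLp (fun ω => π.schauderLevel (fun i => θ i ω) m t) 2 μ :=
  memLp_finsetSum _ fun k _ => (hψ ⟨m, k⟩).mul_const _

/-- The truncated series at `t` are dominated in `L²`: by the Cauchy–Schwarz inequality with
geometric weights, since level `m` has variance of order `r ^ m`. -/
theorem exists_sq_majorant [IsProbabilityMeasure μ] {r c M K ρ : ℝ} (h : GeometricBounds π r c M K ρ)
    (hZ : MemLp Z 2 μ) (hψ : ∀ i, MemLp (θ i) 2 μ)
    (h1 : ∀ i, ∫ ω, θ i ω ^ 2 ∂μ = 1) (h0 : ∀ i j, i ≠ j → ∫ ω, θ i ω * θ j ω ∂μ = 0) {t : ℝ}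
    (ht : t ∈ Icc (0 : ℝ) 1) :
    ∃ g : Ω → ℝ, Integrable g μ ∧
      ∀ᵐ ω ∂μ, ∀ N, π.schauderTrunc (Z ω) (fun i => θ i ω) N t ^ 2 ≤ g ω := by
  set q := √r
  have hq0 : 0 < q := Real.sqrt_pos.2 h.r_pos
  have hq1 : q < 1 := h.sqrt_r_lt_one
  have hqr : q * q = r := Real.mul_self_sqrt h.r_pos.le
  set f : ℕ → Ω → ℝ := fun m ω => (q ^ m)⁻¹ * π.schauderLevel (fun i => θ i ω) m t ^ 2
  have hf : ∀ m, Integrable (f m) μ := fun m =>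
    (memLp_schauderLevel hψ m t).integrable_sq.const_mul _
  have hf0 : ∀ m ω, 0 ≤ f m ω := fun m ω => by positivity
  have hfs : Summable fun m => ∫ ω, f m ω ∂μ := by
    refine ((summable_geometric_of_lt_one hq0.le hq1).mul_left M).of_nonneg_of_le
      (fun m => integral_nonneg (hf0 m)) fun m => ?_
    simp only [f]
    rw [integral_const_mul, integral_schauderLevel_sq hψ h1 h0, inv_mul_le_iff₀ (by positivity)]
    refine (h.sum_schauderFun_sq_le m t).trans (le_of_eq ?_)
    rw [← hqr, mul_pow]; ring
  obtain ⟨g, hg, hgb⟩ := exists_integrable_majorant hf hf0 hfs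
  refine ⟨fun ω => 2 * Z ω ^ 2 + 2 * ((1 - q)⁻¹ * g ω),
    (hZ.integrable_sq.const_mul 2).add ((hg.const_mul _).const_mul 2), ?_⟩
  filter_upwards [hgb] with ω hω N
  have hcs : (∑ m ∈ Finset.range N, π.schauderLevel (fun i => θ i ω) m t) ^ 2 ≤
      (1 - q)⁻¹ * g ω := by
    calc (∑ m ∈ Finset.range N, π.schauderLevel (fun i => θ i ω) m t) ^ 2
        ≤ (∑ m ∈ Finset.range N, q ^ m) * ∑ m ∈ Finset.range N, f m ω := by
          refine Finset.sum_sq_le_sum_mul_sum_of_sq_le_mul _ (fun m _ => by positivity)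
            (fun m _ => hf0 m ω) fun m _ => le_of_eq ?_
          simp only [f]
          field_simp
      _ ≤ (1 - q)⁻¹ * g ω := by
          refine mul_le_mul ?_ (hω N) (Finset.sum_nonneg fun m _ => hf0 m ω)
            (inv_nonneg.2 (by linarith))
          rw [← tsum_geometric_of_lt_one hq0.le hq1]
          exact (summable_geometric_of_lt_one hq0.le hq1).sum_le_tsum _ fun m _ => by positivity
  rw [schauderTrunc]
  have hZt : (Z ω * t) ^ 2 ≤ Z ω ^ 2 := by
    rw [mul_pow]
    exact mul_le_of_le_one_right (sq_nonneg _) (pow_le_one₀ ht.1 ht.2)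
  nlinarith [sq_nonneg (Z ω * t - ∑ m ∈ Finset.range N, π.schauderLevel (fun i => θ i ω) m t)]

theorem memLp_schauderTrunc (hZ : MemLp Z 2 μ) (hψ : ∀ i, MemLp (θ i) 2 μ) (N : ℕ) (t : ℝ) :
    MemLp (fun ω => π.schauderTrunc (Z ω) (fun i => θ i ω) N t) 2 μ :=
  (hZ.mul_const t).add (memLp_finsetSum _ fun m _ => memLp_schauderLevel hψ m t)

theorem memLp_schauderProcess {t : ℝ}
    (hlim : ∀ᵐ ω ∂μ, Tendsto (fun N => π.schauderTrunc (Z ω) (fun i => θ i ω) N t) atTop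
      (𝓝 (schauderProcess π Z θ t ω)))
    (hL2 : ∀ N, MemLp (fun ω => π.schauderTrunc (Z ω) (fun i => θ i ω) N t) 2 μ)
    (hmaj : ∃ g : Ω → ℝ, Integrable g μ ∧
      ∀ᵐ ω ∂μ, ∀ N, π.schauderTrunc (Z ω) (fun i => θ i ω) N t ^ 2 ≤ g ω) :
    MemLp (schauderProcess π Z θ t) 2 μ := by
  obtain ⟨g, hg, hgb⟩ := hmaj
  have hmeas : AEStronglyMeasurable (schauderProcess π Z θ t) μ :=
    aestronglyMeasurable_of_tendsto_ae atTop (fun N => (hL2 N).1) hlim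
  rw [memLp_two_iff_integrable_sq hmeas]
  refine hg.mono' (hmeas.pow 2) ?_
  filter_upwards [hlim, hgb] with ω h1 h2
  rw [Real.norm_of_nonneg (sq_nonneg _)]
  exact le_of_tendsto (h1.pow 2) (Eventually.of_forall h2)

theorem tendsto_integral_schauderTrunc_mul {s t : ℝ}
    (hlim : ∀ u ∈ ({s, t} : Set ℝ), ∀ᵐ ω ∂μ,
      Tendsto (fun N => π.schauderTrunc (Z ω) (fun i => θ i ω) N u) atTop
        (𝓝 (schauderProcess π Z θ u ω)))
    (hL2 : ∀ u N, MemLp (fun ω => π.schauderTrunc (Z ω) (fun i => θ i ω) N u) 2 μ)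
    (hmaj : ∀ u ∈ ({s, t} : Set ℝ), ∃ g : Ω → ℝ, Integrable g μ ∧
      ∀ᵐ ω ∂μ, ∀ N, π.schauderTrunc (Z ω) (fun i => θ i ω) N u ^ 2 ≤ g ω) :
    Tendsto (fun N => ∫ ω, π.schauderTrunc (Z ω) (fun i => θ i ω) N s *
      π.schauderTrunc (Z ω) (fun i => θ i ω) N t ∂μ) atTop
      (𝓝 (∫ ω, schauderProcess π Z θ s ω * schauderProcess π Z θ t ω ∂μ)) := by
  obtain ⟨g₁, hg₁, hb₁⟩ := hmaj s (by simp)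
  obtain ⟨g₂, hg₂, hb₂⟩ := hmaj t (by simp)
  refine tendsto_integral_of_dominated_convergence (fun ω => g₁ ω + g₂ ω)
    (fun N => (hL2 s N).1.mul (hL2 t N).1) (hg₁.add hg₂) (fun N => ?_) ?_
  · filter_upwards [hb₁, hb₂] with ω h1 h2
    have h1 := h1 N
    have h2 := h2 N
    rw [Real.norm_eq_abs, abs_le]
    generalize π.schauderTrunc (Z ω) (fun i => θ i ω) N s = x at *
    generalize π.schauderTrunc (Z ω) (fun i => θ i ω) N t = y at *
    constructor <;> nlinarith [sq_nonneg (x - y), sq_nonneg (x + y)]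
  · filter_upwards [hlim s (by simp), hlim t (by simp)] with ω h1 h2
    exact h1.mul h2

theorem tendsto_integral_schauderTrunc [IsProbabilityMeasure μ] {t : ℝ}
    (hlim : ∀ᵐ ω ∂μ, Tendsto (fun N => π.schauderTrunc (Z ω) (fun i => θ i ω) N t) atTop
      (𝓝 (schauderProcess π Z θ t ω)))
    (hL2 : ∀ N, MemLp (fun ω => π.schauderTrunc (Z ω) (fun i => θ i ω) N t) 2 μ)
    (hmaj : ∃ g : Ω → ℝ, Integrable g μ ∧
      ∀ᵐ ω ∂μ, ∀ N, π.schauderTrunc (Z ω) (fun i => θ i ω) N t ^ 2 ≤ g ω) :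
    Tendsto (fun N => ∫ ω, π.schauderTrunc (Z ω) (fun i => θ i ω) N t ∂μ) atTop
      (𝓝 (∫ ω, schauderProcess π Z θ t ω ∂μ)) := by
  obtain ⟨g, hg, hgb⟩ := hmaj
  refine tendsto_integral_of_dominated_convergence (fun ω => 1 + g ω)
    (fun N => (hL2 N).1) ((integrable_const _).add hg) (fun N => ?_) hlim
  filter_upwards [hgb] with ω h1
  have h1 := h1 N
  rw [Real.norm_eq_abs, abs_le]
  constructor <;> nlinarith [sq_nonneg (π.schauderTrunc (Z ω) (fun i => θ i ω) N t - 1),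
    sq_nonneg (π.schauderTrunc (Z ω) (fun i => θ i ω) N t + 1)]

theorem integral_schauderTrunc [IsProbabilityMeasure μ] (hZ : MemLp Z 2 μ) (hψ : ∀ i, MemLp (θ i) 2 μ)
    (hZ0 : ∫ ω, Z ω ∂μ = 0) (hθ0 : ∀ i, ∫ ω, θ i ω ∂μ = 0) (N : ℕ) (t : ℝ) :
    ∫ ω, π.schauderTrunc (Z ω) (fun i => θ i ω) N t ∂μ = 0 := by
  simp_rw [schauderTrunc_eq]
  have hi : ∀ i, Integrable (fun ω => θ i ω * π.schauderFun i t) μ := fun i =>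
    ((hψ i).integrable one_le_two).mul_const _
  rw [integral_add ((hZ.integrable one_le_two).mul_const t) (integrable_finsetSum _ fun i _ => hi i),
    integral_finsetSum _ fun i _ => hi i]
  simp_rw [integral_mul_const, hZ0, hθ0]
  simp

theorem tendsto_mesh {r c M K ρ : ℝ} (h : GeometricBounds π r c M K ρ) :
    Tendsto (fun n => mesh (π.pts n)) atTop (𝓝 0) := by
  rw [← tendsto_add_atTop_iff_nat 1]
  exact squeeze_zero (fun n => (π.isPartition _).mesh_pos.le) h.mesh_le
    (tendsto_pow_atTop_nhds_zero_of_lt_one h.r_pos.le h.r_lt_one)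

theorem integral_schauderProcess_mul [IsProbabilityMeasure μ] {r c M K ρ : ℝ} (h : GeometricBounds π r c M K ρ) {s t : ℝ}
    (hs : s ∈ Icc (0 : ℝ) 1) (ht : t ∈ Icc (0 : ℝ) 1)
    (hψ : ∀ i, MemLp (optionFamily Z θ i) 2 μ)
    (h1 : ∀ i, ∫ ω, optionFamily Z θ i ω ^ 2 ∂μ = 1)
    (h0 : ∀ i j, i ≠ j → ∫ ω, optionFamily Z θ i ω * optionFamily Z θ j ω ∂μ = 0)
    (hlim : ∀ u ∈ Icc (0 : ℝ) 1, ∀ᵐ ω ∂μ,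
      Tendsto (fun N => π.schauderTrunc (Z ω) (fun i => θ i ω) N u) atTop
        (𝓝 (schauderProcess π Z θ u ω))) :
    ∫ ω, schauderProcess π Z θ s ω * schauderProcess π Z θ t ω ∂μ = min s t := by
  have hst : ∀ u ∈ ({s, t} : Set ℝ), u ∈ Icc (0 : ℝ) 1 := by
    rintro u (rfl | rfl) <;> assumption
  have hθ2 : ∀ i, MemLp (θ i) 2 μ := fun i => hψ (some i)
  refine tendsto_nhds_unique (tendsto_integral_schauderTrunc_mul (fun u hu => hlim u (hst u hu))
    (fun u N => memLp_schauderTrunc (hψ none) hθ2 N u)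
    fun u hu => exists_sq_majorant h (hψ none) hθ2 (fun i => h1 (some i))
      (fun i j hij => h0 (some i) (some j) (by simpa using hij)) (hst u hu)) ?_
  simp_rw [integral_schauderTrunc_mul hψ h1 h0]
  rw [← tendsto_sub_nhds_zero_iff]
  exact squeeze_zero_norm (fun N => abs_sum_schauderFun_mul_sub_le h.refining hs ht)
    (tendsto_mesh h)

end SecondMoments

/-! ### Quadratic variation as a quadratic form -/

/-- The left end points of the intervals that enter the sum of squares up to time `t`. -/
def leftPts (P : Finset ℝ) (t : ℝ) : Finset ℝ := P.filter fun s => s < 1 ∧ s ≤ t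

/-- The increment of `f` over the gap of `P` that starts at `s`. -/
def incr (P : Finset ℝ) (f : ℝ → ℝ) (s : ℝ) : ℝ := f (nextPt P s) - f s

/-- The sum of the squared lengths of the gaps that enter the sum of squares up to time `t`; it is
the area of the union of the squares over these gaps. -/
def squareArea (P : Finset ℝ) (t : ℝ) : ℝ := ∑ s ∈ leftPts P t, (nextPt P s - s) ^ 2

theorem quadVarSum_eq (P : Finset ℝ) (x : ℝ → ℝ) (t : ℝ) :
    quadVarSum P x t = ∑ s ∈ leftPts P t, incr P x s ^ 2 := by
  simp only [quadVarSum, leftPts, incr, sq_abs]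

theorem monotone_quadVarSum (P : Finset ℝ) (x : ℝ → ℝ) : Monotone (quadVarSum P x) := by
  intro s t hst
  refine Finset.sum_le_sum_of_subset_of_nonneg (fun r hr => ?_) fun _ _ _ => by positivity
  obtain ⟨h1, h2, h3⟩ := Finset.mem_filter.1 hr
  exact Finset.mem_filter.2 ⟨h1, h2, h3.trans hst⟩

theorem squareArea_nonneg (P : Finset ℝ) (t : ℝ) : 0 ≤ squareArea P t :=
  Finset.sum_nonneg fun _ _ => sq_nonneg _

namespace IsPartition

variable {P Q : Finset ℝ}

/-- The gaps up to time `t` cover `[0, t]` up to an error of at most the mesh. -/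
theorem abs_sum_leftPts_sub_le (hP : IsPartition P) {t : ℝ} (ht : t ∈ Icc (0 : ℝ) 1) :
    |∑ s ∈ leftPts P t, (nextPt P s - s) - t| ≤ mesh P := by
  rcases eq_or_lt_of_le ht.2 with rfl | ht1
  · have h := hP.sum_increments (fun x => x) hP.2.1
    have hset : leftPts P 1 = P.filter (· < 1) :=
      Finset.filter_congr fun _ _ => ⟨fun h => h.1, fun h => ⟨h, h.le⟩⟩
    rw [hset, h]
    simpa using hP.mesh_pos.le
  · obtain ⟨h1, h2, h3⟩ := hP.nextPt_spec ht1
    have h := hP.sum_increments (fun x => x) h1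
    have hset : leftPts P t = P.filter (· < nextPt P t) :=
      Finset.filter_congr fun s hs => ⟨fun h => h.2.trans_lt h2, fun h => by
        have : s ≤ t := not_lt.1 fun hlt => (h3 s hs hlt).not_gt h
        exact ⟨this.trans_lt ht1, this⟩⟩
    rw [hset, h, sub_zero, abs_of_pos (by linarith)]
    exact hP.nextPt_sub_le ht.1 ht1

theorem squareArea_le_mesh (hP : IsPartition P) (t : ℝ) : squareArea P t ≤ mesh P := by
  have hsub : leftPts P t ⊆ P.filter (· < 1) := fun s hs => by
    obtain ⟨h1, h2, _⟩ := Finset.mem_filter.1 hs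
    exact Finset.mem_filter.2 ⟨h1, h2⟩
  calc squareArea P t ≤ ∑ s ∈ P with s < 1, (nextPt P s - s) ^ 2 :=
        Finset.sum_le_sum_of_subset_of_nonneg hsub fun s _ _ => sq_nonneg _
    _ ≤ ∑ s ∈ P with s < 1, mesh P * (nextPt P s - s) := by
        refine Finset.sum_le_sum fun s hs => ?_
        obtain ⟨h1, h2⟩ := Finset.mem_filter.1 hs
        have h := hP.consecutive_nextPt h1 h2
        rw [sq]
        exact mul_le_mul_of_nonneg_right (gap_le_mesh h) (sub_nonneg.2 h.2.2.1.le)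
    _ = mesh P := by
        rw [← Finset.mul_sum, hP.sum_increments (fun x => x) hP.2.1]; ring

/-- Every gap of a finer partition lies in a gap of the coarser one. -/
theorem exists_coarse_gap (hP : IsPartition P) (hPQ : P ⊆ Q)
    (hQ : IsPartition Q) {t s' : ℝ} (hs' : s' ∈ leftPts Q t) :
    ∃ s ∈ leftPts P t, s ≤ s' ∧ nextPt Q s' ≤ nextPt P s := by
  obtain ⟨h1, h2, h3⟩ := Finset.mem_filter.1 hs'
  by_cases hmem : s' ∈ P
  · refine ⟨s', Finset.mem_filter.2 ⟨hmem, h2, h3⟩, le_rfl, ?_⟩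
    obtain ⟨b1, b2, _⟩ := hP.nextPt_spec h2
    exact (hQ.nextPt_spec h2).2.2 _ (hPQ b1) b2
  · have h0 : 0 < s' := lt_of_le_of_ne (hQ.2.2 s' h1).1 fun h => hmem (h ▸ hP.1)
    obtain ⟨a1, a2, a3⟩ := hP.prevPt_spec h0
    have hp1 : prevPt P s' < 1 := a2.trans h2
    obtain ⟨b1, b2, _⟩ := hP.nextPt_spec hp1
    refine ⟨prevPt P s', Finset.mem_filter.2 ⟨a1, hp1, a2.le.trans h3⟩, a2.le, ?_⟩
    refine (hQ.nextPt_spec h2).2.2 _ (hPQ b1) ?_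
    rcases lt_trichotomy (nextPt P (prevPt P s')) s' with h | h | h
    · exact absurd b2 (a3 _ b1 h).not_gt
    · exact absurd (h ▸ b1) hmem
    · exact h

end IsPartition

theorem sum_mul_gram {α β ι : Type*} (E : Finset ι) (S : Finset α) (T : Finset β)
    (c : α → ι → ℝ) (d : β → ι → ℝ) :
    ∑ i ∈ E, ∑ j ∈ E, (∑ p ∈ S, c p i * c p j) * (∑ q ∈ T, d q i * d q j) =
      ∑ p ∈ S, ∑ q ∈ T, (∑ i ∈ E, c p i * d q i) ^ 2 := by
  have hR : ∀ p q, (∑ i ∈ E, c p i * d q i) ^ 2 =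
      ∑ i ∈ E, ∑ j ∈ E, c p i * c p j * (d q i * d q j) := fun p q => by
    rw [sq, Finset.sum_mul_sum]
    exact Finset.sum_congr rfl fun i _ => Finset.sum_congr rfl fun j _ => by ring
  simp_rw [hR, Finset.sum_mul_sum]
  calc ∑ i ∈ E, ∑ j ∈ E, ∑ p ∈ S, ∑ q ∈ T, c p i * c p j * (d q i * d q j)
      = ∑ i ∈ E, ∑ p ∈ S, ∑ q ∈ T, ∑ j ∈ E, c p i * c p j * (d q i * d q j) := by
        refine Finset.sum_congr rfl fun i _ => ?_
        rw [Finset.sum_comm]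
        exact Finset.sum_congr rfl fun p _ => Finset.sum_comm
    _ = ∑ p ∈ S, ∑ q ∈ T, ∑ i ∈ E, ∑ j ∈ E, c p i * c p j * (d q i * d q j) := by
        rw [Finset.sum_comm]
        exact Finset.sum_congr rfl fun p _ => Finset.sum_comm

namespace PartitionSeq

variable {π : PartitionSeq}

/-- The matrix, in the basis of Schauder functions and the linear function, of the sum of squared
increments along `P` up to time `t`. -/
def qvMatrix (π : PartitionSeq) (P : Finset ℝ) (t : ℝ) (i j : Option π.SchauderIndex) : ℝ :=
  ∑ s ∈ leftPts P t, incr P (optionBasis π i) s * incr P (optionBasis π j) s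

theorem sum_optionBasis_mul (hπ : π.Refining) {N : ℕ} {u v : ℝ} (hu : u ∈ π.pts N)
    (hv : v ∈ π.pts N) :
    ∑ i ∈ Finset.insertNone (π.indexBelow N), optionBasis π i u * optionBasis π i v = min u v := by
  rw [Finset.sum_insertNone]
  exact sum_schauderFun_mul hπ ((π.isPartition N).2.2 u hu) hv

theorem nextPt_mem_of_subset {P : Finset ℝ} (hP : IsPartition P) {N : ℕ} (hPN : P ⊆ π.pts N)
    {t s : ℝ} (hs : s ∈ leftPts P t) :
    s ∈ P ∧ s < nextPt P s ∧ s ∈ π.pts N ∧ nextPt P s ∈ π.pts N := by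
  obtain ⟨h1, h2, _⟩ := Finset.mem_filter.1 hs
  obtain ⟨b1, b2, _⟩ := hP.nextPt_spec h2
  exact ⟨h1, b2, hPN h1, hPN b1⟩

/-- By Parseval's identity, inner products of coefficient vectors of increments are overlaps of
intervals. -/
theorem sum_incr_mul_incr (hπ : π.Refining) {P Q : Finset ℝ} (hP : IsPartition P)
    (hQ : IsPartition Q) {N : ℕ} (hPN : P ⊆ π.pts N) (hQN : Q ⊆ π.pts N) {t s s' : ℝ}
    (hs : s ∈ leftPts P t) (hs' : s' ∈ leftPts Q t) :
    ∑ i ∈ Finset.insertNone (π.indexBelow N),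
      incr P (optionBasis π i) s * incr Q (optionBasis π i) s' =
      min (nextPt P s) (nextPt Q s') - min (nextPt P s) s' - min s (nextPt Q s') + min s s' := by
  obtain ⟨_, _, a3, a4⟩ := nextPt_mem_of_subset hP hPN hs
  obtain ⟨_, _, b3, b4⟩ := nextPt_mem_of_subset hQ hQN hs'
  rw [← sum_optionBasis_mul hπ a4 b4, ← sum_optionBasis_mul hπ a4 b3,
    ← sum_optionBasis_mul hπ a3 b4, ← sum_optionBasis_mul hπ a3 b3, ← Finset.sum_sub_distrib,
    ← Finset.sum_sub_distrib, ← Finset.sum_add_distrib]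
  exact Finset.sum_congr rfl fun i _ => by simp only [incr]; ring

theorem sum_incr_sq (hπ : π.Refining) {P : Finset ℝ} (hP : IsPartition P) {N : ℕ}
    (hPN : P ⊆ π.pts N) {t s : ℝ} (hs : s ∈ leftPts P t) :
    ∑ i ∈ Finset.insertNone (π.indexBelow N),
      incr P (optionBasis π i) s * incr P (optionBasis π i) s = nextPt P s - s := by
  have h := (nextPt_mem_of_subset hP hPN hs).2.1
  rw [sum_incr_mul_incr hπ hP hP hPN hPN hs hs, min_self, min_self, min_eq_right h.le,
    min_eq_left h.le]
  ring

theorem sum_qvMatrix_sq (hπ : π.Refining) {P : Finset ℝ} (hP : IsPartition P) {N : ℕ}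
    (hPN : P ⊆ π.pts N) (t : ℝ) :
    ∑ i ∈ Finset.insertNone (π.indexBelow N), ∑ j ∈ Finset.insertNone (π.indexBelow N),
      π.qvMatrix P t i j * π.qvMatrix P t i j = squareArea P t := by
  unfold qvMatrix
  rw [sum_mul_gram _ _ _ (fun s i => incr P (optionBasis π i) s)
    (fun s i => incr P (optionBasis π i) s)]
  refine Finset.sum_congr rfl fun s hs => ?_
  rw [Finset.sum_eq_single s]
  · rw [sum_incr_sq hπ hP hPN hs]
  · intro s' hs' hne
    rw [sum_incr_mul_incr hπ hP hP hPN hPN hs hs']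
    obtain ⟨p1, p2, _⟩ := nextPt_mem_of_subset hP hPN hs
    obtain ⟨q1, q2, _⟩ := nextPt_mem_of_subset hP hPN hs'
    -- distinct gaps do not overlap
    rcases lt_or_gt_of_ne hne with h | h
    · have h1 := (hP.nextPt_spec (Finset.mem_filter.1 hs').2.1).2.2 s p1 h
      rw [min_eq_right (h1.trans p2.le), min_eq_right (h.le.trans p2.le), min_eq_right h1,
        min_eq_right h.le]
      ring
    · have h1 := (hP.nextPt_spec (Finset.mem_filter.1 hs).2.1).2.2 s' q1 h
      rw [min_eq_left (h1.trans q2.le), min_eq_left h1, min_eq_left (h.le.trans q2.le),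
        min_eq_left h.le]
      ring
  · exact fun h => absurd hs h

theorem squareArea_le_sum_qvMatrix_mul (hπ : π.Refining) {P Q : Finset ℝ} (hP : IsPartition P)
    (hQ : IsPartition Q) (hPQ : P ⊆ Q) {N : ℕ} (hQN : Q ⊆ π.pts N) (t : ℝ) :
    squareArea Q t ≤
      ∑ i ∈ Finset.insertNone (π.indexBelow N), ∑ j ∈ Finset.insertNone (π.indexBelow N),
        π.qvMatrix Q t i j * π.qvMatrix P t i j := by
  unfold qvMatrix
  rw [sum_mul_gram _ _ _ (fun s i => incr Q (optionBasis π i) s)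
    (fun s i => incr P (optionBasis π i) s)]
  refine Finset.sum_le_sum fun s' hs' => ?_
  obtain ⟨s, hs, h1, h2⟩ := hP.exists_coarse_gap hPQ hQ hs'
  refine le_trans (le_of_eq ?_) (Finset.single_le_sum (fun r _ => sq_nonneg _) hs)
  have h3 := (nextPt_mem_of_subset hQ hQN hs').2.1
  rw [sum_incr_mul_incr hπ hQ hP hQN (hPQ.trans hQN) hs' hs, min_eq_left h2,
    min_eq_right (h1.trans h3.le), min_eq_left (h3.le.trans h2), min_eq_right h1]
  ring

theorem sum_some_le (F : Finset π.SchauderIndex)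
    (f : Option π.SchauderIndex → Option π.SchauderIndex → ℝ) (hf : ∀ i j, 0 ≤ f i j) :
    ∑ i ∈ F, ∑ j ∈ F, f (some i) (some j) ≤
      ∑ i ∈ Finset.insertNone F, ∑ j ∈ Finset.insertNone F, f i j := by
  have h1 : ∀ i, ∑ j ∈ F, f i (some j) ≤ ∑ j ∈ Finset.insertNone F, f i j := fun i => by
    rw [Finset.sum_insertNone]; linarith [hf i none]
  rw [Finset.sum_insertNone]
  have h2 : 0 ≤ ∑ j ∈ Finset.insertNone F, f none j := Finset.sum_nonneg fun j _ => hf _ _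
  have h3 := Finset.sum_le_sum fun i (_ : i ∈ F) => h1 (some i)
  linarith

theorem frobenius_qvMatrix_le (hπ : π.Refining) {P : Finset ℝ} (hP : IsPartition P) {N : ℕ}
    (hPN : P ⊆ π.pts N) (t : ℝ) :
    ∑ i ∈ π.indexBelow N, ∑ j ∈ π.indexBelow N, π.qvMatrix P t (some i) (some j) ^ 2 ≤
      squareArea P t := by
  rw [← sum_qvMatrix_sq hπ hP hPN t]
  simp_rw [← sq]
  exact sum_some_le _ (fun i j => π.qvMatrix P t i j ^ 2) fun i j => sq_nonneg _

/-- Refining the partition moves the matrix by at most the loss of area, in squared Frobenius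
norm. -/
theorem frobenius_qvMatrix_sub_le (hπ : π.Refining) {P Q : Finset ℝ} (hP : IsPartition P)
    (hQ : IsPartition Q) (hPQ : P ⊆ Q) {N : ℕ} (hQN : Q ⊆ π.pts N) (t : ℝ) :
    ∑ i ∈ π.indexBelow N, ∑ j ∈ π.indexBelow N,
      (π.qvMatrix Q t (some i) (some j) - π.qvMatrix P t (some i) (some j)) ^ 2 ≤
      squareArea P t - squareArea Q t := by
  refine (sum_some_le _ (fun i j => (π.qvMatrix Q t i j - π.qvMatrix P t i j) ^ 2)
    fun i j => sq_nonneg _).trans ?_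
  have e : ∀ i j, (π.qvMatrix Q t i j - π.qvMatrix P t i j) ^ 2 =
      π.qvMatrix Q t i j * π.qvMatrix Q t i j + π.qvMatrix P t i j * π.qvMatrix P t i j -
        2 * (π.qvMatrix Q t i j * π.qvMatrix P t i j) := fun i j => by ring
  simp_rw [e, Finset.sum_sub_distrib, Finset.sum_add_distrib, ← Finset.mul_sum]
  rw [sum_qvMatrix_sq hπ hQ hQN t, sum_qvMatrix_sq hπ hP (hPQ.trans hQN) t]
  linarith [squareArea_le_sum_qvMatrix_mul hπ hP hQ hPQ hQN t]

theorem squareArea_antitone (hπ : π.Refining) {P Q : Finset ℝ} (hP : IsPartition P)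
    (hQ : IsPartition Q) (hPQ : P ⊆ Q) {N : ℕ} (hQN : Q ⊆ π.pts N) (t : ℝ) :
    squareArea Q t ≤ squareArea P t :=
  sub_nonneg.1 ((Finset.sum_nonneg fun _ _ => Finset.sum_nonneg fun _ _ => sq_nonneg _).trans
    (frobenius_qvMatrix_sub_le hπ hP hQ hPQ hQN t))

theorem trace_qvMatrix (hπ : π.Refining) {P : Finset ℝ} (hP : IsPartition P) {N : ℕ}
    (hPN : P ⊆ π.pts N) (t : ℝ) :
    ∑ i ∈ π.indexBelow N, π.qvMatrix P t (some i) (some i) =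
      ∑ s ∈ leftPts P t, (nextPt P s - s) - squareArea P t := by
  unfold qvMatrix squareArea
  rw [Finset.sum_comm, ← Finset.sum_sub_distrib]
  refine Finset.sum_congr rfl fun s hs => ?_
  have h := sum_incr_sq hπ hP hPN hs
  rw [Finset.sum_insertNone] at h
  have hn : incr P (optionBasis π none) s = nextPt P s - s := rfl
  rw [hn] at h
  linarith

theorem quadVarSum_schauderSeries_zero (hπ : π.Refining) {P : Finset ℝ} (hP : IsPartition P)
    {N : ℕ} (hPN : P ⊆ π.pts N) (θ : π.SchauderIndex → ℝ) (t : ℝ) :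
    quadVarSum P (π.schauderSeries 0 θ) t =
      ∑ i ∈ π.indexBelow N, ∑ j ∈ π.indexBelow N,
        π.qvMatrix P t (some i) (some j) * (θ i * θ j) := by
  have hinc : ∀ s ∈ leftPts P t, incr P (π.schauderSeries 0 θ) s =
      ∑ i ∈ π.indexBelow N, θ i * incr P (π.schauderFun i) s := fun s hs => by
    obtain ⟨_, _, h3, h4⟩ := nextPt_mem_of_subset hP hPN hs
    simp only [incr]
    rw [schauderSeries_eq_of_mem hπ 0 θ h3, schauderSeries_eq_of_mem hπ 0 θ h4]
    simp only [mul_sub, Finset.sum_sub_distrib]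
    ring
  rw [quadVarSum_eq]
  unfold qvMatrix
  simp_rw [Finset.sum_mul]
  calc ∑ s ∈ leftPts P t, incr P (π.schauderSeries 0 θ) s ^ 2
      = ∑ s ∈ leftPts P t, ∑ i ∈ π.indexBelow N, ∑ j ∈ π.indexBelow N,
          incr P (optionBasis π (some i)) s * incr P (optionBasis π (some j)) s *
            (θ i * θ j) := by
        refine Finset.sum_congr rfl fun s hs => ?_
        rw [hinc s hs, sq, Finset.sum_mul_sum]
        refine Finset.sum_congr rfl fun i _ => Finset.sum_congr rfl fun j _ => ?_
        simp only [optionBasis]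
        ring
    _ = _ := by
        rw [Finset.sum_comm]
        exact Finset.sum_congr rfl fun i _ => Finset.sum_comm

end PartitionSeq

/-! ### Almost sure quadratic variation along coarsenings -/

section QuadraticVariation

open PartitionSeq

variable {Ω : Type*} [MeasurableSpace Ω] {μ : Measure Ω} [IsProbabilityMeasure μ]
  {π : PartitionSeq} {θ : π.SchauderIndex → Ω → ℝ}

/-- The centred sum of squares tends to zero almost surely. For a refining sequence the area of the
squares over the gaps serves as the clock; otherwise fourth moments are summable. -/
theorem ae_tendsto_quadVarSum_sub_trace (hπ : π.Refining) (hindep : iIndepFun θ μ)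
    (hθm : ∀ i, Measurable (θ i)) (hmean : ∀ i, ∫ ω, θ i ω ∂μ = 0)
    (hsq : ∀ i, ∫ ω, θ i ω ^ 2 ∂μ = 1) {M : ℝ} (hM : 0 ≤ M)
    (hθ : ∀ i, MemLp (θ i) 8 μ ∧ ∫ ω, θ i ω ^ 8 ∂μ ≤ M) {ν : PartitionSeq}
    (hν : ν.IsCoarsening π) (t : ℝ) :
    ∀ᵐ ω ∂μ, Tendsto (fun n => quadVarSum (ν.pts n) (π.schauderSeries 0 fun i => θ i ω) t -
      (∑ s ∈ leftPts (ν.pts n) t, (nextPt (ν.pts n) s - s) - squareArea (ν.pts n) t))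
      atTop (𝓝 0) := by
  obtain ⟨hsub, hmesh, hcase⟩ := hν
  have hP := fun n => ν.isPartition n
  set C := 16 * (8 * (8 * (1 + M) + 64 * (1 + M) ^ 2))
  have hC : 0 ≤ C := by positivity
  set a : ℕ → ℝ := fun n => squareArea (ν.pts n) t
  have ha0 : ∀ n, 0 ≤ a n := fun n => squareArea_nonneg _ _
  have ha : ∀ n, a n ≤ mesh (ν.pts n) := fun n => (hP n).squareArea_le_mesh t
  set S : ℕ → Ω → ℝ := fun n ω => quadVarSum (ν.pts n) (π.schauderSeries 0 fun i => θ i ω) t -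
    (∑ s ∈ leftPts (ν.pts n) t, (nextPt (ν.pts n) s - s) - squareArea (ν.pts n) t)
  have hS : ∀ n N, n ≤ N → ∀ ω, S n ω = ∑ i ∈ π.indexBelow N, ∑ j ∈ π.indexBelow N,
      π.qvMatrix (ν.pts n) t (some i) (some j) * (θ i ω * θ j ω) -
        ∑ i ∈ π.indexBelow N, π.qvMatrix (ν.pts n) t (some i) (some i) := fun n N hnN ω => by
    have hs : ν.pts n ⊆ π.pts N := (hsub n).trans (hπ n N hnN)
    simp only [S]
    rw [quadVarSum_schauderSeries_zero hπ (hP n) hs, trace_qvMatrix hπ (hP n) hs]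
  have hSL : ∀ n, MemLp (S n) 4 μ := fun n => by
    rw [show S n = _ from funext (hS n n le_rfl)]
    exact memLp_quadraticForm (fun i => (hθ i).1) _ _ _
  have hS4 : ∀ n, ∫ ω, S n ω ^ 4 ∂μ ≤ C * a n ^ 2 := fun n => by
    simp_rw [hS n n le_rfl]
    refine (fourth_moment_quadraticForm_le hindep hθm hmean hsq hM hθ (π.indexBelow n)
      (fun i j => π.qvMatrix (ν.pts n) t (some i) (some j))).trans
      (mul_le_mul_of_nonneg_left (pow_le_pow_left₀ ?_ ?_ 2) hC)
    · exact Finset.sum_nonneg fun _ _ => Finset.sum_nonneg fun _ _ => sq_nonneg _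
    · exact frobenius_qvMatrix_le hπ (hP n) (hsub n) t
  rcases hcase with href | hsum
  · have ha_anti : Antitone a := fun m n hmn =>
      squareArea_antitone hπ (hP m) (hP n) (href m n hmn) (hsub n) t
    refine ae_tendsto_zero_of_clock hC ha_anti (squeeze_zero ha0 ha hmesh) hSL hS4
      fun m n hmn => ?_
    have e : ∀ ω, S n ω - S m ω = ∑ i ∈ π.indexBelow n, ∑ j ∈ π.indexBelow n,
        (π.qvMatrix (ν.pts n) t (some i) (some j) - π.qvMatrix (ν.pts m) t (some i) (some j)) *
          (θ i ω * θ j ω) - ∑ i ∈ π.indexBelow n, (π.qvMatrix (ν.pts n) t (some i) (some i) -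
            π.qvMatrix (ν.pts m) t (some i) (some i)) := fun ω => by
      rw [hS n n le_rfl, hS m n hmn]
      simp only [sub_mul, Finset.sum_sub_distrib]
      ring
    refine (integral_congr_ae (ae_of_all _ fun ω => congrArg (fun x => x ^ 4) (e ω))).trans_le ?_
    refine (fourth_moment_quadraticForm_le hindep hθm hmean hsq hM hθ (π.indexBelow n)
      (fun i j => π.qvMatrix (ν.pts n) t (some i) (some j) -
        π.qvMatrix (ν.pts m) t (some i) (some j))).trans
      (mul_le_mul_of_nonneg_left (pow_le_pow_left₀ ?_ ?_ 2) hC)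
    · exact Finset.sum_nonneg fun _ _ => Finset.sum_nonneg fun _ _ => sq_nonneg _
    · exact frobenius_qvMatrix_sub_le hπ (hP m) (hP n) (href m n hmn) (hsub n) t
  · have hsum4 : Summable fun n => ∫ ω, S n ω ^ 4 ∂μ := by
      refine (hsum.mul_left C).of_nonneg_of_le
        (fun n => integral_nonneg fun ω => by positivity) fun n => (hS4 n).trans ?_
      refine mul_le_mul_of_nonneg_left ?_ hC
      have h1 := ha n
      have h2 := (hP n).mesh_le_one
      nlinarith [ha0 n]
    filter_upwards [ae_tendsto_zero_of_summable_integral (fun n => integrable_pow_four (hSL n))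
      (fun n ω => by positivity) hsum4] with ω hω
    exact tendsto_zero_of_pow_four hω

/-- A linear drift does not change the limit of the sums of squares. -/
theorem tendsto_quadVarSum_add_linear {ν : PartitionSeq} (hmesh : ν.VanishingMesh) {x : ℝ → ℝ}
    {t l : ℝ} (z : ℝ) (hx : Tendsto (fun n => quadVarSum (ν.pts n) x t) atTop (𝓝 l)) :
    Tendsto (fun n => quadVarSum (ν.pts n) (fun u => z * u + x u) t) atTop (𝓝 l) := by
  have ha : Tendsto (fun n => squareArea (ν.pts n) t) atTop (𝓝 0) :=
    squeeze_zero (fun n => squareArea_nonneg _ _)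
      (fun n => (ν.isPartition n).squareArea_le_mesh t) hmesh
  set cross : ℕ → ℝ := fun n => ∑ s ∈ leftPts (ν.pts n) t,
    (nextPt (ν.pts n) s - s) * incr (ν.pts n) x s
  have hcross : Tendsto cross atTop (𝓝 0) := by
    have h1 : Tendsto (fun n => √(squareArea (ν.pts n) t * quadVarSum (ν.pts n) x t)) atTop
        (𝓝 0) := by
      have h2 := (Real.continuous_sqrt.tendsto _).comp (ha.mul hx)
      rwa [zero_mul, Real.sqrt_zero] at h2
    refine squeeze_zero_norm (fun n => ?_) h1
    rw [Real.norm_eq_abs]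
    refine Real.abs_le_sqrt ?_
    rw [quadVarSum_eq]
    exact Finset.sum_mul_sq_le_sq_mul_sq _ _ _
  have e : ∀ n, quadVarSum (ν.pts n) (fun u => z * u + x u) t =
      quadVarSum (ν.pts n) x t + (2 * z * cross n + z ^ 2 * squareArea (ν.pts n) t) := fun n => by
    simp only [quadVarSum_eq, cross, squareArea, Finset.mul_sum]
    rw [← Finset.sum_add_distrib, ← Finset.sum_add_distrib]
    exact Finset.sum_congr rfl fun s _ => by simp only [incr]; ring
  simp_rw [e]
  simpa using hx.add ((hcross.const_mul (2 * z)).add (ha.const_mul (z ^ 2)))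

theorem ae_tendstoUniformlyOn_quadVarSum (hπ : π.Refining) (hindep : iIndepFun θ μ)
    (hθm : ∀ i, Measurable (θ i)) (hmean : ∀ i, ∫ ω, θ i ω ∂μ = 0)
    (hsq : ∀ i, ∫ ω, θ i ω ^ 2 ∂μ = 1) {M : ℝ} (hM : 0 ≤ M)
    (hθ : ∀ i, MemLp (θ i) 8 μ ∧ ∫ ω, θ i ω ^ 8 ∂μ ≤ M) (Z : Ω → ℝ) {ν : PartitionSeq}
    (hν : ν.IsCoarsening π) :
    ∀ᵐ ω ∂μ, TendstoUniformlyOn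
      (fun n t => quadVarSum (ν.pts n) (fun t => schauderProcess π Z θ t ω) t) (fun t => t) atTop
      (Icc 0 1) := by
  have h1 : ∀ᵐ ω ∂μ, ∀ q : ℚ, Tendsto
      (fun n => quadVarSum (ν.pts n) (π.schauderSeries 0 fun i => θ i ω) (q : ℝ) -
        (∑ s ∈ leftPts (ν.pts n) q, (nextPt (ν.pts n) s - s) - squareArea (ν.pts n) q))
      atTop (𝓝 0) :=
    ae_all_iff.2 fun q =>
      ae_tendsto_quadVarSum_sub_trace hπ hindep hθm hmean hsq hM hθ hν (q : ℝ)
  filter_upwards [h1] with ω hω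
  refine tendstoUniformlyOn_id_of_monotoneOn
    (fun n => (monotone_quadVarSum _ _).monotoneOn _) fun q hq => ?_
  have ha : Tendsto (fun n => squareArea (ν.pts n) (q : ℝ)) atTop (𝓝 0) :=
    squeeze_zero (fun n => squareArea_nonneg _ _)
      (fun n => (ν.isPartition n).squareArea_le_mesh _) hν.2.1
  have hlen : Tendsto (fun n => ∑ s ∈ leftPts (ν.pts n) (q : ℝ), (nextPt (ν.pts n) s - s)) atTop
      (𝓝 (q : ℝ)) := by
    rw [← tendsto_sub_nhds_zero_iff]
    exact squeeze_zero_norm (fun n => (ν.isPartition n).abs_sum_leftPts_sub_le hq) hν.2.1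
  have hX : Tendsto (fun n => quadVarSum (ν.pts n) (π.schauderSeries 0 fun i => θ i ω) (q : ℝ))
      atTop (𝓝 (q : ℝ)) := by
    simpa using (hω q).add (hlen.sub ha)
  have hY := tendsto_quadVarSum_add_linear hν.2.1 (Z ω) hX
  simpa [schauderProcess, schauderSeries] using hY

end QuadraticVariation

end

theorem theorem5p1 {Ω : Type*} [MeasurableSpace Ω] (μ : Measure Ω) [IsProbabilityMeasure μ]
    (π : PartitionSeq) (hbal : π.Balanced) (hcr : π.CompleteRefining)
    (Z : Ω → ℝ) (θ : π.SchauderIndex → Ω → ℝ)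
    (hZm : Measurable Z) (hθm : ∀ i, Measurable (θ i))
    -- independence: the coefficients among themselves, and `Z` of the whole family
    (hindep : iIndepFun θ μ)
    (hZindep : IndepFun Z (fun ω i => θ i ω) μ)
    -- means and variances
    (hZmean : ∫ ω, Z ω ∂μ = 0) (hZvar : variance Z μ = 1)
    (hθmean : ∀ i, ∫ ω, θ i ω ∂μ = 0) (hθvar : ∀ i, variance (θ i) μ = 1)
    -- uniform sub-Gaussian tails
    (htail : ∃ C₁ C₂ : ℝ, 0 < C₁ ∧ 0 < C₂ ∧ ∀ δ : ℝ, 0 < δ → ∀ i,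
      μ.real {ω | δ ≤ |θ i ω|} ≤ C₁ * Real.exp (-(δ ^ 2 / (2 * C₂)))) :
    -- the series converges uniformly and its sum has continuous paths
    (∀ᵐ ω ∂μ,
      TendstoUniformlyOn (fun n t => π.schauderTrunc (Z ω) (fun i => θ i ω) n t)
        (fun t => schauderProcess π Z θ t ω) atTop (Icc 0 1) ∧
      ContinuousOn (fun t => schauderProcess π Z θ t ω) (Icc 0 1)) ∧
    -- mean and covariance of Brownian motion
    (∀ t ∈ Icc (0 : ℝ) 1, MemLp (schauderProcess π Z θ t) 2 μ ∧
      ∫ ω, schauderProcess π Z θ t ω ∂μ = 0) ∧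
    (∀ t ∈ Icc (0 : ℝ) 1, ∀ s ∈ Icc (0 : ℝ) 1,
      ∫ ω, schauderProcess π Z θ t ω * schauderProcess π Z θ s ω ∂μ = min t s) ∧
    -- uncorrelated increments
    (∀ s t u v : ℝ, 0 ≤ s → s ≤ t → t ≤ u → u ≤ v → v ≤ 1 →
      ∫ ω, (schauderProcess π Z θ t ω - schauderProcess π Z θ s ω) *
        (schauderProcess π Z θ v ω - schauderProcess π Z θ u ω) ∂μ = 0) ∧
    -- Hölder continuity of every order below `1/2`
    (∀ᵐ ω ∂μ, ∀ α : ℝ≥0, α < 1 / 2 → ∃ C : ℝ≥0,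
      HolderOnWith C α (fun t => schauderProcess π Z θ t ω) (Icc 0 1)) ∧
    -- the Schauder coefficients of the paths are the given ones, and they are centred,
    -- of variance one and uncorrelated
    (∀ᵐ ω ∂μ, ∀ i, π.schauderCoeff (fun t => schauderProcess π Z θ t ω) i = θ i ω) ∧
    (∀ i, ∫ ω, π.schauderCoeff (fun t => schauderProcess π Z θ t ω) i ∂μ = 0) ∧
    (∀ i, variance (fun ω => π.schauderCoeff (fun t => schauderProcess π Z θ t ω) i) μ = 1) ∧
    (∀ i j, i ≠ j →
      ∫ ω, π.schauderCoeff (fun t => schauderProcess π Z θ t ω) i *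
        π.schauderCoeff (fun t => schauderProcess π Z θ t ω) j ∂μ = 0) ∧
    -- quadratic variation along `π` and along every coarsening, under finite fourth moments
    ((∀ i, Integrable (fun ω => θ i ω ^ 4) μ) →
      (∀ᵐ ω ∂μ, HasQuadVar π (fun t => schauderProcess π Z θ t ω) (fun t => t)) ∧
      (∀ ν : PartitionSeq, ν.IsCoarsening π →
        ∀ᵐ ω ∂μ, HasQuadVar ν (fun t => schauderProcess π Z θ t ω) (fun t => t))) := by
  obtain ⟨r, c, M, K, ρ, hg⟩ := PartitionSeq.exists_geometricBounds hbal hcr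
  have hπ : π.Refining := hg.refining
  obtain ⟨M₈, hM₈, hθ8⟩ := exists_eighth_moment_bound hθm htail
  -- first and second moments of the family consisting of `Z` and the coefficients
  have hZ2 : MemLp Z 2 μ := memLp_two_of_variance hZm hZvar
  have hθ2 : ∀ i, MemLp (θ i) 2 μ := fun i => memLp_two_of_variance (hθm i) (hθvar i)
  have hZsq : ∫ ω, Z ω ^ 2 ∂μ = 1 := by
    rw [← variance_of_integral_eq_zero hZm.aemeasurable hZmean, hZvar]
  have hθsq : ∀ i, ∫ ω, θ i ω ^ 2 ∂μ = 1 := fun i => by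
    rw [← variance_of_integral_eq_zero (hθm i).aemeasurable (hθmean i), hθvar i]
  have hθθ : ∀ i j, i ≠ j → ∫ ω, θ i ω * θ j ω ∂μ = 0 := fun i j hij => by
    rw [(hindep.indepFun hij).integral_fun_mul_eq_mul_integral (hθm i).aestronglyMeasurable
      (hθm j).aestronglyMeasurable, hθmean i, zero_mul]
  have hZθ : ∀ i, ∫ ω, Z ω * θ i ω ∂μ = 0 := fun i => by
    have hi : IndepFun Z (θ i) μ := hZindep.comp measurable_id (measurable_pi_apply i)
    rw [hi.integral_fun_mul_eq_mul_integral hZm.aestronglyMeasurable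
      (hθm i).aestronglyMeasurable, hZmean, zero_mul]
  have hψ : ∀ i, MemLp (optionFamily Z θ i) 2 μ := by
    rintro (_ | i)
    exacts [hZ2, hθ2 i]
  have hψ1 : ∀ i, ∫ ω, optionFamily Z θ i ω ^ 2 ∂μ = 1 := by
    rintro (_ | i)
    exacts [hZsq, hθsq i]
  have hψ0 : ∀ i j, i ≠ j → ∫ ω, optionFamily Z θ i ω * optionFamily Z θ j ω ∂μ = 0 := by
    rintro (_ | i) (_ | j) hij
    · exact absurd rfl hij
    · exact hZθ j
    · simp only [optionFamily, mul_comm (θ i _)]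
      exact hZθ i
    · exact hθθ i j fun h => hij (congrArg some h)
  -- pathwise properties
  have hgrow := ae_exists_linear_growth hg htail
  have hunif : ∀ᵐ ω ∂μ, TendstoUniformlyOn
      (fun n t => π.schauderTrunc (Z ω) (fun i => θ i ω) n t)
      (fun t => schauderProcess π Z θ t ω) atTop (Icc 0 1) := by
    filter_upwards [hgrow] with ω ⟨C, hC, hω⟩
    exact hg.tendstoUniformlyOn_schauderTrunc hC hω (Z ω)
  have hcont : ∀ᵐ ω ∂μ, ContinuousOn (fun t => schauderProcess π Z θ t ω) (Icc 0 1) := by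
    filter_upwards [hgrow] with ω ⟨C, hC, hω⟩
    exact hg.continuousOn_schauderSeries hC hω (Z ω)
  have hlim : ∀ u ∈ Icc (0 : ℝ) 1, ∀ᵐ ω ∂μ,
      Tendsto (fun N => π.schauderTrunc (Z ω) (fun i => θ i ω) N u) atTop
        (𝓝 (schauderProcess π Z θ u ω)) := fun u hu => by
    filter_upwards [hunif] with ω hω
    exact hω.tendsto_at hu
  have hmaj := fun {t : ℝ} (ht : t ∈ Icc (0 : ℝ) 1) => exists_sq_majorant hg hZ2 hθ2 hθsq hθθ ht
  have hL2 := memLp_schauderTrunc (μ := μ) (π := π) hZ2 hθ2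
  have hmem : ∀ t ∈ Icc (0 : ℝ) 1, MemLp (schauderProcess π Z θ t) 2 μ := fun t ht =>
    memLp_schauderProcess (hlim t ht) (fun N => hL2 N t) (hmaj ht)
  have hcov : ∀ t ∈ Icc (0 : ℝ) 1, ∀ s ∈ Icc (0 : ℝ) 1,
      ∫ ω, schauderProcess π Z θ t ω * schauderProcess π Z θ s ω ∂μ = min t s :=
    fun t ht s hs => integral_schauderProcess_mul hg ht hs hψ hψ1 hψ0 hlim
  have hcoeff : ∀ ω i, π.schauderCoeff (fun t => schauderProcess π Z θ t ω) i = θ i ω :=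
    fun ω => PartitionSeq.schauderCoeff_schauderSeries hπ (Z ω) fun i => θ i ω
  have hQV : ∀ ν : PartitionSeq, ν.IsCoarsening π →
      ∀ᵐ ω ∂μ, HasQuadVar ν (fun t => schauderProcess π Z θ t ω) (fun t => t) := fun ν hν => by
    filter_upwards [hcont, ae_tendstoUniformlyOn_quadVarSum hπ hindep hθm hθmean hθsq hM₈ hθ8 Z hν]
      with ω h1 h2
    exact ⟨h1, continuousOn_id, h2⟩
  refine ⟨hunif.and hcont, fun t ht => ⟨hmem t ht, ?_⟩, hcov, ?_, ?_, ae_of_all _ hcoeff,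
    fun i => ?_, fun i => ?_, fun i j hij => ?_, fun _ => ⟨hQV π ?_, hQV⟩⟩
  · refine tendsto_nhds_unique
      (tendsto_integral_schauderTrunc (hlim t ht) (fun N => hL2 N t) (hmaj ht)) ?_
    simp_rw [integral_schauderTrunc hZ2 hθ2 hZmean hθmean]
    exact tendsto_const_nhds
  · intro s t u v h0 hst htu huv h1
    have hs : s ∈ Icc (0 : ℝ) 1 := ⟨h0, by linarith⟩
    have ht : t ∈ Icc (0 : ℝ) 1 := ⟨by linarith, by linarith⟩
    have hu : u ∈ Icc (0 : ℝ) 1 := ⟨by linarith, by linarith⟩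
    have hv : v ∈ Icc (0 : ℝ) 1 := ⟨by linarith, h1⟩
    have hint : ∀ p ∈ Icc (0 : ℝ) 1, ∀ q ∈ Icc (0 : ℝ) 1, Integrable
        (fun ω => schauderProcess π Z θ p ω * schauderProcess π Z θ q ω) μ :=
      fun p hp q hq => (hmem p hp).integrable_mul (hmem q hq)
    have hdiff : ∀ p ∈ Icc (0 : ℝ) 1, Integrable
        (fun ω => schauderProcess π Z θ p ω * schauderProcess π Z θ v ω -
          schauderProcess π Z θ p ω * schauderProcess π Z θ u ω) μ :=
      fun p hp => (hint p hp v hv).sub (hint p hp u hu)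
    have e : ∀ ω, (schauderProcess π Z θ t ω - schauderProcess π Z θ s ω) *
        (schauderProcess π Z θ v ω - schauderProcess π Z θ u ω) =
        (schauderProcess π Z θ t ω * schauderProcess π Z θ v ω -
          schauderProcess π Z θ t ω * schauderProcess π Z θ u ω) -
        (schauderProcess π Z θ s ω * schauderProcess π Z θ v ω -
          schauderProcess π Z θ s ω * schauderProcess π Z θ u ω) := fun ω => by ring
    simp_rw [e]
    rw [integral_sub (hdiff t ht) (hdiff s hs), integral_sub (hint t ht v hv) (hint t ht u hu),
      integral_sub (hint s hs v hv) (hint s hs u hu), hcov t ht v hv, hcov t ht u hu, hcov s hs v hv, hcov s hs u hu, min_eq_left (by linarith),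
      min_eq_left htu, min_eq_left (by linarith), min_eq_left (by linarith)]
    ring
  · filter_upwards [hgrow] with ω ⟨C, hC, hω⟩ α hα
    exact hg.exists_holderOnWith_schauderSeries hC hω (Z ω) hα
  · simp_rw [hcoeff]
    exact hθmean i
  · simp_rw [hcoeff]
    exact hθvar i
  · simp_rw [hcoeff]
    exact hθθ i j hij
  · exact ⟨fun n => Finset.Subset.refl _, tendsto_mesh hg, Or.inl hπ⟩
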